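/- Let $\mathcal S$ be a finite set, $p$ a probability vector on $\mathcal S$, $Q$ an intensity matrix on $\mathcal S$ (nonnegative off-diagonal entries, zero row sums), $\mu_i\in\mathbb R$ and $\sigma_i>0$ for $i\in\mathcal S$. Let $\lambda_0=2\max_i|Q_{ii}|$ and let $\lambda_0\le\lambda_1\le\cdots$ tend to infinity. On a probability space let $B$ be a standard Brownian motion, $M^0$ a Poisson process of rate $\lambda_0/2$, $\widetilde M^\ell$ ($\ell\ge1$) Poisson processes of rate $(\lambda_\ell-\lambda_{\ell-1})/2$, and $X^0$ a discrete-time Markov chain with initial law $p$ and transition matrix $I+(\lambda_0/2)^{-1}Q$ (equal to $I$ if $Q=0$), all mutually independent. Put $J(t)=X^0(M^0(t))$ and let $$R(t)=\int_0^t\mu_{J(s)}\,ds+\int_0^t\sigma_{J(s)}\,dB(s)$$ be the Markov-modulated Brownian motion (MMBM). For $n\ge0$ with $\lambda_n>0$ let $0=\theta^n_0<\theta^n_1<\cdots$ be the arrival epochs of $M^n=M^0+\sum_{\ell=1}^n\widetilde M^\ell$, preceded by $0$, let $X^n(k)=J(\theta^n_k)$, and let $L^n_{k+1}$, $H^n_{k+1}$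 be $R(\theta^n_k)$, respectively $R(\theta^n_{k+1})$, minus $\min_{[\theta^n_k,\theta^n_{k+1}]}R$. Put $$\omega^n_i=\sqrt{\tfrac{\mu_i^2}{\sigma_i^4}+\tfrac{\lambda_n}{\sigma_i^2}}+\tfrac{\mu_i}{\sigma_i^2},\qquad \eta^n_i=\sqrt{\tfrac{\mu_i^2}{\sigma_i^4}+\tfrac{\lambda_n}{\sigma_i^2}}-\tfrac{\mu_i}{\sigma_i^2},$$ and, with $i=X^n(k)$, $\widehat L^n_{k+1}=\lambda_n^{-1}\omega^n_iL^n_{k+1}$, $\widehat H^n_{k+1}=\lambda_n^{-1}\eta^n_iH^n_{k+1}$, and $\chi^n_k=\sum_{j=1}^k(\widehat L^n_j+\widehat H^n_j)$. Let $J^n(t)=(-,X^n(k))$ for $t\in[\chi^n_k,\chi^n_k+\widehat L^n_{k+1})$ and $J^n(t)=(+,X^n(k))$ for $t\in[\chi^n_k+\widehat L^n_{k+1},\chi^n_{k+1})$, and let $R^n(t)=\int_0^tr^n(J^n(s))\,ds$ with $r^n(+,i)=\lambda_n/\eta^n_i$ and $r^n(-,i)=-\lambda_n/\omega^n_i$.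 Let $\pi_2$ be the projection on the second coordinate, and $\tau_x=\inf\{s\ge0:R(s)<-x\}$, $\tau^n_x=\inf\{s\ge0:R^n(s)<-x\}$ for $x\ge0$. The processes $\{J(\tau_x)\}_{x\ge0}$ and $\{\pi_2(J^n(\tau^n_x))\}_{x\ge0}$ are killed when $\tau_x=\infty$, respectively $\tau^n_x=\infty$. A generator $U$ of such a possibly killed process is a matrix with nonnegative off-diagonal entries and nonpositive row sums such that the process is Markov, in the variable $x$, with transition semigroup $e^{xU}$ on $\mathcal S$. Then $\{J(\tau_x)\}_{x\ge0}$ has a generator $U$ that solves $$X^2+2\Delta_\mu\Delta_\sigma^{-2}X+2\Delta_\sigma^{-2}Q=0,\qquad \Delta_\mu=\mathrm{diag}(\mu_i),\ \Delta_\sigma=\mathrm{diag}(\sigma_i),$$ and, for every $n\ge0$ with $\lambda_n>0$, the same $U$ is a generator $U_n$ of $\{\pi_2(J^n(\tau^n_x))\}_{x\ge0}$ and $$U=U_n=\lambda_n\Delta_{r^n_-}^{-1}(\Psi_n-I),$$ where $\Delta_{r^n_\pm}=\mathrm{diag}(|r^n(\pm,i)|)$ and $\Psi_n$ is the (entrywise)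 minimal nonnegative solution, which exists, of the Riccati equation $$\Delta_{r^n_+}^{-1}(-\lambda_nI)\Psi+\Psi\Delta_{r^n_-}^{-1}(-\lambda_nI)+\Psi\Delta_{r^n_-}^{-1}(\lambda_nI)\Psi+\Delta_{r^n_+}^{-1}(2Q+\lambda_nI)=0 .$$ If all $p_i>0$, each of these processes has exactly one generator, so that $U$ is the generator of all of them. -/

import Mathlib

open MeasureTheory ProbabilityTheory Filter
open scoped NNReal Topology

noncomputable section

namespace MMBM

/-! ### Parameters and driving processes -/

/-- The parameters: initial law `p` and intensity matrix `Q` of the phase process on the finite set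
`S`, drifts `μ`, volatilities `σ > 0`, and observation intensities `lam n` (that is, `λ_n`) with
`λ_0 = 2 max_i |Q_ii|`, nondecreasing and tending to infinity. -/
structure Params (S : Type*) [Fintype S] where
  p : S → ℝ
  Q : Matrix S S ℝ
  μ : S → ℝ
  σ : S → ℝ
  lam : ℕ → ℝ
  p_nonneg : ∀ i, 0 ≤ p i
  p_sum : ∑ i, p i = 1
  Q_offDiag : ∀ i j, i ≠ j → 0 ≤ Q i j
  Q_rowSum : ∀ i, ∑ j, Q i j = 0
  σ_pos : ∀ i, 0 < σ i
  lam_zero : lam 0 = 2 * ⨆ i, |Q i i|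
  lam_mono : Monotone lam
  lam_tendsto : Tendsto lam atTop atTop

/-- The driving processes on `Ω`: a real process `B`, counting processes `N ℓ`
(`N 0` is the process `M⁰`, and `N ℓ` for `ℓ ≥ 1` the extra arrivals added at stage `ℓ`),
and a discrete-time chain `X`. -/
structure Drivers (S Ω : Type*) where
  B : ℝ≥0 → Ω → ℝ
  N : ℕ → ℝ≥0 → Ω → ℕ
  X : ℕ → Ω → S

/-- `A` is (the counting process of) a Poisson process of rate `r`; `r = 0` is allowed. -/
structure IsPoissonProcess {Ω : Type*} [MeasurableSpace Ω] (A : ℝ≥0 → Ω → ℕ) (r : ℝ≥0)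
    (P : Measure Ω) : Prop where
  measurable : ∀ t, Measurable (A t)
  zero : ∀ᵐ ω ∂P, A 0 ω = 0
  mono : ∀ᵐ ω ∂P, Monotone (fun t => A t ω)
  rightCont : ∀ᵐ ω ∂P, ∀ t, ContinuousWithinAt (fun s => A s ω) (Set.Ici t) t
  indep : HasIndepIncrements (fun t ω => (A t ω : ℝ)) P
  law : ∀ s t : ℝ≥0, s ≤ t → HasLaw (fun ω => A t ω - A s ω) (poissonMeasure (r * (t - s))) P

/-- `X` is a discrete-time Markov chain with initial law `p` and transition matrix `K`. -/
structure IsMarkovChain {S Ω : Type*} [MeasurableSpace S] [MeasurableSpace Ω] (X : ℕ → Ω → S)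
    (p : S → ℝ) (K : Matrix S S ℝ) (P : Measure Ω) : Prop where
  measurable : ∀ k, Measurable (X k)
  law : ∀ (m : ℕ) (i : ℕ → S), P.real {ω | ∀ k ≤ m, X k ω = i k} =
    p (i 0) * ∏ k ∈ Finset.range m, K (i k) (i (k + 1))

/-- Labels of the independent sources of randomness. -/
inductive Source
  | brownian
  | poisson (ℓ : ℕ)
  | chain

/-- The σ-algebra generated by each driving process. -/
@[reducible]
def Drivers.sigma {S Ω : Type*} [MeasurableSpace S] (W : Drivers S Ω) : Source → MeasurableSpace Ω
  | .brownian => MeasurableSpace.comap (fun ω t => W.B t ω) inferInstance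
  | .poisson ℓ => MeasurableSpace.comap (fun ω t => W.N ℓ t ω) inferInstance
  | .chain => MeasurableSpace.comap (fun ω k => W.X k ω) inferInstance

/-- The driving processes have the prescribed laws and are mutually independent: a standard Brownian
motion, Poisson processes of rates `λ_0 / 2` and `(λ_ℓ - λ_{ℓ-1}) / 2`, and a Markov chain with
transition matrix `I + (λ_0 / 2)⁻¹ Q` (which is `I` when `Q = 0`). -/
structure Drivers.HasLaws {S Ω : Type*} [Fintype S] [DecidableEq S] [MeasurableSpace S]
    [MeasurableSpace Ω] (W : Drivers S Ω) (D : Params S) (P : Measure Ω) : Prop where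
  brownian : IsBrownianReal W.B P
  brownian_measurable : ∀ t, Measurable (W.B t)
  poisson_zero : IsPoissonProcess (W.N 0) (D.lam 0 / 2).toNNReal P
  poisson_succ : ∀ ℓ, IsPoissonProcess (W.N (ℓ + 1)) ((D.lam (ℓ + 1) - D.lam ℓ) / 2).toNNReal P
  chain : IsMarkovChain W.X D.p (1 + (D.lam 0 / 2)⁻¹ • D.Q) P
  indep : iIndep W.sigma P

/-! ### The Markov-modulated Brownian motion -/

section Construction

variable {S Ω : Type*} [Fintype S] (D : Params S) (W : Drivers S Ω)

/-- The superposed counting process `Mⁿ`. -/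
def M (n : ℕ) (t : ℝ≥0) (ω : Ω) : ℕ := ∑ ℓ ∈ Finset.range (n + 1), W.N ℓ t ω

/-- The arrival epochs `θⁿ_k` of `Mⁿ`, with `θⁿ_0 = 0`. -/
def theta (n k : ℕ) (ω : Ω) : ℝ≥0 := sInf {t : ℝ≥0 | k ≤ M W n t ω}

/-- The phase process `J(t) = X(M⁰(t))`. -/
def J (t : ℝ≥0) (ω : Ω) : S := W.X (M W 0 t ω) ω

/-- The stochastic integral `∫₀ᵗ σ_{J(s)} dB(s)`. The integrand is piecewise constant, with value
`σ_{X(k)}` between the arrival epochs `θ⁰_k` and `θ⁰_{k+1}`, so the integral is the usual sum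
of Brownian increments; the last one runs from the last arrival before `t` to `t`. -/
def stochInt (t : ℝ≥0) (ω : Ω) : ℝ :=
  (∑ k ∈ Finset.range (M W 0 t ω),
      D.σ (W.X k ω) * (W.B (theta W 0 (k + 1) ω) ω - W.B (theta W 0 k ω) ω)) +
    D.σ (W.X (M W 0 t ω) ω) * (W.B t ω - W.B (theta W 0 (M W 0 t ω) ω) ω)

/-- The level process `R(t) = ∫₀ᵗ μ_{J(s)} ds + ∫₀ᵗ σ_{J(s)} dB(s)`. -/
def R (t : ℝ≥0) (ω : Ω) : ℝ :=
  (∫ s in (0 : ℝ)..t, D.μ (J W s.toNNReal ω)) + stochInt D W t ω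

/-! ### The embedded stochastic fluid process -/

/-- The embedded chain `Xⁿ(k) = J(θⁿ_k)`. -/
def Xn (n k : ℕ) (ω : Ω) : S := J W (theta W n k ω) ω

/-- The minimum of `R` over `[θⁿ_k, θⁿ_{k+1}]`. -/
def minR (n k : ℕ) (ω : Ω) : ℝ :=
  sInf ((fun t => R D W t ω) '' Set.Icc (theta W n k ω) (theta W n (k + 1) ω))

/-- `Lⁿ_{k+1} = R(θⁿ_k) - min R`. -/
def L (n k : ℕ) (ω : Ω) : ℝ := R D W (theta W n k ω) ω - minR D W n k ω

/-- `Hⁿ_{k+1} = R(θⁿ_{k+1}) - min R`. -/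
def H (n k : ℕ) (ω : Ω) : ℝ := R D W (theta W n (k + 1) ω) ω - minR D W n k ω

/-- `ωⁿ_i = √(μ_i²/σ_i⁴ + λ_n/σ_i²) + μ_i/σ_i²`. -/
def omegaRate (n : ℕ) (i : S) : ℝ :=
  √(D.μ i ^ 2 / D.σ i ^ 4 + D.lam n / D.σ i ^ 2) + D.μ i / D.σ i ^ 2

/-- `ηⁿ_i = √(μ_i²/σ_i⁴ + λ_n/σ_i²) - μ_i/σ_i²`. -/
def etaRate (n : ℕ) (i : S) : ℝ :=
  √(D.μ i ^ 2 / D.σ i ^ 4 + D.lam n / D.σ i ^ 2) - D.μ i / D.σ i ^ 2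

/-- The rescaled `Lⁿ_{k+1}`: the duration of the descent in the `k`-th cycle. -/
def Lhat (n k : ℕ) (ω : Ω) : ℝ := (D.lam n)⁻¹ * omegaRate D n (Xn W n k ω) * L D W n k ω

/-- The rescaled `Hⁿ_{k+1}`: the duration of the ascent in the `k`-th cycle. -/
def Hhat (n k : ℕ) (ω : Ω) : ℝ := (D.lam n)⁻¹ * etaRate D n (Xn W n k ω) * H D W n k ω

/-- The epochs `χⁿ_k` at which the cycles of the fluid process start. -/
def chi (n k : ℕ) (ω : Ω) : ℝ := ∑ j ∈ Finset.range k, (Lhat D W n j ω + Hhat D W n j ω)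

/-- The index `k` of the cycle with `χⁿ_k ≤ t < χⁿ_{k+1}`. -/
def cycle (n : ℕ) (t : ℝ≥0) (ω : Ω) : ℕ := sSup {k : ℕ | chi D W n k ω ≤ t}

/-- The directions `+` and `-` of a fluid process. -/
inductive Dir
  | plus
  | minus

/-- The phase process `Jⁿ` on `{+,-} × S`: direction `-` on `[χⁿ_k, χⁿ_k + L̂ⁿ_{k+1})` and `+` on
`[χⁿ_k + L̂ⁿ_{k+1}, χⁿ_{k+1})`, second coordinate `Xⁿ(k)`. -/
def Jn (n : ℕ) (t : ℝ≥0) (ω : Ω) : Dir × S :=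
  (if (t : ℝ) < chi D W n (cycle D W n t ω) ω + Lhat D W n (cycle D W n t ω) ω
      then Dir.minus else Dir.plus,
    Xn W n (cycle D W n t ω) ω)

/-- The fluid rates: `rⁿ(+,i) = λ_n/ηⁿ_i` and `rⁿ(-,i) = -λ_n/ωⁿ_i`. -/
def rate (n : ℕ) : Dir × S → ℝ
  | (Dir.plus, i) => D.lam n / etaRate D n i
  | (Dir.minus, i) => -(D.lam n / omegaRate D n i)

/-- The fluid level `Rⁿ(t) = ∫₀ᵗ rⁿ(Jⁿ(s)) ds`. -/
def Rn (n : ℕ) (t : ℝ≥0) (ω : Ω) : ℝ :=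
  ∫ s in (0 : ℝ)..t, rate D n (Jn D W n s.toNNReal ω)

end Construction

/-! ### Down-crossing phase processes and their generators -/

/-- `τ_x = inf {s ≥ 0 : Z(s) < -x}`, equal to `⊤` when there is no such `s`. -/
def tau {Ω : Type*} (Z : ℝ≥0 → Ω → ℝ) (x : ℝ≥0) (ω : Ω) : WithTop ℝ≥0 :=
  hittingAfter Z (Set.Iio (-(x : ℝ))) 0 ω

/-- The down-crossing phase process `x ↦ K(τ_x)` of a level process `Z` with phase `K`;
it is sent to the cemetery `⊤` when `τ_x = ∞`. -/
def downPhase {S Ω : Type*} (Z : ℝ≥0 → Ω → ℝ) (K : ℝ≥0 → Ω → S) (x : ℝ≥0) (ω : Ω) : WithTop S :=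
  (tau Z x ω).map (fun t => K t ω)

/-- The (possibly terminating) process `Y` on the finite set `S`, with cemetery `⊤`, is a
time-homogeneous Markov jump process with infinitesimal generator `U`: `U` has nonnegative
off-diagonal entries and nonpositive row sums, `⊤` is absorbing, and the finite-dimensional
laws are governed by the semigroup `exp (x U)`. -/
structure IsGenerator {S Ω : Type*} [Fintype S] [DecidableEq S] [MeasurableSpace Ω]
    (P : Measure Ω) (Y : ℝ≥0 → Ω → WithTop S) (U : Matrix S S ℝ) : Prop where
  offDiag : ∀ i j, i ≠ j → 0 ≤ U i j
  rowSum : ∀ i, ∑ j, U i j ≤ 0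
  absorbing : ∀ x y : ℝ≥0, x ≤ y → ∀ᵐ ω ∂P, Y x ω = ⊤ → Y y ω = ⊤
  markov : ∀ (m : ℕ) (x : ℕ → ℝ≥0), Monotone x → ∀ i : ℕ → S,
    P.real {ω | ∀ k ≤ m, Y (x k) ω = i k} =
      P.real {ω | Y (x 0) ω = i 0} *
        ∏ k ∈ Finset.range m,
          NormedSpace.exp (((x (k + 1) : ℝ) - (x k : ℝ)) • U) (i k) (i (k + 1))

/-! ### Matrix equations -/

section Equations

variable {S : Type*} [Fintype S] [DecidableEq S] (D : Params S)

/-- The inverse of `diag (rⁿ(+,i))`. -/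
def rPlusInv (n : ℕ) : Matrix S S ℝ := Matrix.diagonal fun i => (rate D n (Dir.plus, i))⁻¹

/-- The inverse of `diag |rⁿ(-,i)|`. -/
def rMinusInv (n : ℕ) : Matrix S S ℝ := Matrix.diagonal fun i => |rate D n (Dir.minus, i)|⁻¹

/-- The fluid Riccati equation, with the blocks `T₊₊ = -λI`, `T₊₋ = 2Q + λI`, `T₋₊ = λI`,
`T₋₋ = -λI` of the intensity matrix of `Jⁿ` written out. -/
def IsRiccatiSolution (n : ℕ) (Ψ : Matrix S S ℝ) : Prop :=
  rPlusInv D n * (-(D.lam n • (1 : Matrix S S ℝ))) * Ψ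
    + Ψ * rMinusInv D n * (-(D.lam n • (1 : Matrix S S ℝ)))
    + Ψ * rMinusInv D n * (D.lam n • (1 : Matrix S S ℝ)) * Ψ
    + rPlusInv D n * ((2 : ℝ) • D.Q + D.lam n • (1 : Matrix S S ℝ)) = 0

/-- The (entrywise) minimal nonnegative solution of the fluid Riccati equation. -/
structure IsMinimalRiccatiSolution (n : ℕ) (Ψ : Matrix S S ℝ) : Prop where
  nonneg : ∀ i j, 0 ≤ Ψ i j
  solution : IsRiccatiSolution D n Ψ
  minimal : ∀ Φ : Matrix S S ℝ, (∀ i j, 0 ≤ Φ i j) → IsRiccatiSolution D n Φ →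
    ∀ i j, Ψ i j ≤ Φ i j

/-- The quadratic equation `X² + 2 Δ_μ Δ_σ⁻² X + 2 Δ_σ⁻² Q = 0`. -/
def IsQuadraticSolution (X : Matrix S S ℝ) : Prop :=
  X ^ 2
    + (2 : ℝ) • (Matrix.diagonal D.μ * Matrix.diagonal (fun i => (D.σ i ^ 2)⁻¹) * X)
    + (2 : ℝ) • (Matrix.diagonal (fun i => (D.σ i ^ 2)⁻¹) * D.Q) = 0

end Equations

end MMBM

end

open scoped ENNReal

noncomputable section

set_option linter.unusedSectionVars false

namespace MMBM

/-! ### Rates and matrix equations -/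

section Rates

variable {S : Type*} [Fintype S] (D : Params S)

/-! Probability enters at a single observation stage, the first `n₀` with `λ_{n₀} > 0`. All other
stages are reached by a pathwise identity for the processes and by algebra for the matrix equations.

Pathwise part. On a cycle `[θ_k, θ_{k+1}]` the MMBM is a Brownian motion with constant drift and
volatility, and the fluid replaces it by a straight descent followed by a straight ascent with the
same starting level, minimum, end level and phase. For either process the phase at the first passage
below `-x` is the phase of the first cycle whose minimum is below `-x`, and for `R` this is so
whichever stage is used to cut the path (`downPhase_R_eq_iff`, `downPhase_Rn_eq_iff`). Hence all the
phase processes of the theorem coincide almost surely. What must be excluded is that the fluid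
cycles accumulate at a finite time: then `R` would converge along the epochs of stage `n` and the
descents of stage `n₀` would tend to `0` (`exists_lt_chi`), an event of probability zero
(`ae_not_tendsto_descent`).

Probabilistic part. At stage `n₀` the path is cut by a Poisson process of rate `λ/2` independent of
the embedded chain; if `n₀ > 0`, then `Q = 0` and the phase is almost surely constant. By the
Wiener–Hopf factorization (`map_arrivalBlock_apply`) the depth and the height of a Brownian motion
with drift over an exponential time are independent and exponential, of rates `ω_i` and `η_i`. This
follows from the strong Markov property at a passage time and the explicit characteristic function
of the end point. Depth and height are recorded for every phase `i` at once, so that the blocks do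
not depend on the chain, and blocks and chain form an `IsCycleChain`. The probabilities of crossing
`-x` within `r` cycles obey a renewal recursion. By memorylessness their limits form a semigroup,
and differentiating the renewal equation identifies it as `exp (x U)` with `U = Δ_ω (Ψ - I)`, where
`Ψ` collects the phases at the return to the starting level after an ascent (`crossMatrix_eq_exp`).
The Markov property at first crossings then gives the finite-dimensional laws (`measure_phaseHit`).

Matrix equations. Since `Ψ = ∫ η e^{-ηl} K e^{lU} dl`, integration by parts gives the Riccati
equation at stage `n₀` (`isFluidSolution_returnMatrix`). If `Φ ≥ 0` is another solution, induction
on the number of cycles bounds the crossing probabilities by `exp (x Δ_ω (Φ - I))`; comparing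
derivatives at `0` gives `Ψ ≤ Φ` (`returnMatrix_le`). Under `U = Δ_ω (Ψ - I)` the Riccati equation
of any stage becomes the same quadratic equation, free of `λ_n`, and nonnegative `Ψ` correspond, in
an order-preserving way, to solutions `U` with nonnegative off-diagonal entries. So minimality at
`n₀` gives minimality at every stage (`isMinimalRiccatiSolution_of_isFluidSolution`). -/

lemma lt_sqrt_sq_div_add {m s l : ℝ} (hs : 0 < s) (hl : 0 < l) :
    |m / s ^ 2| < √(m ^ 2 / s ^ 4 + l / s ^ 2) := by
  rw [← Real.sqrt_sq_eq_abs]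
  apply Real.sqrt_lt_sqrt (by positivity)
  have : (m / s ^ 2) ^ 2 = m ^ 2 / s ^ 4 := by rw [div_pow]; ring
  rw [this]
  have : 0 < l / s ^ 2 := by positivity
  linarith

variable {D} {n : ℕ}

lemma omegaRate_pos (hn : 0 < D.lam n) (i : S) : 0 < omegaRate D n i := by
  have h := lt_sqrt_sq_div_add (m := D.μ i) (D.σ_pos i) hn
  have := (abs_lt.1 h).1
  unfold omegaRate
  linarith

lemma etaRate_pos (hn : 0 < D.lam n) (i : S) : 0 < etaRate D n i := by
  have h := lt_sqrt_sq_div_add (m := D.μ i) (D.σ_pos i) hn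
  have := (abs_lt.1 h).2
  unfold etaRate
  linarith

lemma omegaRate_sub_etaRate (i : S) :
    omegaRate D n i - etaRate D n i = 2 * (D.μ i * (D.σ i ^ 2)⁻¹) := by
  unfold omegaRate etaRate
  ring

lemma omegaRate_mul_etaRate (hn : 0 < D.lam n) (i : S) :
    omegaRate D n i * etaRate D n i = D.lam n * (D.σ i ^ 2)⁻¹ := by
  have h : 0 ≤ D.μ i ^ 2 / D.σ i ^ 4 + D.lam n / D.σ i ^ 2 := by
    have := D.σ_pos i
    positivity
  have h2 := Real.mul_self_sqrt h
  have : omegaRate D n i * etaRate D n i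
      = √(D.μ i ^ 2 / D.σ i ^ 4 + D.lam n / D.σ i ^ 2) *
        √(D.μ i ^ 2 / D.σ i ^ 4 + D.lam n / D.σ i ^ 2) - (D.μ i / D.σ i ^ 2) ^ 2 := by
    unfold omegaRate etaRate
    ring
  rw [this, h2, div_pow]
  ring

lemma abs_Q_diag_le (D : Params S) (n : ℕ) (i : S) : 2 * |D.Q i i| ≤ D.lam n := by
  have h : |D.Q i i| ≤ ⨆ j, |D.Q j j| :=
    le_ciSup (f := fun j => |D.Q j j|) (Set.finite_range _).bddAbove i
  have := D.lam_mono (Nat.zero_le n)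
  rw [D.lam_zero] at this
  linarith

variable [DecidableEq S]

/-- The transition matrix `I + (λ_n / 2)⁻¹ Q` of the embedded chain. -/
def embeddedMatrix (D : Params S) (n : ℕ) : Matrix S S ℝ := 1 + (D.lam n / 2)⁻¹ • D.Q

lemma embeddedMatrix_nonneg (hn : 0 < D.lam n) (i j : S) : 0 ≤ embeddedMatrix D n i j := by
  simp only [embeddedMatrix, Matrix.add_apply, Matrix.smul_apply, smul_eq_mul]
  by_cases hij : i = j
  · subst hij
    have h := abs_Q_diag_le D n i
    have h2 := neg_abs_le (D.Q i i)
    rw [Matrix.one_apply_eq]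
    have : -1 ≤ (D.lam n / 2)⁻¹ * D.Q i i := by
      rw [inv_mul_eq_div, le_div_iff₀ (by positivity)]
      linarith
    linarith
  · rw [Matrix.one_apply_ne hij]
    have := D.Q_offDiag i j hij
    positivity

lemma embeddedMatrix_rowSum (i : S) : ∑ j, embeddedMatrix D n i j = 1 := by
  simp only [embeddedMatrix, Matrix.add_apply, Matrix.smul_apply, smul_eq_mul,
    Finset.sum_add_distrib, ← Finset.mul_sum, D.Q_rowSum, mul_zero, add_zero]
  simp [Matrix.one_apply]

/-- The equation `-η_i Ψ_ij + ∑ k, Ψ_ik ω_k (Ψ - I)_kj + η_i K_ij = 0`, for rates `ω, η` and a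
transition matrix `K`. -/
def IsFluidSolution (om et : S → ℝ) (K Ψ : Matrix S S ℝ) : Prop :=
  ∀ i j, et i * Ψ i j = et i * K i j + ∑ k, Ψ i k * (om k * (Ψ - 1) k j)

/-- Since `r₊⁻¹ = η/λ`, `r₋⁻¹ = ω/λ` and `2Q + λI = λK` with `K` the embedded transition matrix,
every factor `λ` cancels. -/
lemma isRiccatiSolution_iff (hn : 0 < D.lam n) (Ψ : Matrix S S ℝ) :
    IsRiccatiSolution D n Ψ ↔
      IsFluidSolution (omegaRate D n) (etaRate D n) (embeddedMatrix D n) Ψ := by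
  have hp : rPlusInv D n = (D.lam n)⁻¹ • Matrix.diagonal (etaRate D n) := by
    ext i j
    by_cases h : i = j <;>
      simp [rPlusInv, rate, h, div_eq_inv_mul]
  have hm : rMinusInv D n = (D.lam n)⁻¹ • Matrix.diagonal (omegaRate D n) := by
    ext i j
    by_cases h : i = j
    · subst h
      have := omegaRate_pos hn i
      simp [rMinusInv, rate, div_eq_inv_mul, abs_of_pos hn, abs_of_pos this]
    · simp [rMinusInv, h]
  have key : ∀ i j, (rPlusInv D n * (-(D.lam n • (1 : Matrix S S ℝ))) * Ψ
    + Ψ * rMinusInv D n * (-(D.lam n • (1 : Matrix S S ℝ)))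
    + Ψ * rMinusInv D n * (D.lam n • (1 : Matrix S S ℝ)) * Ψ
    + rPlusInv D n * ((2 : ℝ) • D.Q + D.lam n • (1 : Matrix S S ℝ))) i j =
      -(etaRate D n i * Ψ i j) + ∑ k, Ψ i k * (omegaRate D n k * (Ψ - 1) k j)
        + etaRate D n i * embeddedMatrix D n i j := by
    intro i j
    have e1 : ∑ k, Ψ i k * (omegaRate D n k * (Ψ - 1) k j) =
        (Ψ * (Matrix.diagonal (omegaRate D n) * (Ψ - 1))) i j := by
      rw [Matrix.mul_apply]
      simp [Matrix.diagonal_mul]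
    have e2 : etaRate D n i * Ψ i j = (Matrix.diagonal (etaRate D n) * Ψ) i j := by
      rw [Matrix.diagonal_mul]
    have e3 : etaRate D n i * embeddedMatrix D n i j =
        (Matrix.diagonal (etaRate D n) * embeddedMatrix D n) i j := by
      rw [Matrix.diagonal_mul]
    rw [e1, e2, e3, hp, hm, ← Matrix.neg_apply, ← Matrix.add_apply, ← Matrix.add_apply]
    refine congrFun (congrFun ?_ i) j
    have hl : D.lam n ≠ 0 := hn.ne'
    have : embeddedMatrix D n = (D.lam n)⁻¹ • ((2 : ℝ) • D.Q + D.lam n • 1) := by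
      rw [smul_add, smul_smul, smul_smul, inv_mul_cancel₀ hl, one_smul, embeddedMatrix, add_comm,
        inv_div, div_eq_inv_mul]
    rw [this]
    simp only [Matrix.smul_mul, Matrix.mul_smul, mul_neg, neg_mul, mul_one, smul_smul, mul_sub,
      mul_inv_cancel₀ hl, one_smul, Matrix.mul_assoc]
    abel
  unfold IsRiccatiSolution IsFluidSolution
  rw [← Matrix.ext_iff]
  refine forall_congr' fun i => forall_congr' fun j => ?_
  rw [key, Matrix.zero_apply]
  constructor <;> intro h <;> linarith

lemma isQuadraticSolution_iff (U : Matrix S S ℝ) :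
    IsQuadraticSolution D U ↔ ∀ i j, ∑ k, U i k * U k j
      + 2 * (D.μ i * (D.σ i ^ 2)⁻¹) * U i j + 2 * ((D.σ i ^ 2)⁻¹ * D.Q i j) = 0 := by
  unfold IsQuadraticSolution
  rw [← Matrix.ext_iff]
  refine forall_congr' fun i => forall_congr' fun j => ?_
  rw [Matrix.add_apply, Matrix.add_apply, pow_two, Matrix.mul_apply, Matrix.smul_apply,
    Matrix.smul_apply, Matrix.diagonal_mul_diagonal, Matrix.diagonal_mul, Matrix.diagonal_mul,
    smul_eq_mul, smul_eq_mul, Matrix.zero_apply, ← mul_assoc (2 : ℝ) (D.μ i * (D.σ i ^ 2)⁻¹)]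

/-- Multiply row `i` by `ω_i` and substitute `ω_i Ψ_ik = U_ik + ω_i δ_ik`. The terms in `ω_i η_i
δ_ij` cancel, the linear term has coefficient `ω_i - η_i = 2μ_i/σ_i²`, and `ω_i η_i = λ_n/σ_i²`
absorbs the `λ_n⁻¹` of the embedded matrix. The stage `n` thus disappears from the equation for `U`.
-/
lemma isFluidSolution_iff_isQuadraticSolution (hn : 0 < D.lam n) (Ψ U : Matrix S S ℝ)
    (hU : ∀ i j, U i j = omegaRate D n i * (Ψ - 1) i j) :
    IsFluidSolution (omegaRate D n) (etaRate D n) (embeddedMatrix D n) Ψ ↔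
      IsQuadraticSolution D U := by
  rw [isQuadraticSolution_iff]
  refine forall_congr' fun i => forall_congr' fun j => ?_
  have ho := omegaRate_pos hn i
  have hΨ : ∀ k, omegaRate D n i * Ψ i k = U i k + omegaRate D n i * (1 : Matrix S S ℝ) i k := by
    intro k
    rw [hU, Matrix.sub_apply]
    ring
  have hs : omegaRate D n i * ∑ k, Ψ i k * (omegaRate D n k * (Ψ - 1) k j) =
      ∑ k, U i k * U k j + omegaRate D n i * U i j := by
    simp_rw [← hU, Finset.mul_sum, ← mul_assoc, hΨ, add_mul, Finset.sum_add_distrib]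
    congr 1
    simp [Matrix.one_apply]
  have hK : embeddedMatrix D n i j = (1 : Matrix S S ℝ) i j + 2 * (D.lam n)⁻¹ * D.Q i j := by
    simp [embeddedMatrix, div_eq_mul_inv, mul_comm]
  have h1 := omegaRate_sub_etaRate (D := D) (n := n) i
  have h2 := omegaRate_mul_etaRate hn i
  have h3 : omegaRate D n i * etaRate D n i * (2 * (D.lam n)⁻¹ * D.Q i j)
      = 2 * ((D.σ i ^ 2)⁻¹ * D.Q i j) := by
    rw [h2]
    field_simp
  have key : omegaRate D n i * (etaRate D n i * embeddedMatrix D n i j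
      + ∑ k, Ψ i k * (omegaRate D n k * (Ψ - 1) k j) - etaRate D n i * Ψ i j)
      = ∑ k, U i k * U k j
      + 2 * (D.μ i * (D.σ i ^ 2)⁻¹) * U i j + 2 * ((D.σ i ^ 2)⁻¹ * D.Q i j) := by
    rw [← h1, ← h3, mul_sub, mul_add, hs, hK]
    linear_combination (-(etaRate D n i)) * hΨ j
  constructor
  · intro h
    rw [← key, h]
    ring
  · intro h
    rw [h] at key
    have := (mul_eq_zero.1 key).resolve_left ho.ne'
    linarith

/-- Makes the diagonal of `I + Δ_ω⁻¹ U` nonnegative. On the diagonal `(U²)_ii ≥ U_ii²`, and `2|Q_ii|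
≤ λ_n` gives `2Q_ii/σ_i² ≥ -ω_i η_i`, so the equation forces `(U_ii + ω_i)(U_ii - η_i) ≤ 0`, which
fails below `-ω_i`. -/
lemma neg_omegaRate_le_of_isQuadraticSolution (hn : 0 < D.lam n) {U : Matrix S S ℝ}
    (hU : IsQuadraticSolution D U) (hoff : ∀ i j, i ≠ j → 0 ≤ U i j) (i : S) :
    -omegaRate D n i ≤ U i i := by
  by_contra! hlt
  have h := (isQuadraticSolution_iff U).1 hU i i
  have h1 : U i i * U i i ≤ ∑ k, U i k * U k i := by
    rw [← Finset.add_sum_erase _ _ (Finset.mem_univ i)]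
    refine le_add_of_nonneg_right (Finset.sum_nonneg fun k hk => ?_)
    have := Finset.ne_of_mem_erase hk
    exact mul_nonneg (hoff _ _ this.symm) (hoff _ _ this)
  have h2 := omegaRate_sub_etaRate (D := D) (n := n) i
  have h3 := omegaRate_mul_etaRate hn i
  have h4 := omegaRate_pos hn i
  have h5 := etaRate_pos hn i
  have h6 := abs_Q_diag_le D n i
  have h7 := neg_abs_le (D.Q i i)
  have hs : 0 < (D.σ i ^ 2)⁻¹ := by
    have := D.σ_pos i
    positivity
  rw [← h2] at h
  have h8 : -(omegaRate D n i * etaRate D n i) ≤ 2 * ((D.σ i ^ 2)⁻¹ * D.Q i i) := by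
    rw [h3]
    nlinarith
  have h9 : 0 < (U i i + omegaRate D n i) * (U i i - etaRate D n i) :=
    mul_pos_of_neg_of_neg (by linarith) (by linarith)
  nlinarith

/-- Minimality of a solution of the fluid equation at one observation rate gives the minimal
nonnegative Riccati solution at every other one. -/
lemma isMinimalRiccatiSolution_of_isFluidSolution {m : ℕ} (hm : 0 < D.lam m) {Ψ : Matrix S S ℝ}
    (hΨ0 : ∀ i j, 0 ≤ Ψ i j)
    (hΨ : IsFluidSolution (omegaRate D m) (etaRate D m) (embeddedMatrix D m) Ψ)
    (hmin : ∀ Φ : Matrix S S ℝ, (∀ i j, 0 ≤ Φ i j) →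
      IsFluidSolution (omegaRate D m) (etaRate D m) (embeddedMatrix D m) Φ → ∀ i j, Ψ i j ≤ Φ i j)
    {U : Matrix S S ℝ} (hU : ∀ i j, U i j = omegaRate D m i * (Ψ - 1) i j)
    (hn : 0 < D.lam n) :
    ∃ Ψ' : Matrix S S ℝ, IsMinimalRiccatiSolution D n Ψ' ∧
      U = D.lam n • (rMinusInv D n * (Ψ' - 1)) := by
  have offDiag : ∀ (k : ℕ), 0 < D.lam k → ∀ (Φ V : Matrix S S ℝ),
      (∀ i j, V i j = omegaRate D k i * (Φ - 1) i j) → (∀ i j, 0 ≤ Φ i j) →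
      ∀ i j, i ≠ j → 0 ≤ V i j := by
    intro k hk Φ V hV hΦ i j hij
    rw [hV, Matrix.sub_apply, Matrix.one_apply_ne hij, sub_zero]
    exact mul_nonneg (omegaRate_pos hk i).le (hΦ i j)
  -- The inverse substitution `V ↦ I + Δ_ω⁻¹ V` sends solutions of the quadratic equation with
  -- nonnegative off-diagonal entries to nonnegative solutions of the fluid equation at stage `k`.
  have lift : ∀ (k : ℕ), 0 < D.lam k → ∀ V : Matrix S S ℝ, IsQuadraticSolution D V →
      (∀ i j, i ≠ j → 0 ≤ V i j) → ∃ Φ : Matrix S S ℝ, (∀ i j, 0 ≤ Φ i j) ∧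
        IsFluidSolution (omegaRate D k) (etaRate D k) (embeddedMatrix D k) Φ ∧
        ∀ i j, V i j = omegaRate D k i * (Φ - 1) i j := by
    intro k hk V hV hoff
    have hVΦ : ∀ i j, V i j = omegaRate D k i *
        ((1 + Matrix.of fun i j => (omegaRate D k i)⁻¹ * V i j : Matrix S S ℝ) - 1) i j := by
      intro i j
      rw [add_sub_cancel_left, Matrix.of_apply, mul_inv_cancel_left₀ (omegaRate_pos hk i).ne']
    refine ⟨_, ?_, (isFluidSolution_iff_isQuadraticSolution hk _ V hVΦ).2 hV, hVΦ⟩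
    intro i j
    have ho := omegaRate_pos hk i
    rw [Matrix.add_apply, Matrix.of_apply]
    by_cases hij : i = j
    · subst hij
      have := neg_omegaRate_le_of_isQuadraticSolution hk hV hoff i
      rw [Matrix.one_apply_eq, inv_mul_eq_div]
      have : -1 ≤ V i i / omegaRate D k i := by
        rw [le_div_iff₀ ho]
        linarith
      linarith
    · rw [Matrix.one_apply_ne hij, zero_add]
      exact mul_nonneg (inv_nonneg.2 ho.le) (hoff i j hij)
  have hUq := (isFluidSolution_iff_isQuadraticSolution hm Ψ U hU).1 hΨ
  obtain ⟨Ψ', h0, hsol, hUΨ'⟩ := lift n hn U hUq (offDiag m hm Ψ U hU hΨ0)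
  refine ⟨Ψ', ⟨h0, (isRiccatiSolution_iff hn Ψ').2 hsol, ?_⟩, ?_⟩
  · intro Φ hΦ0 hΦ i j
    have hV : ∀ i j, (Matrix.of fun i j => omegaRate D n i * (Φ - 1) i j) i j
        = omegaRate D n i * (Φ - 1) i j := fun i j => rfl
    have hVq := (isFluidSolution_iff_isQuadraticSolution hn Φ _ hV).1
      ((isRiccatiSolution_iff hn Φ).1 hΦ)
    -- A competitor `Φ` at stage `n` is carried, through its matrix `V`, to a competitor `Φ'` at
    -- stage `m`, where minimality is known; positive row scalings preserve the order.
    obtain ⟨Φ', hΦ'0, hΦ', hVΦ'⟩ := lift m hm _ hVq (offDiag n hn Φ _ hV hΦ0)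
    have h1 := hmin Φ' hΦ'0 hΦ' i j
    have h2 : U i j ≤ omegaRate D n i * (Φ - 1) i j := by
      rw [← hV, hVΦ', hU]
      exact mul_le_mul_of_nonneg_left (by simpa using h1) (omegaRate_pos hm i).le
    rw [hUΨ'] at h2
    simpa using le_of_mul_le_mul_left h2 (omegaRate_pos hn i)
  · ext i j
    have := omegaRate_pos hn i
    rw [hUΨ', Matrix.smul_apply, rMinusInv, Matrix.diagonal_mul]
    simp only [rate, abs_neg, abs_div, abs_of_pos hn, abs_of_pos this, smul_eq_mul, inv_div]
    field_simp

end Rates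

end MMBM

namespace MMBM

/-! ### Exponential laws -/

section Exponential

variable {r : ℝ}

lemma lintegral_expMeasure (r : ℝ) {g : ℝ → ℝ≥0∞} (hg : Measurable g) :
    ∫⁻ l, g l ∂expMeasure r = ∫⁻ l, exponentialPDF r l * g l := by
  rw [expMeasure, gammaMeasure, lintegral_withDensity_eq_lintegral_mul _ _ hg]
  · rfl
  · exact (measurable_gammaPDFReal 1 r).ennreal_ofReal

lemma setLIntegral_expMeasure (r : ℝ) {g : ℝ → ℝ≥0∞} (hg : Measurable g) {s : Set ℝ}
    (hs : MeasurableSet s) :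
    ∫⁻ l in s, g l ∂expMeasure r = ∫⁻ l in s, exponentialPDF r l * g l := by
  rw [← lintegral_indicator hs, lintegral_expMeasure r (hg.indicator hs), ← lintegral_indicator hs]
  congr 1
  ext l
  by_cases hl : l ∈ s <;> simp [hl]

lemma measurable_exponentialPDF (r : ℝ) : Measurable (exponentialPDF r) :=
  (measurable_exponentialPDFReal r).ennreal_ofReal

lemma expMeasure_Iic_zero (r : ℝ) : expMeasure r (Set.Iic 0) = 0 := by
  have h := setLIntegral_expMeasure r (g := fun _ => 1) measurable_const
    (measurableSet_Iic (a := 0))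
  simp only [setLIntegral_one, mul_one] at h
  rw [h, setLIntegral_congr (Iio_ae_eq_Iic (μ := volume) (a := (0 : ℝ))).symm,
    lintegral_exponentialPDF_of_nonpos le_rfl]

lemma ae_pos_expMeasure (r : ℝ) : ∀ᵐ l ∂expMeasure r, 0 < l := by
  rw [ae_iff]
  convert expMeasure_Iic_zero r using 2
  ext; simp

/-- The memoryless property of the exponential law. -/
lemma setLIntegral_Ioi_expMeasure {x : ℝ} (hx : 0 ≤ x) {g : ℝ → ℝ≥0∞}
    (hg : Measurable g) :
    ∫⁻ l in Set.Ioi x, g l ∂expMeasure r =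
      ENNReal.ofReal (Real.exp (-(r * x))) * ∫⁻ l, g (x + l) ∂expMeasure r := by
  have hg' : Measurable fun l => g (x + l) := hg.comp (measurable_const_add x)
  rw [setLIntegral_expMeasure r hg measurableSet_Ioi, lintegral_expMeasure r hg',
    ← lintegral_const_mul _ (f := fun l => exponentialPDF r l * g (x + l))
      ((measurable_exponentialPDF r).mul hg'),
    ← lintegral_indicator measurableSet_Ioi,
    ← lintegral_add_left_eq_self (μ := volume) _ x]
  refine lintegral_congr_ae ?_
  -- At `l = 0` the shifted half-line and the support of the density disagree, so that point is
  -- discarded as a null set.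
  filter_upwards [compl_mem_ae_iff.2 (measure_singleton (0 : ℝ) : volume {(0 : ℝ)} = 0)] with l hl
  rcases lt_trichotomy l 0 with h | h | h
  · rw [exponentialPDF_of_neg h, Set.indicator_of_notMem (by simp [h.le])]
    simp
  · exact absurd h hl
  · rw [Set.indicator_of_mem (by simp [h]), exponentialPDF_of_nonneg h.le,
      exponentialPDF_of_nonneg (by positivity), ← mul_assoc,
      ← ENNReal.ofReal_mul (Real.exp_nonneg _)]
    congr 2
    rw [mul_left_comm, ← Real.exp_add]
    ring_nf

lemma expMeasure_Ioi (hr : 0 < r) {x : ℝ} (hx : 0 ≤ x) :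
    expMeasure r (Set.Ioi x) = ENNReal.ofReal (Real.exp (-(r * x))) := by
  have := isProbabilityMeasure_expMeasure hr
  have h := setLIntegral_Ioi_expMeasure (r := r) hx (g := fun _ => 1) measurable_const
  simpa using h

lemma setLIntegral_Iic_expMeasure (hr : 0 < r) {x : ℝ} (hx : 0 ≤ x) {φ : ℝ → ℝ}
    (hφm : Measurable φ) (hφ0 : ∀ l ∈ Set.Ioc 0 x, 0 ≤ φ l)
    (hφi : IntervalIntegrable φ volume 0 x) :
    ∫⁻ l in Set.Iic x, ENNReal.ofReal (φ l) ∂expMeasure r =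
      ENNReal.ofReal (∫ l in (0 : ℝ)..x, r * Real.exp (-(r * l)) * φ l) := by
  have h1 : ∫⁻ l in Set.Iic x, ENNReal.ofReal (φ l) ∂expMeasure r =
      ∫⁻ l in Set.Ioc 0 x, ENNReal.ofReal (φ l) ∂expMeasure r := by
    rw [← lintegral_indicator measurableSet_Iic, ← lintegral_indicator measurableSet_Ioc]
    refine lintegral_congr_ae ?_
    filter_upwards [ae_pos_expMeasure r] with l hl
    simp [Set.indicator_apply, hl]
  rw [h1, setLIntegral_expMeasure r hφm.ennreal_ofReal measurableSet_Ioc,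
    intervalIntegral.integral_of_le hx, ofReal_integral_eq_lintegral_ofReal]
  · refine setLIntegral_congr_fun measurableSet_Ioc fun l hl => ?_
    rw [exponentialPDF_of_nonneg hl.1.le, ← ENNReal.ofReal_mul]
    positivity
  · rw [← IntegrableOn, ← intervalIntegrable_iff_integrableOn_Ioc_of_le hx]
    exact hφi.continuousOn_mul (by fun_prop)
  · rw [EventuallyLE, ae_restrict_iff' measurableSet_Ioc]
    filter_upwards with l hl
    have := hφ0 l hl
    simp only [Pi.zero_apply]
    positivity

/-- Lets integrals over the whole half-line be handled as limits of interval integrals, with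
monotone convergence in `ℝ≥0∞` replacing integrability of improper integrals. -/
lemma lintegral_eq_iSup_Iic {m : Measure ℝ} (g : ℝ → ℝ≥0∞) :
    ∫⁻ l, g l ∂m = ⨆ n : ℕ, ∫⁻ l in Set.Iic (n : ℝ), g l ∂m := by
  have : (⋃ n : ℕ, Set.Iic (n : ℝ)) = Set.univ := by
    ext x
    simpa using exists_nat_ge x
  rw [← setLIntegral_univ, ← this, setLIntegral_iUnion_of_directed]
  exact directed_of_isDirected_le fun i j hij => Set.Iic_subset_Iic.2 (by exact_mod_cast hij)

end Exponential

/-! ### Probabilities of crossing a level within a given number of cycles -/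

section Crossing

variable {S : Type*} [Fintype S] [DecidableEq S] (om et : S → ℝ) (K : Matrix S S ℝ)

/-- Average of `f` after an ascent from the height `v` in phase `a` and one transition. -/
def ascend (f : ℝ → Matrix S S ℝ≥0∞) (v : ℝ) (a b : S) : ℝ≥0∞ :=
  ∫⁻ h, ∑ c, ENNReal.ofReal (K a c) * f (v + h) c b ∂expMeasure (et a)

/-- The probability that a fluid, started in a descent at height `w` in phase `a`, goes below `0`
within `r` cycles, in phase `b`: descents and ascents are exponential of rates `om` and `et`, and
phases change at the end of each ascent according to `K`. -/
def crossProb : ℕ → ℝ → Matrix S S ℝ≥0∞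
  | 0 => fun _ => 0
  | r + 1 => fun w a b =>
    ∫⁻ l, (if w < l then (1 : Matrix S S ℝ≥0∞) a b else ascend et K (crossProb r) (w - l) a b)
      ∂expMeasure (om a)

variable {om et K}

lemma measurable_ascend {f : ℝ → Matrix S S ℝ≥0∞} (hf : ∀ a b, Measurable fun w => f w a b)
    (hom : ∀ i, 0 < et i) (a b : S) : Measurable fun v => ascend et K f v a b := by
  have := isProbabilityMeasure_expMeasure (hom a)
  refine Measurable.lintegral_prod_right' (f := fun p : ℝ × ℝ =>
    ∑ c, ENNReal.ofReal (K a c) * f (p.1 + p.2) c b) ?_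
  refine Finset.measurable_sum _ fun c _ => Measurable.const_mul ?_ _
  exact (hf c b).comp (measurable_fst.add measurable_snd)

lemma measurable_crossProb (hom : ∀ i, 0 < om i) (het : ∀ i, 0 < et i) (r : ℕ) (a b : S) :
    Measurable fun w => crossProb om et K r w a b := by
  induction r generalizing a b with
  | zero => exact measurable_const
  | succ r ih =>
    have := isProbabilityMeasure_expMeasure (hom a)
    refine Measurable.lintegral_prod_right' (f := fun p : ℝ × ℝ =>
      if p.1 < p.2 then (1 : Matrix S S ℝ≥0∞) a b
        else ascend et K (crossProb om et K r) (p.1 - p.2) a b) ?_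
    refine Measurable.ite (measurableSet_lt measurable_fst measurable_snd) measurable_const ?_
    exact (measurable_ascend ih het a b).comp (measurable_fst.sub measurable_snd)

lemma ascend_mono {f g : ℝ → Matrix S S ℝ≥0∞} {v : ℝ} (h : ∀ w, v ≤ w → ∀ a b, f w a b ≤ g w a b)
    (a b : S) : ascend et K f v a b ≤ ascend et K g v a b := by
  refine lintegral_mono_ae ?_
  filter_upwards [ae_pos_expMeasure (et a)] with h' hh
  gcongr
  exact h _ (by linarith) _ _

lemma crossProb_le_succ (r : ℕ) (w : ℝ) (a b : S) :
    crossProb om et K r w a b ≤ crossProb om et K (r + 1) w a b := by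
  induction r generalizing w a b with
  | zero => exact zero_le
  | succ r ih =>
    refine lintegral_mono fun l => ?_
    simp only
    split_ifs
    · exact le_rfl
    · exact ascend_mono (fun w _ a b => ih w a b) a b

lemma crossProb_mono {r r' : ℕ} (h : r ≤ r') (w : ℝ) (a b : S) :
    crossProb om et K r w a b ≤ crossProb om et K r' w a b :=
  monotone_nat_of_le_succ (f := fun r => crossProb om et K r w a b)
    (fun r => crossProb_le_succ r w a b) h

lemma sum_ofReal_row (hK : ∀ i j, 0 ≤ K i j) (hK1 : ∀ i, ∑ j, K i j = 1) (a : S) :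
    ∑ c, ENNReal.ofReal (K a c) = 1 := by
  rw [← ENNReal.ofReal_sum_of_nonneg fun c _ => hK a c, hK1, ENNReal.ofReal_one]

lemma sum_ascend_le (het : ∀ i, 0 < et i) (hK : ∀ i j, 0 ≤ K i j) (hK1 : ∀ i, ∑ j, K i j = 1)
    {f : ℝ → Matrix S S ℝ≥0∞} (hf : ∀ a b, Measurable fun w => f w a b)
    (hf1 : ∀ w a, ∑ b, f w a b ≤ 1) (v : ℝ) (a : S) : ∑ b, ascend et K f v a b ≤ 1 := by
  have := isProbabilityMeasure_expMeasure (het a)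
  unfold ascend
  rw [← lintegral_finsetSum]
  · calc _ ≤ ∫⁻ _, 1 ∂expMeasure (et a) := by
          refine lintegral_mono fun h => ?_
          simp only
          rw [Finset.sum_comm]
          simp_rw [← Finset.mul_sum]
          calc _ ≤ ∑ c, ENNReal.ofReal (K a c) * 1 := by
                gcongr with c
                exact hf1 _ _
            _ = 1 := by simp [sum_ofReal_row hK hK1]
      _ = 1 := by simp
  · intro b _
    refine Finset.measurable_sum _ fun c _ => Measurable.const_mul ?_ _
    exact (hf c b).comp (measurable_const_add v)

lemma sum_crossProb_le (hom : ∀ i, 0 < om i) (het : ∀ i, 0 < et i) (hK : ∀ i j, 0 ≤ K i j)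
    (hK1 : ∀ i, ∑ j, K i j = 1) (r : ℕ) (w : ℝ) (a : S) :
    ∑ b, crossProb om et K r w a b ≤ 1 := by
  induction r generalizing w a with
  | zero => simp [crossProb]
  | succ r ih =>
    have := isProbabilityMeasure_expMeasure (hom a)
    have hm := measurable_crossProb (K := K) hom het r
    simp only [crossProb]
    rw [← lintegral_finsetSum]
    · calc _ ≤ ∫⁻ _, 1 ∂expMeasure (om a) := by
            refine lintegral_mono fun l => ?_
            simp only
            split_ifs
            · simp [Matrix.one_apply]
            · exact sum_ascend_le het hK hK1 hm ih _ _
        _ = 1 := by simp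
    · intro b _
      refine Measurable.ite (measurableSet_lt measurable_const measurable_id) measurable_const ?_
      exact (measurable_ascend hm het a b).comp (measurable_const.sub measurable_id)

/-- Splitting at the end of a descent of length `x`. -/
lemma crossProb_succ_add (hom : ∀ i, 0 < om i) (het : ∀ i, 0 < et i) (r : ℕ) {x y : ℝ}
    (hx : 0 ≤ x) (hy : 0 ≤ y) (a b : S) :
    crossProb om et K (r + 1) (x + y) a b =
      ∫⁻ l in Set.Iic x, ascend et K (crossProb om et K r) (x + y - l) a b ∂expMeasure (om a) +
      ENNReal.ofReal (Real.exp (-(om a * x))) * crossProb om et K (r + 1) y a b := by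
  have hm := measurable_ascend (K := K) (measurable_crossProb (K := K) hom het r) het a b
  simp only [crossProb]
  rw [← lintegral_add_compl _ (measurableSet_Iic (a := x)), Set.compl_Iic,
    setLIntegral_Ioi_expMeasure hx]
  · congr 1
    · refine setLIntegral_congr_fun measurableSet_Iic fun l hl => ?_
      have : ¬ (x + y < l) := by
        have : l ≤ x := hl
        linarith
      simp only [this, if_false]
    · congr 1
      refine lintegral_congr fun l => ?_
      simp only [add_lt_add_iff_left, add_sub_add_left_eq_sub]
  · refine Measurable.ite (measurableSet_lt measurable_const measurable_id) measurable_const ?_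
    exact hm.comp (measurable_const.sub measurable_id)

/-- The case `y = 0` of `crossProb_succ_add`: from height `0` an exponential descent, being almost
surely positive, crosses at once without a change of phase. -/
lemma crossProb_succ_of_nonneg (hom : ∀ i, 0 < om i) (het : ∀ i, 0 < et i) (r : ℕ) {x : ℝ}
    (hx : 0 ≤ x) (a b : S) :
    crossProb om et K (r + 1) x a b =
      ∫⁻ l in Set.Iic x, ascend et K (crossProb om et K r) (x - l) a b ∂expMeasure (om a) +
      ENNReal.ofReal (Real.exp (-(om a * x))) * (1 : Matrix S S ℝ≥0∞) a b := by
  have h := crossProb_succ_add (K := K) hom het r hx le_rfl a b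
  have : crossProb om et K (r + 1) 0 a b = (1 : Matrix S S ℝ≥0∞) a b := by
    have := isProbabilityMeasure_expMeasure (hom a)
    simp only [crossProb]
    calc _ = ∫⁻ _, (1 : Matrix S S ℝ≥0∞) a b ∂expMeasure (om a) := by
          refine lintegral_congr_ae ?_
          filter_upwards [ae_pos_expMeasure (om a)] with l hl
          simp [hl]
      _ = _ := by simp
  rw [this] at h
  simpa using h

lemma sum_ascend_mul {g : ℝ → Matrix S S ℝ≥0∞} (M : Matrix S S ℝ≥0∞) (v : ℝ)
    (hgm : ∀ a b, Measurable fun w => g w a b) (a b : S) :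
    ∑ c, ascend et K g v a c * M c b =
      ∫⁻ h, ∑ c, ENNReal.ofReal (K a c) * (g (v + h) * M) c b ∂expMeasure (et a) := by
  have hm : ∀ d, Measurable fun h => ∑ c, ENNReal.ofReal (K a c) * g (v + h) c d := fun d =>
    Finset.measurable_sum _ fun c _ => ((hgm c d).comp (measurable_const_add v)).const_mul _
  calc _ = ∑ d, ∫⁻ h, (∑ c, ENNReal.ofReal (K a c) * g (v + h) c d) * M d b ∂expMeasure (et a) :=
        Finset.sum_congr rfl fun d _ => (lintegral_mul_const _ (hm d)).symm
    _ = ∫⁻ h, ∑ d, (∑ c, ENNReal.ofReal (K a c) * g (v + h) c d) * M d b ∂expMeasure (et a) :=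
        (lintegral_finsetSum _ fun d _ => (hm d).mul_const _).symm
    _ = _ := by
        refine lintegral_congr fun h => ?_
        simp_rw [Finset.sum_mul, Matrix.mul_apply, Finset.mul_sum, mul_assoc]
        exact Finset.sum_comm

/-- Carries an inequality between crossing probabilities through an ascent; heights `t ≥ 0` suffice
because ascents are almost surely positive. Together with `mul_le_ascend` it drives both halves of
the semigroup property. -/
lemma ascend_le_mul {f g : ℝ → Matrix S S ℝ≥0∞} {M : Matrix S S ℝ≥0∞} {u v : ℝ}
    (hgm : ∀ a b, Measurable fun w => g w a b)
    (h : ∀ t, 0 ≤ t → ∀ a b, f (u + t) a b ≤ (g (v + t) * M) a b) (a b : S) :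
    ascend et K f u a b ≤ ∑ c, ascend et K g v a c * M c b := by
  rw [sum_ascend_mul M v hgm]
  refine lintegral_mono_ae ?_
  filter_upwards [ae_pos_expMeasure (et a)] with t ht
  gcongr
  exact h t ht.le _ b

lemma mul_le_ascend {f g : ℝ → Matrix S S ℝ≥0∞} {M : Matrix S S ℝ≥0∞} {u v : ℝ}
    (hgm : ∀ a b, Measurable fun w => g w a b)
    (h : ∀ t, 0 ≤ t → ∀ a b, (g (v + t) * M) a b ≤ f (u + t) a b) (a b : S) :
    ∑ c, ascend et K g v a c * M c b ≤ ascend et K f u a b := by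
  rw [sum_ascend_mul M v hgm]
  refine lintegral_mono_ae ?_
  filter_upwards [ae_pos_expMeasure (et a)] with t ht
  gcongr
  exact h t ht.le _ b

lemma setLIntegral_ascend_mul (hom : ∀ i, 0 < om i) (het : ∀ i, 0 < et i) (r : ℕ)
    (x : ℝ) (M : Matrix S S ℝ≥0∞) (a b : S) :
    ∑ c, (∫⁻ l in Set.Iic x, ascend et K (crossProb om et K r) (x - l) a c ∂expMeasure (om a))
      * M c b =
    ∫⁻ l in Set.Iic x, ∑ c, ascend et K (crossProb om et K r) (x - l) a c * M c b
      ∂expMeasure (om a) := by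
  have hm : ∀ c, Measurable fun l => ascend et K (crossProb om et K r) (x - l) a c := fun c =>
    (measurable_ascend (K := K) (measurable_crossProb (K := K) hom het r) het a c).comp
      (measurable_const.sub measurable_id)
  rw [lintegral_finsetSum _ fun c _ => (hm c).mul_const _]
  refine Finset.sum_congr rfl fun c _ => ?_
  rw [lintegral_mul_const _ (hm c)]

/-- A path that goes down by `x + y` within `r` cycles first goes down by `x`, then by a further
`y`, each within `r` cycles. In the induction a first descent longer than `x` starts afresh at
distance `y` by memorylessness; a shorter one is followed by an ascent and the induction hypothesis.
-/
lemma crossProb_add_le (hom : ∀ i, 0 < om i) (het : ∀ i, 0 < et i) (r : ℕ) {x y : ℝ}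
    (hx : 0 ≤ x) (hy : 0 ≤ y) (a b : S) :
    crossProb om et K r (x + y) a b ≤ (crossProb om et K r x * crossProb om et K r y) a b := by
  induction r generalizing x a b with
  | zero => exact zero_le
  | succ r ih =>
    rw [crossProb_succ_add hom het r hx hy, Matrix.mul_apply]
    simp_rw [crossProb_succ_of_nonneg hom het r hx, add_mul, Finset.sum_add_distrib,
      setLIntegral_ascend_mul hom het]
    refine add_le_add ?_ ?_
    · refine setLIntegral_mono' measurableSet_Iic fun l hl => ?_
      refine ascend_le_mul (measurable_crossProb hom het r) (fun t ht c d => ?_) a b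
      have hl' : l ≤ x := hl
      have h1 : x + y - l + t = (x - l + t) + y := by ring
      rw [h1]
      refine (ih (by linarith) c d).trans ?_
      rw [Matrix.mul_apply, Matrix.mul_apply]
      gcongr
      exact crossProb_le_succ _ _ _ _
    · simp [Matrix.one_apply]

/-- Concatenation: going down by `x` in `r` cycles and then by `y` in `r'` cycles takes at most `r +
r'` cycles in all. -/
lemma le_crossProb_add (hom : ∀ i, 0 < om i) (het : ∀ i, 0 < et i) (r r' : ℕ) {x y : ℝ}
    (hx : 0 ≤ x) (hy : 0 ≤ y) (a b : S) :
    (crossProb om et K r x * crossProb om et K r' y) a b ≤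
      crossProb om et K (r + r') (x + y) a b := by
  induction r generalizing x a b with
  | zero => simp [crossProb]
  | succ r ih =>
    rw [add_right_comm, crossProb_succ_add hom het (r + r') hx hy, Matrix.mul_apply]
    simp_rw [crossProb_succ_of_nonneg hom het r hx, add_mul, Finset.sum_add_distrib,
      setLIntegral_ascend_mul hom het]
    refine add_le_add ?_ ?_
    · refine setLIntegral_mono' measurableSet_Iic fun l hl => ?_
      refine mul_le_ascend (measurable_crossProb hom het r) (fun t ht c d => ?_) a b
      have hl' : l ≤ x := hl
      have h1 : x + y - l + t = (x - l + t) + y := by ring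
      rw [h1]
      exact ih (by linarith) c d
    · simp only [mul_assoc, Matrix.one_apply, ite_mul, one_mul, zero_mul, mul_ite, mul_zero,
        Finset.sum_ite_eq, Finset.mem_univ, if_true]
      gcongr
      exact crossProb_mono (by omega) _ _ _

variable (om et K) in
/-- The probability that a fluid started at height `w` in phase `a` ever goes below `0`, in phase
`b`. -/
def crossLim (w : ℝ) : Matrix S S ℝ≥0∞ := fun a b => ⨆ r, crossProb om et K r w a b

lemma tendsto_crossProb (w : ℝ) (a b : S) :
    Tendsto (fun r => crossProb om et K r w a b) atTop (𝓝 (crossLim om et K w a b)) :=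
  tendsto_atTop_iSup fun _ _ h => crossProb_mono h w a b

lemma measurable_crossLim (hom : ∀ i, 0 < om i) (het : ∀ i, 0 < et i) (a b : S) :
    Measurable fun w => crossLim om et K w a b :=
  Measurable.iSup fun r => measurable_crossProb hom het r a b

lemma sum_crossLim_le (hom : ∀ i, 0 < om i) (het : ∀ i, 0 < et i) (hK : ∀ i j, 0 ≤ K i j)
    (hK1 : ∀ i, ∑ j, K i j = 1) (w : ℝ) (a : S) : ∑ b, crossLim om et K w a b ≤ 1 :=
  le_of_tendsto (tendsto_finsetSum _ fun b _ => tendsto_crossProb w a b)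
    (Eventually.of_forall fun r => sum_crossProb_le hom het hK hK1 r w a)

lemma crossLim_le_one (hom : ∀ i, 0 < om i) (het : ∀ i, 0 < et i) (hK : ∀ i j, 0 ≤ K i j)
    (hK1 : ∀ i, ∑ j, K i j = 1) (w : ℝ) (a b : S) : crossLim om et K w a b ≤ 1 :=
  (Finset.single_le_sum (fun _ _ => zero_le) (Finset.mem_univ b)).trans
    (sum_crossLim_le hom het hK hK1 w a)

lemma crossLim_ne_top (hom : ∀ i, 0 < om i) (het : ∀ i, 0 < et i) (hK : ∀ i j, 0 ≤ K i j)
    (hK1 : ∀ i, ∑ j, K i j = 1) (w : ℝ) (a b : S) : crossLim om et K w a b ≠ ∞ :=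
  ((crossLim_le_one hom het hK hK1 w a b).trans_lt ENNReal.one_lt_top).ne

/-- For finitely many cycles the product is only squeezed between `crossProb` at `r` and at `r + r`
cycles; the two bounds meet in the limit. Finiteness of the entries is needed to pass to the limit
in products over `ℝ≥0∞`. -/
lemma crossLim_add (hom : ∀ i, 0 < om i) (het : ∀ i, 0 < et i) (hK : ∀ i j, 0 ≤ K i j)
    (hK1 : ∀ i, ∑ j, K i j = 1) {x y : ℝ} (hx : 0 ≤ x) (hy : 0 ≤ y) :
    crossLim om et K (x + y) = crossLim om et K x * crossLim om et K y := by
  ext a b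
  have hlim : Tendsto (fun r => (crossProb om et K r x * crossProb om et K r y) a b) atTop
      (𝓝 ((crossLim om et K x * crossLim om et K y) a b)) := by
    simp_rw [Matrix.mul_apply]
    refine tendsto_finsetSum _ fun c _ => ENNReal.Tendsto.mul (tendsto_crossProb _ _ _) (.inr ?_)
      (tendsto_crossProb _ _ _) (.inr ?_)
    · exact crossLim_ne_top hom het hK hK1 _ _ _
    · exact crossLim_ne_top hom het hK hK1 _ _ _
  refine le_antisymm ?_ ?_
  · exact le_of_tendsto_of_tendsto' (tendsto_crossProb _ _ _) hlim
      fun r => crossProb_add_le hom het r hx hy a b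
  · exact le_of_tendsto' hlim fun r => (le_crossProb_add hom het r r hx hy a b).trans
      (le_iSup (fun r => crossProb om et K r (x + y) a b) _)

variable (om et K) in
/-- The probabilities of the phase at the first return to the starting level, for a fluid started
in an ascent. -/
def returnProb : Matrix S S ℝ≥0∞ := fun a b => ascend et K (crossLim om et K) 0 a b

/-- After an ascent of height `t` from `v`, the path must come back to `v` before going below `0`.
By the semigroup property the factor `crossLim v` does not depend on `t` and leaves the integral,
which becomes `returnProb`. -/
lemma ascend_crossLim (hom : ∀ i, 0 < om i) (het : ∀ i, 0 < et i) (hK : ∀ i j, 0 ≤ K i j)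
    (hK1 : ∀ i, ∑ j, K i j = 1) {v : ℝ} (hv : 0 ≤ v) (a b : S) :
    ascend et K (crossLim om et K) v a b = (returnProb om et K * crossLim om et K v) a b := by
  have h : ∀ t, 0 ≤ t → crossLim om et K (v + t)
      = crossLim om et K (0 + t) * crossLim om et K v := by
    intro t ht
    rw [zero_add, add_comm, crossLim_add hom het hK hK1 ht hv]
  rw [Matrix.mul_apply]
  refine le_antisymm ?_ ?_
  · exact ascend_le_mul (measurable_crossLim hom het) (fun t ht c d => (by rw [h t ht])) a b
  · exact mul_le_ascend (measurable_crossLim hom het) (fun t ht c d => (by rw [h t ht])) a b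

/-- The renewal equation for the first descent, obtained by monotone convergence in the number of
cycles from `crossProb_succ_of_nonneg`. -/
lemma crossLim_eq (hom : ∀ i, 0 < om i) (het : ∀ i, 0 < et i) (hK : ∀ i j, 0 ≤ K i j)
    (hK1 : ∀ i, ∑ j, K i j = 1) {x : ℝ} (hx : 0 ≤ x) (a b : S) :
    crossLim om et K x a b =
      ∫⁻ l in Set.Iic x, (returnProb om et K * crossLim om et K (x - l)) a b ∂expMeasure (om a) +
      ENNReal.ofReal (Real.exp (-(om a * x))) * (1 : Matrix S S ℝ≥0∞) a b := by
  have hsup : ∀ v, Tendsto (fun r => ascend et K (crossProb om et K r) v a b) atTop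
      (𝓝 (ascend et K (crossLim om et K) v a b)) := by
    intro v
    refine lintegral_tendsto_of_tendsto_of_monotone (fun r => ?_) ?_ ?_
    · exact (Finset.measurable_sum _ fun c _ => ((measurable_crossProb hom het r c b).comp
        (measurable_const_add v)).const_mul _).aemeasurable
    · refine Eventually.of_forall fun h r r' hr => ?_
      simp only
      gcongr
      exact crossProb_mono hr _ _ _
    · refine Eventually.of_forall fun h => tendsto_finsetSum _ fun c _ =>
        ENNReal.Tendsto.const_mul (tendsto_crossProb _ _ _) (.inr ENNReal.ofReal_ne_top)
  have h1 : Tendsto (fun r => crossProb om et K (r + 1) x a b) atTop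
      (𝓝 (crossLim om et K x a b)) := (tendsto_crossProb x a b).comp (tendsto_add_atTop_nat 1)
  simp_rw [crossProb_succ_of_nonneg hom het _ hx] at h1
  refine tendsto_nhds_unique h1 ((Tendsto.add ?_ tendsto_const_nhds))
  have : ∫⁻ l in Set.Iic x, (returnProb om et K * crossLim om et K (x - l)) a b ∂expMeasure (om a)
      = ∫⁻ l in Set.Iic x, ascend et K (crossLim om et K) (x - l) a b ∂expMeasure (om a) := by
    refine setLIntegral_congr_fun measurableSet_Iic fun l hl => ?_
    have hl' : l ≤ x := hl
    exact (ascend_crossLim hom het hK hK1 (by linarith) a b).symm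
  rw [this]
  refine lintegral_tendsto_of_tendsto_of_monotone (fun r => ?_) ?_ ?_
  · exact ((measurable_ascend (measurable_crossProb hom het r) het a b).comp
      (measurable_const.sub measurable_id)).aemeasurable
  · refine Eventually.of_forall fun l r r' hr => ?_
    exact ascend_mono (fun w _ c d => crossProb_mono hr w c d) a b
  · exact Eventually.of_forall fun l => hsup _

end Crossing

end MMBM

namespace MMBM

/-! ### Exponentials of matrices -/

section MatrixExp

variable {S : Type*} [Fintype S] [DecidableEq S]

open scoped Matrix.Norms.Operator in
lemma hasDerivAt_mul_exp_apply (A V : Matrix S S ℝ) (x : ℝ) (a b : S) :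
    HasDerivAt (fun x : ℝ => (A * NormedSpace.exp (x • V)) a b)
      ((A * (V * NormedSpace.exp (x • V))) a b) x := by
  have h := (hasDerivAt_exp_smul_const' (𝕂 := ℝ) V x).const_mul A
  exact ((LinearMap.toContinuousLinearMap
    (Matrix.entryLinearMap ℝ ℝ a b)).hasFDerivAt.comp_hasDerivAt
    x h :)

lemma exp_zero_smul (V : Matrix S S ℝ) : NormedSpace.exp ((0 : ℝ) • V) = 1 := by
  rw [zero_smul, NormedSpace.exp_zero]

lemma hasDerivAt_exp_apply (V : Matrix S S ℝ) (x : ℝ) (a b : S) :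
    HasDerivAt (fun x : ℝ => NormedSpace.exp (x • V) a b)
      ((V * NormedSpace.exp (x • V)) a b) x := by
  simpa using hasDerivAt_mul_exp_apply 1 V x a b

lemma continuous_mul_exp_apply (A V : Matrix S S ℝ) (a b : S) :
    Continuous fun x : ℝ => (A * NormedSpace.exp (x • V)) a b :=
  continuous_iff_continuousAt.2 fun x => (hasDerivAt_mul_exp_apply A V x a b).continuousAt

lemma exp_add_smul (V : Matrix S S ℝ) (x y : ℝ) :
    NormedSpace.exp ((x + y) • V) = NormedSpace.exp (x • V) * NormedSpace.exp (y • V) := by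
  rw [add_smul]
  exact Matrix.exp_add_of_commute _ _ (((Commute.refl V).smul_left x).smul_right y)

lemma commute_exp_smul (V : Matrix S S ℝ) (x : ℝ) :
    V * NormedSpace.exp (x • V) = NormedSpace.exp (x • V) * V := by
  have h : Commute V (x • V) := (Commute.refl V).smul_right x
  exact (Commute.exp_right h).eq

open scoped Matrix.Norms.Operator in
lemma exp_nonneg_of_nonneg {A : Matrix S S ℝ} (hA : ∀ i j, 0 ≤ A i j) (a b : S) :
    0 ≤ NormedSpace.exp A a b := by
  have h := NormedSpace.exp_series_hasSum_exp' (𝕂 := ℝ) A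
  have h2 := (LinearMap.toContinuousLinearMap (Matrix.entryLinearMap ℝ ℝ a b)).hasSum h
  have hpow : ∀ n : ℕ, ∀ i j, 0 ≤ (A ^ n) i j := by
    intro n
    induction n with
    | zero =>
      intro i j
      rw [pow_zero, Matrix.one_apply]
      split_ifs <;> simp
    | succ n ih =>
      intro i j
      rw [pow_succ, Matrix.mul_apply]
      exact Finset.sum_nonneg fun k _ => mul_nonneg (ih i k) (hA k j)
  refine h2.nonneg fun n => ?_
  have := hpow n a b
  change 0 ≤ ((n.factorial : ℝ)⁻¹ • A ^ n) a b
  rw [Matrix.smul_apply, smul_eq_mul]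
  positivity

/-- Adding `c I` with `c` at least every `|V_ii|` makes the matrix entrywise nonnegative, hence also
its exponential; since `c I` is central, this only costs the positive scalar `e^{-xc}`. -/
lemma exp_smul_nonneg {V : Matrix S S ℝ} (hV : ∀ i j, i ≠ j → 0 ≤ V i j) {x : ℝ} (hx : 0 ≤ x)
    (a b : S) : 0 ≤ NormedSpace.exp (x • V) a b := by
  set c : ℝ := ∑ i, |V i i| with hc
  have hA : ∀ i j, 0 ≤ (x • (V + c • (1 : Matrix S S ℝ))) i j := by
    intro i j
    rw [Matrix.smul_apply, Matrix.add_apply, Matrix.smul_apply, smul_eq_mul, smul_eq_mul]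
    refine mul_nonneg hx ?_
    by_cases hij : i = j
    · subst hij
      have h1 : |V i i| ≤ c := Finset.single_le_sum (f := fun i => |V i i|)
        (fun _ _ => abs_nonneg _) (Finset.mem_univ i)
      have h2 := neg_abs_le (V i i)
      rw [Matrix.one_apply_eq]
      linarith
    · simpa [Matrix.one_apply_ne hij] using hV i j hij
  have hd : (-(x * c)) • (1 : Matrix S S ℝ) = Matrix.diagonal fun _ => -(x * c) := by
    rw [Matrix.smul_one_eq_diagonal]
  have hsplit : x • V = x • (V + c • (1 : Matrix S S ℝ)) + (-(x * c)) • (1 : Matrix S S ℝ) := by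
    rw [smul_add, smul_smul, neg_smul]
    abel
  rw [hsplit, Matrix.exp_add_of_commute _ _ ((Commute.one_right _).smul_right _), hd,
    Matrix.exp_diagonal, Matrix.mul_diagonal]
  refine mul_nonneg (exp_nonneg_of_nonneg hA a b) ?_
  rw [Pi.coe_exp, ← Real.exp_eq_exp_ℝ]
  exact (Real.exp_pos _).le

/-- Comparing matrix exponentials compares the generators. -/
lemma le_of_exp_smul_le {V W : Matrix S S ℝ} (a b : S)
    (h : ∀ x : ℝ, 0 ≤ x → NormedSpace.exp (x • V) a b ≤ NormedSpace.exp (x • W) a b) :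
    V a b ≤ W a b := by
  -- Both exponentials equal `I` at `0`, so the hypothesis says that the right difference quotient
  -- of `exp (xW) - exp (xV)` at `0` is nonnegative; its limit is `W - V`.
  have h1 := (hasDerivAt_exp_apply W 0 a b).sub (hasDerivAt_exp_apply V 0 a b)
  have h2 := h1.tendsto_slope_zero_right
  have h3 : 0 ≤ (W * NormedSpace.exp ((0 : ℝ) • W)) a b -
      (V * NormedSpace.exp ((0 : ℝ) • V)) a b := by
    refine ge_of_tendsto h2 ?_
    filter_upwards [self_mem_nhdsWithin] with t ht
    have ht' : 0 < t := ht
    have := h t ht'.le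
    simp only [zero_add, exp_zero_smul, Pi.sub_apply, sub_self, sub_zero, smul_eq_mul]
    exact mul_nonneg (inv_nonneg.2 ht'.le) (by linarith)
  simp only [exp_zero_smul, mul_one] at h3
  linarith

end MatrixExp

/-! ### The semigroup of crossing probabilities and its generator. -/

section CrossingGenerator

variable {S : Type*} [Fintype S] [DecidableEq S] {om et : S → ℝ} {K : Matrix S S ℝ}
  (hom : ∀ i, 0 < om i) (het : ∀ i, 0 < et i) (hK : ∀ i j, 0 ≤ K i j) (hK1 : ∀ i, ∑ j, K i j = 1)

variable (om et K) in
/-- The matrix of return probabilities, with real entries. -/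
def returnMatrix : Matrix S S ℝ := fun a b => (returnProb om et K a b).toReal

variable (om et K) in
/-- The generator `Δ_ω (Ψ - I)` attached to the return probabilities. -/
def crossGenerator : Matrix S S ℝ := fun a b => om a * (returnMatrix om et K - 1) a b

variable (om et K) in
/-- The crossing probabilities, with real entries. -/
def crossMatrix (w : ℝ) : Matrix S S ℝ := fun a b => (crossLim om et K w a b).toReal

lemma returnMatrix_nonneg (a b : S) : 0 ≤ returnMatrix om et K a b := ENNReal.toReal_nonneg

lemma crossMatrix_nonneg (w : ℝ) (a b : S) : 0 ≤ crossMatrix om et K w a b := ENNReal.toReal_nonneg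

lemma crossGenerator_offDiag (hom : ∀ i, 0 < om i) (a b : S) (hab : a ≠ b) :
    0 ≤ crossGenerator om et K a b := by
  rw [crossGenerator, Matrix.sub_apply, Matrix.one_apply_ne hab, sub_zero]
  exact mul_nonneg (hom a).le (returnMatrix_nonneg _ _)

include hom het hK hK1

lemma sum_returnProb_le (a : S) : ∑ b, returnProb om et K a b ≤ 1 :=
  sum_ascend_le het hK hK1 (measurable_crossLim hom het) (sum_crossLim_le hom het hK hK1) 0 a

lemma returnProb_ne_top (a b : S) : returnProb om et K a b ≠ ∞ :=
  ((Finset.single_le_sum (f := fun b => returnProb om et K a b) (fun _ _ => zero_le)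
    (Finset.mem_univ b)).trans_lt
    ((sum_returnProb_le hom het hK hK1 a).trans_lt ENNReal.one_lt_top)).ne

lemma sum_returnMatrix_le (a : S) : ∑ b, returnMatrix om et K a b ≤ 1 := by
  simp only [returnMatrix]
  rw [← ENNReal.toReal_sum fun b _ => returnProb_ne_top hom het hK hK1 a b, ← ENNReal.toReal_one]
  exact ENNReal.toReal_mono ENNReal.one_ne_top (sum_returnProb_le hom het hK hK1 a)

lemma crossMatrix_le_one (w : ℝ) (a b : S) : crossMatrix om et K w a b ≤ 1 := by
  rw [crossMatrix, ← ENNReal.toReal_one]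
  exact ENNReal.toReal_mono ENNReal.one_ne_top (crossLim_le_one hom het hK hK1 w a b)

lemma ofReal_crossMatrix (w : ℝ) (a b : S) :
    ENNReal.ofReal (crossMatrix om et K w a b) = crossLim om et K w a b :=
  ENNReal.ofReal_toReal (crossLim_ne_top hom het hK hK1 w a b)

lemma measurable_crossMatrix (a b : S) : Measurable fun w => crossMatrix om et K w a b :=
  (measurable_crossLim hom het a b).ennreal_toReal

lemma measurable_returnMatrix_mul (a b : S) :
    Measurable fun w => (returnMatrix om et K * crossMatrix om et K w) a b := by
  simp_rw [Matrix.mul_apply]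
  exact Finset.measurable_sum _ fun c _ =>
    (measurable_crossMatrix hom het hK hK1 c b).const_mul _

lemma returnMatrix_mul_nonneg (w : ℝ) (a b : S) :
    0 ≤ (returnMatrix om et K * crossMatrix om et K w) a b := by
  rw [Matrix.mul_apply]
  exact Finset.sum_nonneg fun c _ => mul_nonneg (returnMatrix_nonneg _ _) (crossMatrix_nonneg _ _ _)

lemma returnMatrix_mul_le_one (w : ℝ) (a b : S) :
    (returnMatrix om et K * crossMatrix om et K w) a b ≤ 1 := by
  rw [Matrix.mul_apply]
  refine (Finset.sum_le_sum fun c _ => mul_le_of_le_one_right (returnMatrix_nonneg a c)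
    (crossMatrix_le_one hom het hK hK1 w c b)).trans (sum_returnMatrix_le hom het hK hK1 a)

lemma intervalIntegrable_returnMatrix_mul (a b : S) (x y : ℝ) :
    IntervalIntegrable (fun w => (returnMatrix om et K * crossMatrix om et K w) a b)
      volume x y := by
  rw [intervalIntegrable_iff]
  refine Measure.integrableOn_of_bounded (M := 1) (by simp) 
    (measurable_returnMatrix_mul hom het hK hK1 a b).aestronglyMeasurable ?_
  refine Eventually.of_forall fun w => ?_
  rw [Real.norm_of_nonneg (returnMatrix_mul_nonneg hom het hK hK1 w a b)]
  exact returnMatrix_mul_le_one hom het hK hK1 w a b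

/-- The substitution `s = x - l` moves the variable `x` of the renewal equation into the factor
`e^{-ωx}` and the upper end of a primitive. Regularity can then be bootstrapped: bounded measurable
crossing probabilities are continuous, hence differentiable from the right. -/
lemma crossMatrix_eq {x : ℝ} (hx : 0 ≤ x) (a b : S) :
    crossMatrix om et K x a b = Real.exp (-(om a * x)) * ((1 : Matrix S S ℝ) a b +
      ∫ s in (0 : ℝ)..x, om a * Real.exp (om a * s) *
        (returnMatrix om et K * crossMatrix om et K s) a b) := by
  have h1 : ∀ l, (returnProb om et K * crossLim om et K (x - l)) a b =
      ENNReal.ofReal ((returnMatrix om et K * crossMatrix om et K (x - l)) a b) := by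
    intro l
    rw [Matrix.mul_apply, Matrix.mul_apply, ENNReal.ofReal_sum_of_nonneg fun c _ =>
      mul_nonneg (returnMatrix_nonneg _ _) (crossMatrix_nonneg _ _ _)]
    refine Finset.sum_congr rfl fun c _ => ?_
    rw [ENNReal.ofReal_mul (returnMatrix_nonneg _ _), ofReal_crossMatrix hom het hK hK1,
      returnMatrix, ENNReal.ofReal_toReal (returnProb_ne_top hom het hK hK1 a c)]
  have h2 := crossLim_eq hom het hK hK1 hx a b
  simp_rw [h1] at h2
  rw [setLIntegral_Iic_expMeasure (hom a) hx (φ := fun l =>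
    (returnMatrix om et K * crossMatrix om et K (x - l)) a b)] at h2
  · have h3 : ∫ l in (0 : ℝ)..x, om a * Real.exp (-(om a * l)) *
        (returnMatrix om et K * crossMatrix om et K (x - l)) a b =
        Real.exp (-(om a * x)) * ∫ s in (0 : ℝ)..x, om a * Real.exp (om a * s) *
        (returnMatrix om et K * crossMatrix om et K s) a b := by
      have := intervalIntegral.integral_comp_sub_left (a := 0) (b := x) (fun s =>
        om a * Real.exp (-(om a * (x - s))) * (returnMatrix om et K * crossMatrix om et K s) a b) x
      simp only [sub_sub_cancel, sub_self, sub_zero] at this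
      rw [this, ← intervalIntegral.integral_const_mul]
      congr 1
      ext s
      have : Real.exp (-(om a * (x - s))) = Real.exp (-(om a * x)) * Real.exp (om a * s) := by
        rw [← Real.exp_add]
        ring_nf
      rw [this]
      ring
    have hpos : 0 ≤ ∫ l in (0 : ℝ)..x, om a * Real.exp (-(om a * l)) *
        (returnMatrix om et K * crossMatrix om et K (x - l)) a b := by
      refine intervalIntegral.integral_nonneg hx fun l _ => ?_
      exact mul_nonneg (mul_nonneg (hom a).le (Real.exp_nonneg _))
        (returnMatrix_mul_nonneg hom het hK hK1 _ a b)
    have h4 : (1 : Matrix S S ℝ≥0∞) a b = ENNReal.ofReal ((1 : Matrix S S ℝ) a b) := by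
      rw [Matrix.one_apply, Matrix.one_apply]
      split_ifs <;> simp
    have h5 : 0 ≤ (1 : Matrix S S ℝ) a b := by
      rw [Matrix.one_apply]
      split_ifs <;> simp
    rw [h4, ← ENNReal.ofReal_mul (Real.exp_nonneg _),
      ← ENNReal.ofReal_add hpos (by positivity)] at h2
    rw [crossMatrix, h2, ENNReal.toReal_ofReal (by positivity), h3]
    ring
  · exact (measurable_returnMatrix_mul hom het hK hK1 a b).comp (measurable_const.sub measurable_id)
  · exact fun l _ => returnMatrix_mul_nonneg hom het hK hK1 _ a b
  · have := (intervalIntegrable_returnMatrix_mul hom het hK hK1 a b x 0).comp_sub_left x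
    simpa using this

lemma intervalIntegrable_weighted (a b : S) (x y : ℝ) :
    IntervalIntegrable (fun s => om a * Real.exp (om a * s) *
        (returnMatrix om et K * crossMatrix om et K s) a b) volume x y :=
  (intervalIntegrable_returnMatrix_mul hom het hK hK1 a b x y).continuousOn_mul (by fun_prop)

lemma continuousOn_crossMatrix (a b : S) :
    ContinuousOn (fun x => crossMatrix om et K x a b) (Set.Ici 0) := by
  have h := intervalIntegral.continuous_primitive (fun x y =>
    intervalIntegrable_weighted hom het hK hK1 a b x y) 0
  have h2 : Continuous fun x => Real.exp (-(om a * x)) * ((1 : Matrix S S ℝ) a b +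
      ∫ s in (0 : ℝ)..x, om a * Real.exp (om a * s) *
        (returnMatrix om et K * crossMatrix om et K s) a b) := by fun_prop
  exact h2.continuousOn.congr fun x hx => crossMatrix_eq hom het hK hK1 hx a b

lemma continuousWithinAt_weighted {x : ℝ} (hx : 0 ≤ x) (a b : S) :
    ContinuousWithinAt (fun s => om a * Real.exp (om a * s) *
      (returnMatrix om et K * crossMatrix om et K s) a b) (Set.Ioi x) x := by
  have h1 : ContinuousWithinAt (fun s => om a * Real.exp (om a * s)) (Set.Ioi x) x := by fun_prop
  refine h1.mul ?_
  simp_rw [Matrix.mul_apply]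
  refine tendsto_finsetSum _ fun c _ => Tendsto.const_mul _ ?_
  exact (continuousOn_crossMatrix hom het hK hK1 c b x hx).mono
    fun y hy => hx.trans (le_of_lt hy)

lemma measurable_weighted (a b : S) : Measurable fun s => om a * Real.exp (om a * s) *
    (returnMatrix om et K * crossMatrix om et K s) a b := by
  have h1 : Measurable fun s => om a * Real.exp (om a * s) := by fun_prop
  exact h1.mul (measurable_returnMatrix_mul hom het hK hK1 a b)

lemma hasDerivWithinAt_integral_weighted {x : ℝ} (hx : 0 ≤ x) (a b : S) :
    HasDerivWithinAt (fun x => ∫ s in (0 : ℝ)..x, om a * Real.exp (om a * s) *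
        (returnMatrix om et K * crossMatrix om et K s) a b)
      (om a * Real.exp (om a * x) * (returnMatrix om et K * crossMatrix om et K x) a b)
      (Set.Ici x) x :=
  intervalIntegral.integral_hasDerivWithinAt_right
    (intervalIntegrable_weighted hom het hK hK1 a b 0 x) (s := Set.Ici x) (t := Set.Ioi x)
    (measurable_weighted hom het hK hK1 a b).stronglyMeasurable.stronglyMeasurableAtFilter
    (continuousWithinAt_weighted hom het hK hK1 hx a b)

/-- The product rule applied to the integral equation: differentiating `e^{-ωx}` gives `-ω P`,
differentiating the primitive gives `ω Ψ P`, and together they make `Δ_ω (Ψ - I) P`. -/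
lemma hasDerivWithinAt_crossMatrix {x : ℝ} (hx : 0 ≤ x) (a b : S) :
    HasDerivWithinAt (fun x => crossMatrix om et K x a b)
      ((crossGenerator om et K * crossMatrix om et K x) a b) (Set.Ici x) x := by
  have hI := hasDerivWithinAt_integral_weighted hom het hK hK1 hx a b
  have hE : HasDerivWithinAt (fun x => Real.exp (-(om a * x)))
      (Real.exp (-(om a * x)) * (-(om a * 1))) (Set.Ici x) x :=
    (HasDerivAt.exp (((hasDerivAt_id' x).const_mul (om a)).fun_neg)).hasDerivWithinAt
  have hP' : HasDerivWithinAt (fun x => crossMatrix om et K x a b) _ (Set.Ici x) x :=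
    (hE.fun_mul (hI.const_add ((1 : Matrix S S ℝ) a b))).congr
      (fun y hy => crossMatrix_eq hom het hK hK1 (hx.trans hy) a b)
      (crossMatrix_eq hom het hK hK1 hx a b)
  refine hP'.congr_deriv ?_
  have h1 := crossMatrix_eq hom het hK hK1 hx a b
  have h2 : (crossGenerator om et K * crossMatrix om et K x) a b =
      om a * (returnMatrix om et K * crossMatrix om et K x) a b
        - om a * crossMatrix om et K x a b := by
    simp only [Matrix.mul_apply, crossGenerator, Matrix.sub_apply, mul_sub, sub_mul,
      Finset.sum_sub_distrib, Finset.mul_sum, mul_assoc]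
    congr 1
    simp [Matrix.one_apply]
  have h3 : Real.exp (-(om a * x)) * Real.exp (om a * x) = 1 := by
    rw [← Real.exp_add]
    simp
  rw [h2, h1]
  generalize (returnMatrix om et K * crossMatrix om et K x) a b = z
  linear_combination (om a * z) * h3

lemma crossMatrix_zero : crossMatrix om et K 0 = 1 := by
  ext a b
  simp [crossMatrix_eq hom het hK hK1 le_rfl a b]

/-- The crossing probabilities form the semigroup of `crossGenerator`. -/
theorem crossMatrix_eq_exp {x : ℝ} (hx : 0 ≤ x) :
    crossMatrix om et K x = NormedSpace.exp (x • crossGenerator om et K) := by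
  set U := crossGenerator om et K with hU
  -- `e^{-yU} P(y)` has right derivative zero, because `U` commutes with its exponential. Only right
  -- derivatives are at hand, so constancy is taken from continuity together with a vanishing right
  -- derivative.
  have key : ∀ a b, ∀ y ∈ Set.Icc (0 : ℝ) x,
      (NormedSpace.exp (y • (-U)) * crossMatrix om et K y) a b =
      (NormedSpace.exp ((0 : ℝ) • (-U)) * crossMatrix om et K 0) a b := by
    intro a b
    refine constant_of_has_deriv_right_zero ?_ ?_
    · simp_rw [Matrix.mul_apply]
      refine continuousOn_finsetSum _ fun c _ => ContinuousOn.mul ?_ ?_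
      · simpa using (continuous_mul_exp_apply 1 (-U) a c).continuousOn
      · exact (continuousOn_crossMatrix hom het hK hK1 c b).mono fun y hy => hy.1
    · intro y hy
      have h := HasDerivWithinAt.fun_sum (u := Finset.univ) fun c _ =>
        (hasDerivAt_exp_apply (-U) y a c).hasDerivWithinAt.fun_mul
          (hasDerivWithinAt_crossMatrix hom het hK hK1 hy.1 c b)
      simp_rw [Matrix.mul_apply (M := NormedSpace.exp _)]
      refine h.congr_deriv ?_
      rw [Finset.sum_add_distrib, ← Matrix.mul_apply, ← Matrix.mul_apply, commute_exp_smul,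
        Matrix.mul_assoc, ← hU, Matrix.neg_mul, Matrix.mul_neg, Matrix.neg_apply]
      simp
  have h0 : NormedSpace.exp (x • (-U)) * crossMatrix om et K x = 1 := by
    ext a b
    rw [key a b x ⟨hx, le_rfl⟩, exp_zero_smul, crossMatrix_zero hom het hK hK1, one_mul]
  have h1 : NormedSpace.exp (x • U) * NormedSpace.exp (x • (-U)) = 1 := by
    rw [smul_neg, ← neg_smul, ← exp_add_smul, add_neg_cancel, exp_zero_smul]
  calc _ = (NormedSpace.exp (x • U) * NormedSpace.exp (x • (-U))) * crossMatrix om et K x := by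
        rw [h1, one_mul]
    _ = _ := by rw [Matrix.mul_assoc, h0, mul_one]

lemma crossGenerator_rowSum (a : S) : ∑ b, crossGenerator om et K a b ≤ 0 := by
  have h := sum_returnMatrix_le hom het hK hK1 a
  have h1 : ∑ b, (1 : Matrix S S ℝ) a b = 1 := by simp [Matrix.one_apply]
  simp only [crossGenerator, ← Finset.mul_sum, Matrix.sub_apply, Finset.sum_sub_distrib, h1]
  exact mul_nonpos_of_nonneg_of_nonpos (hom a).le (by linarith)

end CrossingGenerator

end MMBM

namespace MMBM

/-! ### The fluid equation for the return probabilities and their minimality. -/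

section CrossingEquation

variable {S : Type*} [Fintype S] [DecidableEq S] {om et : S → ℝ} {K : Matrix S S ℝ}
  (hom : ∀ i, 0 < om i) (het : ∀ i, 0 < et i) (hK : ∀ i j, 0 ≤ K i j) (hK1 : ∀ i, ∑ j, K i j = 1)

lemma hasDerivAt_weighted_mul_exp (r : ℝ) (A V : Matrix S S ℝ) (x : ℝ) (a b : S) :
    HasDerivAt (fun x : ℝ => Real.exp (-(r * x)) * (A * NormedSpace.exp (x • V)) a b)
      (Real.exp (-(r * x)) * ((A * (V * NormedSpace.exp (x • V))) a b
        - r * (A * NormedSpace.exp (x • V)) a b)) x := by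
  have hE : HasDerivAt (fun x => Real.exp (-(r * x))) (Real.exp (-(r * x)) * (-(r * 1))) x :=
    HasDerivAt.exp (((hasDerivAt_id' x).const_mul r).fun_neg)
  refine (hE.fun_mul (hasDerivAt_mul_exp_apply A V x a b)).congr_deriv ?_
  ring

lemma mul_mul_exp_apply (A V : Matrix S S ℝ) (x : ℝ) (a b : S) :
    (A * (V * NormedSpace.exp (x • V))) a b = ∑ c, (A * NormedSpace.exp (x • V)) a c * V c b := by
  rw [commute_exp_smul, ← Matrix.mul_assoc, Matrix.mul_apply (N := V)]

lemma continuous_weighted_mul_exp (r : ℝ) (A V : Matrix S S ℝ) (a b : S) :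
    Continuous (fun x : ℝ => r * Real.exp (-(r * x)) * (A * NormedSpace.exp (x • V)) a b) := by
  have h1 : Continuous fun x : ℝ => r * Real.exp (-(r * x)) := by fun_prop
  exact h1.mul (continuous_mul_exp_apply A V a b)

/-- Integration by parts for `∫ r e^{-r x} A e^{x V} dx`. -/
lemma integral_weighted_mul_exp {r : ℝ} {A V G : Matrix S S ℝ} {a : S}
    (hG : ∀ b, r * G a b = r * A a b + (G * V) a b) (x : ℝ) (b : S) :
    ∫ l in (0 : ℝ)..x, r * Real.exp (-(r * l)) * (A * NormedSpace.exp (l • V)) a b =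
      G a b - Real.exp (-(r * x)) * (G * NormedSpace.exp (x • V)) a b := by
  -- The relation `r G = r A + G V` in row `a` says exactly that `-e^{-rl} G e^{lV}` is an
  -- antiderivative there. No convergence at infinity is involved, so `G` may be any solution of the
  -- relation.
  have hd : ∀ l : ℝ, r * Real.exp (-(r * l)) * (A * NormedSpace.exp (l • V)) a b =
      -(Real.exp (-(r * l)) * ((G * (V * NormedSpace.exp (l • V))) a b
        - r * (G * NormedSpace.exp (l • V)) a b)) := by
    intro l
    have : r * (G * NormedSpace.exp (l • V)) a b = r * (A * NormedSpace.exp (l • V)) a b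
        + (G * V * NormedSpace.exp (l • V)) a b := by
      simp only [Matrix.mul_apply (N := NormedSpace.exp _), Finset.mul_sum, ← mul_assoc, hG,
        add_mul, Finset.sum_add_distrib]
    rw [this, Matrix.mul_assoc]
    ring
  have h := intervalIntegral.integral_eq_sub_of_hasDerivAt (a := 0) (b := x)
    (fun l _ => (hasDerivAt_weighted_mul_exp r G V l a b).fun_neg)
    (by
      simp_rw [← hd]
      exact (continuous_weighted_mul_exp r A V a b).intervalIntegrable _ _)
  simp_rw [← hd] at h
  rw [h, exp_zero_smul]
  simp
  ring

section Semigroup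

include hom het hK hK1

lemma crossLim_eq_exp {x : ℝ} (hx : 0 ≤ x) (a b : S) :
    crossLim om et K x a b =
      ENNReal.ofReal (NormedSpace.exp (x • crossGenerator om et K) a b) := by
  rw [← crossMatrix_eq_exp hom het hK hK1 hx, ofReal_crossMatrix hom het hK hK1]

lemma mul_exp_nonneg {x : ℝ} (hx : 0 ≤ x) (a b : S) :
    0 ≤ (K * NormedSpace.exp (x • crossGenerator om et K)) a b := by
  rw [Matrix.mul_apply, ← crossMatrix_eq_exp hom het hK hK1 hx]
  exact Finset.sum_nonneg fun c _ => mul_nonneg (hK a c) (crossMatrix_nonneg _ _ _)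

/-- After an ascent of height `l` and a transition `K`, the return to the starting level is a
crossing from height `l`, of probability `e^{lU}`. So `Ψ` is the limit of these truncated integrals,
monotone before conversion to real numbers. -/
lemma tendsto_returnMatrix (a b : S) :
    Tendsto (fun n : ℕ => ∫ l in (0 : ℝ)..n, et a * Real.exp (-(et a * l)) *
      (K * NormedSpace.exp (l • crossGenerator om et K)) a b) atTop
      (𝓝 (returnMatrix om et K a b)) := by
  set U := crossGenerator om et K
  have h0 : ∀ n : ℕ, ∫⁻ h in Set.Iic (n : ℝ), ∑ c, ENNReal.ofReal (K a c) *
      crossLim om et K (0 + h) c b ∂expMeasure (et a) =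
      ENNReal.ofReal (∫ l in (0 : ℝ)..n, et a * Real.exp (-(et a * l)) *
      (K * NormedSpace.exp (l • U)) a b) := by
    intro n
    rw [← setLIntegral_Iic_expMeasure (het a) n.cast_nonneg
      (continuous_mul_exp_apply K U a b).measurable
      (fun l hl => mul_exp_nonneg hom het hK hK1 hl.1.le a b)
      ((continuous_mul_exp_apply K U a b).intervalIntegrable _ _)]
    refine lintegral_congr_ae (ae_restrict_of_ae ?_)
    filter_upwards [ae_pos_expMeasure (et a)] with l hl
    rw [zero_add, Matrix.mul_apply, ENNReal.ofReal_sum_of_nonneg]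
    · refine Finset.sum_congr rfl fun c _ => ?_
      rw [crossLim_eq_exp hom het hK hK1 hl.le, ENNReal.ofReal_mul (hK a c)]
    · intro c _
      rw [← crossMatrix_eq_exp hom het hK hK1 hl.le]
      exact mul_nonneg (hK a c) (crossMatrix_nonneg _ _ _)
  have h1 : returnProb om et K a b = ⨆ n : ℕ, ENNReal.ofReal (∫ l in (0 : ℝ)..n,
      et a * Real.exp (-(et a * l)) * (K * NormedSpace.exp (l • U)) a b) := by
    rw [returnProb, ascend, lintegral_eq_iSup_Iic]
    simp_rw [h0]
  have hmono : Monotone fun n : ℕ => ENNReal.ofReal (∫ l in (0 : ℝ)..n,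
      et a * Real.exp (-(et a * l)) * (K * NormedSpace.exp (l • U)) a b) := by
    intro n m hnm
    simp only [← h0]
    exact lintegral_mono_set (Set.Iic_subset_Iic.2 (by exact_mod_cast hnm))
  have h2 := tendsto_atTop_iSup hmono
  rw [← h1] at h2
  have h3 := (ENNReal.tendsto_toReal (returnProb_ne_top hom het hK hK1 a b)).comp h2
  refine h3.congr fun n => ?_
  simp only [Function.comp]
  refine ENNReal.toReal_ofReal (intervalIntegral.integral_nonneg n.cast_nonneg fun l hl => ?_)
  exact mul_nonneg (mul_nonneg (het a).le (Real.exp_nonneg _))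
    (mul_exp_nonneg hom het hK hK1 hl.1 a b)

/-- The return probabilities solve the fluid equation. -/
theorem isFluidSolution_returnMatrix : IsFluidSolution om et K (returnMatrix om et K) := by
  intro a b
  set U := crossGenerator om et K with hU
  set I : ℕ → S → ℝ := fun n b => ∫ l in (0 : ℝ)..n, et a * Real.exp (-(et a * l)) *
      (K * NormedSpace.exp (l • U)) a b with hI
  -- The integral over `[0, n]` of the derivative of `η e^{-ηl} K e^{lU}`. In the limit this is the
  -- fluid equation `-η K = Ψ U - η Ψ`, once the boundary term at `n` is shown to vanish.
  have hid : ∀ n : ℕ, et a * (Real.exp (-(et a * n)) * (K * NormedSpace.exp ((n : ℝ) • U)) a b)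
      - et a * K a b = ∑ c, I n c * U c b - et a * I n b := by
    intro n
    have h2 := fun c => continuous_weighted_mul_exp (et a) K U a c
    have hd : ∀ l : ℝ, et a * (Real.exp (-(et a * l)) * ((K * (U * NormedSpace.exp (l • U))) a b
        - et a * (K * NormedSpace.exp (l • U)) a b)) =
        ∑ c, et a * Real.exp (-(et a * l)) * (K * NormedSpace.exp (l • U)) a c * U c b
          - et a * (et a * Real.exp (-(et a * l)) * (K * NormedSpace.exp (l • U)) a b) := by
      intro l
      rw [mul_mul_exp_apply, mul_sub, Finset.mul_sum, mul_sub, Finset.mul_sum]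
      congr 1
      · exact Finset.sum_congr rfl fun c _ => by ring
      · ring
    have hc1 : Continuous fun l : ℝ =>
        ∑ c, et a * Real.exp (-(et a * l)) * (K * NormedSpace.exp (l • U)) a c * U c b :=
      continuous_finsetSum _ fun c _ => (h2 c).mul continuous_const
    have hc2 : Continuous fun l : ℝ =>
        et a * (et a * Real.exp (-(et a * l)) * (K * NormedSpace.exp (l • U)) a b) :=
      (h2 b).const_mul _
    have h := intervalIntegral.integral_eq_sub_of_hasDerivAt (a := 0) (b := n)
      (fun l _ => ((hasDerivAt_weighted_mul_exp (et a) K U l a b).const_mul (et a)).congr_deriv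
        (hd l)) ((hc1.sub hc2).intervalIntegrable _ _)
    rw [exp_zero_smul] at h
    simp only [mul_one, mul_zero, neg_zero, Real.exp_zero, one_mul] at h
    rw [← h, intervalIntegral.integral_sub (hc1.intervalIntegrable _ _)
      (hc2.intervalIntegrable _ _), intervalIntegral.integral_const_mul]
    congr 1
    refine (intervalIntegral.integral_finsetSum (f := fun c l => et a * Real.exp (-(et a * l)) *
      (K * NormedSpace.exp (l • U)) a c * U c b)
      fun c _ => ((h2 c).mul continuous_const).intervalIntegrable _ _).trans ?_
    exact Finset.sum_congr rfl fun c _ => intervalIntegral.integral_mul_const _ _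
  -- The entries of `K e^{nU}` are at most `1`: the rows of `K` sum to `1` and the entries of
  -- `e^{nU}` are crossing probabilities. The factor `e^{-ηn}` then wins.
  have hlim0 : Tendsto (fun n : ℕ => Real.exp (-(et a * n)) *
      (K * NormedSpace.exp ((n : ℝ) • U)) a b) atTop (𝓝 0) := by
    have h1 : Tendsto (fun n : ℕ => Real.exp (-(et a * n))) atTop (𝓝 0) :=
      Real.tendsto_exp_neg_atTop_nhds_zero.comp
        ((tendsto_natCast_atTop_atTop (R := ℝ)).const_mul_atTop (het a))
    refine squeeze_zero (fun n => mul_nonneg (Real.exp_nonneg _)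
      (mul_exp_nonneg hom het hK hK1 n.cast_nonneg a b)) (fun n => ?_) h1
    refine mul_le_of_le_one_right (Real.exp_nonneg _) ?_
    rw [Matrix.mul_apply, ← crossMatrix_eq_exp hom het hK hK1 n.cast_nonneg, ← hK1 a]
    exact Finset.sum_le_sum fun c _ => mul_le_of_le_one_right (hK a c)
      (crossMatrix_le_one hom het hK hK1 _ _ _)
  have hl := (hlim0.const_mul (et a)).sub_const (et a * K a b)
  have hr : Tendsto (fun n => ∑ c, I n c * U c b - et a * I n b) atTop
      (𝓝 (∑ c, returnMatrix om et K a c * U c b - et a * returnMatrix om et K a b)) :=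
    (tendsto_finsetSum _ fun c _ =>
      (tendsto_returnMatrix hom het hK hK1 a c).mul_const _).sub
      ((tendsto_returnMatrix hom het hK hK1 a b).const_mul _)
  simp_rw [hid] at hl
  have := tendsto_nhds_unique hl hr
  have hUd : ∀ c, U c b = om c * (returnMatrix om et K - 1) c b := fun c => rfl
  simp_rw [hUd] at this
  linarith

end Semigroup

section Minimal

variable {Φ : Matrix S S ℝ} (hΦ0 : ∀ i j, 0 ≤ Φ i j) (hΦ : IsFluidSolution om et K Φ)

include hom het hK hΦ0 hΦ

/-- The crossing probabilities are dominated by the semigroup attached to any nonnegative solution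
of the fluid equation. -/
lemma crossProb_le_exp {V : Matrix S S ℝ} (hV : ∀ i j, V i j = om i * (Φ - 1) i j) (r : ℕ)
    {x : ℝ} (hx : 0 ≤ x) (a b : S) :
    crossProb om et K r x a b ≤ ENNReal.ofReal (NormedSpace.exp (x • V) a b) := by
  have hoff : ∀ i j, i ≠ j → 0 ≤ V i j := by
    intro i j hij
    rw [hV, Matrix.sub_apply, Matrix.one_apply_ne hij, sub_zero]
    exact mul_nonneg (hom i).le (hΦ0 i j)
  have hexp : ∀ x : ℝ, 0 ≤ x → ∀ a b, 0 ≤ NormedSpace.exp (x • V) a b :=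
    fun x hx => exp_smul_nonneg hoff hx
  have hmul : ∀ (A : Matrix S S ℝ), (∀ i j, 0 ≤ A i j) → ∀ x : ℝ, 0 ≤ x → ∀ a b,
      0 ≤ (A * NormedSpace.exp (x • V)) a b := by
    intro A hA x hx a b
    rw [Matrix.mul_apply]
    exact Finset.sum_nonneg fun c _ => mul_nonneg (hA a c) (hexp x hx c b)
  induction r generalizing x a b with
  | zero => exact zero_le
  | succ r ih =>
    -- Bound after an ascent from height `v`: the induction hypothesis puts `e^{(v+h)V}` under the
    -- integral, and integration by parts leaves `Φ e^{vV}` minus a nonnegative boundary term.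
    have hasc : ∀ v, 0 ≤ v → ascend et K (crossProb om et K r) v a b ≤
        ENNReal.ofReal ((Φ * NormedSpace.exp (v • V)) a b) := by
      intro v hv
      have h1 : ascend et K (crossProb om et K r) v a b ≤
          ∫⁻ h, ENNReal.ofReal ((K * NormedSpace.exp ((v + h) • V)) a b) ∂expMeasure (et a) := by
        refine lintegral_mono_ae ?_
        filter_upwards [ae_pos_expMeasure (et a)] with h hh
        rw [Matrix.mul_apply, ENNReal.ofReal_sum_of_nonneg fun c _ =>
          mul_nonneg (hK a c) (hexp _ (by linarith) c b)]
        refine Finset.sum_le_sum fun c _ => ?_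
        rw [ENNReal.ofReal_mul (hK a c)]
        gcongr
        exact ih (by linarith) c b
      refine h1.trans ?_
      rw [lintegral_eq_iSup_Iic]
      refine iSup_le fun n => ?_
      have hc : Continuous fun h : ℝ => (K * NormedSpace.exp ((v + h) • V)) a b :=
        (continuous_mul_exp_apply K V a b).comp (continuous_const_add v)
      rw [setLIntegral_Iic_expMeasure (het a) n.cast_nonneg hc.measurable
        (fun l hl => hmul K hK _ (by linarith [hl.1]) a b) (hc.intervalIntegrable _ _)]
      refine ENNReal.ofReal_le_ofReal ?_
      have hassoc : ∀ (A : Matrix S S ℝ) (h : ℝ), A * NormedSpace.exp ((v + h) • V) =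
          A * NormedSpace.exp (v • V) * NormedSpace.exp (h • V) := by
        intro A h
        rw [exp_add_smul, Matrix.mul_assoc]
      simp_rw [hassoc]
      -- The relation required of `G = Φ e^{vV}` is the fluid equation for `Φ` multiplied on the
      -- right by `e^{vV}`, since `V` commutes with its exponential.
      rw [integral_weighted_mul_exp (G := Φ * NormedSpace.exp (v • V))]
      · rw [sub_le_self_iff, ← hassoc]
        exact mul_nonneg (Real.exp_nonneg _) (hmul Φ hΦ0 _ (by positivity) a b)
      · intro d
        have h2 : Φ * NormedSpace.exp (v • V) * V = Φ * V * NormedSpace.exp (v • V) := by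
          rw [Matrix.mul_assoc, ← commute_exp_smul, Matrix.mul_assoc]
        have h3 : ∀ c, et a * Φ a c = et a * K a c + (Φ * V) a c := by
          intro c
          rw [hΦ a c, Matrix.mul_apply]
          simp_rw [hV]
        rw [h2]
        simp only [Matrix.mul_apply (N := NormedSpace.exp _), Finset.mul_sum, ← mul_assoc, h3,
          add_mul, Finset.sum_add_distrib]
    rw [crossProb_succ_of_nonneg hom het r hx]
    have hc : Continuous fun l : ℝ => (Φ * NormedSpace.exp ((x - l) • V)) a b :=
      (continuous_mul_exp_apply Φ V a b).comp (continuous_const.sub continuous_id)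
    -- The antiderivative is `-e^{-ωl} e^{(x-l)V}`; writing `e^{-ωl} = e^{-ωx} e^{ω(x-l)}` makes it
    -- a function of `x - l`, to which the weighted derivative applies with rate `-ω`.
    have hd : ∀ l : ℝ, HasDerivAt (fun l : ℝ => -(Real.exp (-(om a * x)) *
        (Real.exp (-(-(om a) * (x - l))) *
          ((1 : Matrix S S ℝ) * NormedSpace.exp ((x - l) • V)) a b)))
        (om a * Real.exp (-(om a * l)) * (Φ * NormedSpace.exp ((x - l) • V)) a b) l := by
      intro l
      have h := (((hasDerivAt_weighted_mul_exp (-(om a)) 1 V (x - l) a b).scomp l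
        ((hasDerivAt_id' l).const_sub x)).const_mul (Real.exp (-(om a * x)))).fun_neg
      refine h.congr_deriv ?_
      have he : Real.exp (-(om a * l)) = Real.exp (-(om a * x)) *
          Real.exp (-(-(om a) * (x - l))) := by
        rw [← Real.exp_add]
        ring_nf
      have hVΦ : (V * NormedSpace.exp ((x - l) • V)) a b =
          om a * (Φ * NormedSpace.exp ((x - l) • V)) a b
            - om a * NormedSpace.exp ((x - l) • V) a b := by
        simp only [Matrix.mul_apply, hV, Matrix.sub_apply, mul_sub, sub_mul,
          Finset.sum_sub_distrib, Finset.mul_sum, mul_assoc]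
        congr 1
        simp [Matrix.one_apply]
      rw [one_mul, one_mul, hVΦ, he, smul_eq_mul]
      ring
    have hcw : Continuous fun l : ℝ =>
        om a * Real.exp (-(om a * l)) * (Φ * NormedSpace.exp ((x - l) • V)) a b := by
      have h1 : Continuous fun l : ℝ => om a * Real.exp (-(om a * l)) := by fun_prop
      exact h1.mul hc
    -- The missing `e^{-ωx} I` is the probability of crossing in the first descent, so the two
    -- contributions add up to `e^{xV}` exactly and the induction closes.
    have hint : ∫ l in (0 : ℝ)..x,
        om a * Real.exp (-(om a * l)) * (Φ * NormedSpace.exp ((x - l) • V)) a b =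
        NormedSpace.exp (x • V) a b - Real.exp (-(om a * x)) * (1 : Matrix S S ℝ) a b := by
      rw [intervalIntegral.integral_eq_sub_of_hasDerivAt (fun l _ => hd l)
        (hcw.intervalIntegrable _ _)]
      have he : Real.exp (-(om a * x)) * Real.exp (om a * x) = 1 := by
        rw [← Real.exp_add]
        simp
      simp only [sub_self, exp_zero_smul, mul_one, mul_zero, neg_zero, Real.exp_zero,
        one_mul, sub_zero, neg_mul, neg_neg]
      rw [← mul_assoc, he]
      ring
    have hpos : 0 ≤ ∫ l in (0 : ℝ)..x,
        om a * Real.exp (-(om a * l)) * (Φ * NormedSpace.exp ((x - l) • V)) a b :=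
      intervalIntegral.integral_nonneg hx fun l hl => mul_nonneg
        (mul_nonneg (hom a).le (Real.exp_nonneg _)) (hmul Φ hΦ0 _ (by linarith [hl.2]) a b)
    have h1 : ∫⁻ l in Set.Iic x, ascend et K (crossProb om et K r) (x - l) a b
          ∂expMeasure (om a) ≤ ENNReal.ofReal (∫ l in (0 : ℝ)..x,
        om a * Real.exp (-(om a * l)) * (Φ * NormedSpace.exp ((x - l) • V)) a b) := by
      rw [← setLIntegral_Iic_expMeasure (hom a) hx hc.measurable
        (fun l hl => hmul Φ hΦ0 _ (by linarith [hl.2]) a b) (hc.intervalIntegrable _ _)]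
      refine setLIntegral_mono' measurableSet_Iic fun l hl => hasc _ ?_
      have : l ≤ x := hl
      linarith
    have h2 : (1 : Matrix S S ℝ≥0∞) a b = ENNReal.ofReal ((1 : Matrix S S ℝ) a b) := by
      rw [Matrix.one_apply, Matrix.one_apply]
      split_ifs <;> simp
    have h3 : 0 ≤ (1 : Matrix S S ℝ) a b := by
      rw [Matrix.one_apply]
      split_ifs <;> simp
    rw [h2, ← ENNReal.ofReal_mul (Real.exp_nonneg _)]
    refine (add_le_add_left h1 _).trans_eq ?_
    rw [← ENNReal.ofReal_add hpos (by positivity), hint, sub_add_cancel]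

include hK1 het in
/-- The matrix of return probabilities is the minimal nonnegative solution of the fluid
equation. -/
theorem returnMatrix_le (a b : S) : returnMatrix om et K a b ≤ Φ a b := by
  set V : Matrix S S ℝ := Matrix.of fun i j => om i * (Φ - 1) i j with hVdef
  have hV : ∀ i j, V i j = om i * (Φ - 1) i j := fun i j => rfl
  have h1 : ∀ x : ℝ, 0 ≤ x → NormedSpace.exp (x • crossGenerator om et K) a b ≤
      NormedSpace.exp (x • V) a b := by
    intro x hx
    have h : crossLim om et K x a b ≤ ENNReal.ofReal (NormedSpace.exp (x • V) a b) :=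
      iSup_le fun r => crossProb_le_exp hom het hK hΦ0 hΦ hV r hx a b
    have hpos : 0 ≤ NormedSpace.exp (x • V) a b := by
      refine exp_smul_nonneg (fun i j hij => ?_) hx a b
      rw [hV, Matrix.sub_apply, Matrix.one_apply_ne hij, sub_zero]
      exact mul_nonneg (hom i).le (hΦ0 i j)
    rw [crossLim_eq_exp hom het hK hK1 hx] at h
    exact (ENNReal.ofReal_le_ofReal_iff hpos).1 h
  have h2 := le_of_exp_smul_le a b h1
  rw [hV] at h2
  simpa using le_of_mul_le_mul_left h2 (hom a)

end Minimal

end CrossingEquation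

end MMBM

namespace MMBM

/-! ### Independence of generated σ-algebras -/

section Indep

variable {Ω : Type*}

lemma isPiSystem_image2_inter {C D : Set (Set Ω)} (hC : IsPiSystem C) (hD : IsPiSystem D) :
    IsPiSystem (Set.image2 (· ∩ ·) C D) := by
  rintro - ⟨a, ha, b, hb, rfl⟩ - ⟨a', ha', b', hb', rfl⟩ hne
  have h : a ∩ b ∩ (a' ∩ b') = (a ∩ a') ∩ (b ∩ b') := Set.inter_inter_inter_comm _ _ _ _
  simp only [h] at hne ⊢
  exact ⟨_, hC a ha a' ha' (hne.mono Set.inter_subset_left), _,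
    hD b hb b' hb' (hne.mono Set.inter_subset_right), rfl⟩

lemma generateFrom_image2_inter {C D : Set (Set Ω)} (hC : Set.univ ∈ C) (hD : Set.univ ∈ D) :
    MeasurableSpace.generateFrom (Set.image2 (· ∩ ·) C D) =
      MeasurableSpace.generateFrom C ⊔ MeasurableSpace.generateFrom D := by
  refine le_antisymm ?_ (sup_le ?_ ?_)
  · refine MeasurableSpace.generateFrom_le ?_
    rintro - ⟨a, ha, b, hb, rfl⟩
    exact MeasurableSet.inter
      ((le_sup_left : MeasurableSpace.generateFrom C ≤ _) _
        (MeasurableSpace.measurableSet_generateFrom ha))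
      ((le_sup_right : MeasurableSpace.generateFrom D ≤ _) _
        (MeasurableSpace.measurableSet_generateFrom hb))
  · exact MeasurableSpace.generateFrom_mono fun a ha => ⟨a, ha, _, hD, Set.inter_univ a⟩
  · exact MeasurableSpace.generateFrom_mono fun a ha => ⟨_, hC, a, ha, Set.univ_inter a⟩

/-- Independence of joins of σ-algebras is checked on intersections. -/
lemma indep_sup_sup {m₁ m₂ m₃ m₄ m₅ m₀ : MeasurableSpace Ω} {P : Measure Ω}
    [IsProbabilityMeasure P] (h₁ : m₁ ≤ m₀) (h₂ : m₂ ≤ m₀) (h₃ : m₃ ≤ m₀) (h₄ : m₄ ≤ m₀)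
    (h₅ : m₅ ≤ m₀)
    (h : ∀ s₁ s₂ s₃ s₄ s₅, MeasurableSet[m₁] s₁ → MeasurableSet[m₂] s₂ → MeasurableSet[m₃] s₃ →
      MeasurableSet[m₄] s₄ → MeasurableSet[m₅] s₅ →
      P (s₁ ∩ (s₂ ∩ s₃) ∩ (s₄ ∩ s₅)) = P (s₁ ∩ (s₂ ∩ s₃)) * P (s₄ ∩ s₅)) :
    Indep (m₁ ⊔ (m₂ ⊔ m₃)) (m₄ ⊔ m₅) P := by
  have hpi : ∀ m : MeasurableSpace Ω, IsPiSystem {s | MeasurableSet[m] s} :=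
    fun m => @MeasurableSpace.isPiSystem_measurableSet Ω m
  have hgen : ∀ m : MeasurableSpace Ω, m = MeasurableSpace.generateFrom {s | MeasurableSet[m] s} :=
    fun m => (@MeasurableSpace.generateFrom_measurableSet Ω m).symm
  have huniv : ∀ m : MeasurableSpace Ω, Set.univ ∈ {s | MeasurableSet[m] s} :=
    fun m => @MeasurableSet.univ Ω m
  refine IndepSets.indep (sup_le h₁ (sup_le h₂ h₃)) (sup_le h₄ h₅)
    (isPiSystem_image2_inter (hpi m₁) (isPiSystem_image2_inter (hpi m₂) (hpi m₃)))
    (isPiSystem_image2_inter (hpi m₄) (hpi m₅)) ?_ ?_ ?_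
  · have h23 : Set.univ ∈ Set.image2 (· ∩ ·) {s | MeasurableSet[m₂] s} {s | MeasurableSet[m₃] s} :=
      ⟨_, huniv _, _, huniv _, Set.inter_univ _⟩
    rw [generateFrom_image2_inter (huniv _) h23, generateFrom_image2_inter (huniv _) (huniv _),
      ← hgen, ← hgen, ← hgen]
  · rw [generateFrom_image2_inter (huniv _) (huniv _), ← hgen, ← hgen]
  · rw [IndepSets_iff]
    rintro - - ⟨s₁, hs₁, -, ⟨s₂, hs₂, s₃, hs₃, rfl⟩, rfl⟩ ⟨s₄, hs₄, s₅, hs₅, rfl⟩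
    exact h s₁ s₂ s₃ s₄ s₅ hs₁ hs₂ hs₃ hs₄ hs₅

end Indep

/-! ### Drivers with regular paths -/

/-- A Brownian motion `B`, a Poisson process `A` of rate `q` and a process `X`, mutually
independent, all paths of `B` and `A` being regular. -/
structure IsRegularDrivers {S Ω : Type*} [MeasurableSpace S] [MeasurableSpace Ω] (P : Measure Ω)
    (B : ℝ≥0 → Ω → ℝ) (A : ℝ≥0 → Ω → ℕ) (X : ℕ → Ω → S) (q : ℝ) : Prop where
  rate_pos : 0 < q
  measurable_B : ∀ t, Measurable (B t)
  measurable_A : ∀ t, Measurable (A t)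
  measurable_X : ∀ k, Measurable (X k)
  continuous_B : ∀ ω, Continuous fun t => B t ω
  B_zero : ∀ ω, B 0 ω = 0
  mono_A : ∀ ω, Monotone fun t => A t ω
  A_zero : ∀ ω, A 0 ω = 0
  right_A : ∀ ω t, ∃ s, t < s ∧ A s ω = A t ω
  surj_A : ∀ ω k, ∃ t, A t ω = k
  brownian : IsPreBrownianReal B P
  indep_A : HasIndepIncrements (fun t ω => (A t ω : ℝ)) P
  law_A : ∀ t s, P {ω | A (t + s) ω = A t ω} = ENNReal.ofReal (Real.exp (-(q * s)))
  indep_B_AX : IndepFun (fun ω t => B t ω) (fun ω => (fun t => A t ω, fun k => X k ω)) P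
  indep_A_X : IndepFun (fun ω t => A t ω) (fun ω k => X k ω) P

/-- The time from `t` until the next arrival. -/
def nextArrival {Ω : Type*} (A : ℝ≥0 → Ω → ℕ) (t : ℝ≥0) (ω : Ω) : ℝ≥0 :=
  sInf {s | A t ω < A (t + s) ω}

/-- Continuous paths. -/
abbrev Path := {w : ℝ≥0 → ℝ // Continuous w}

/-- Joint measurability comes from continuity in time, which is the reason for bundling paths with
their continuity: they are to be evaluated at random times. -/
lemma measurable_path_eval : Measurable fun p : Path × ℝ≥0 => p.1.1 p.2 := by
  have h := measurable_uncurry_of_continuous_of_measurable (u := fun (t : ℝ≥0) (w : Path) => w.1 t)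
    (fun w => w.2) (fun t => (measurable_pi_apply t).comp measurable_subtype_coe)
  exact h.comp measurable_swap

/-! ### Depth and height of a drifted path over an interval. -/

section Blocks

/-- The displacement of the path `m t + s w(t)` over a time fraction `r` of `[a, a + e]`. -/
def segment (m s : ℝ) (w : ℝ≥0 → ℝ) (a e r : ℝ≥0) : ℝ := m * (r * e) + s * (w (a + r * e) - w a)

/-- The depth of the path `m t + s w(t)` over `[a, a + e]` below its starting point. -/
def depth (m s : ℝ) (w : ℝ≥0 → ℝ) (a e : ℝ≥0) : ℝ := -sInf (segment m s w a e '' Set.Icc 0 1)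

/-- The height of the end point of the path `m t + s w(t)` over `[a, a + e]` above its minimum. -/
def height (m s : ℝ) (w : ℝ≥0 → ℝ) (a e : ℝ≥0) : ℝ := segment m s w a e 1 + depth m s w a e

variable {m s : ℝ} {w : ℝ≥0 → ℝ}

lemma continuous_segment (hw : Continuous w) :
    Continuous fun p : (ℝ≥0 × ℝ≥0) × ℝ≥0 => segment m s w p.1.1 p.1.2 p.2 := by
  unfold segment
  fun_prop

lemma continuous_segment_right (hw : Continuous w) (a e : ℝ≥0) : Continuous (segment m s w a e) :=
  (continuous_segment hw).comp (by fun_prop : Continuous fun r : ℝ≥0 => ((a, e), r))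

/-- Time is measured in fractions of the interval, so the infimum runs over the fixed compact set
`[0, 1]` and depends continuously on the start and the length. -/
lemma continuous_depth (hw : Continuous w) :
    Continuous fun p : ℝ≥0 × ℝ≥0 => depth m s w p.1 p.2 :=
  (isCompact_Icc.continuous_sInf (f := fun p : ℝ≥0 × ℝ≥0 => segment m s w p.1 p.2)
    (continuous_segment hw)).neg

lemma continuous_height (hw : Continuous w) :
    Continuous fun p : ℝ≥0 × ℝ≥0 => height m s w p.1 p.2 :=
  ((continuous_segment hw).comp (by fun_prop : Continuous fun p : ℝ≥0 × ℝ≥0 => (p, (1 : ℝ≥0)))).add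
    (continuous_depth hw)

lemma measurable_segment (m s : ℝ) (r : ℝ≥0) :
    Measurable fun p : Path × ℝ≥0 × ℝ≥0 => segment m s p.1.1 p.2.1 p.2.2 r := by
  unfold segment
  have h1 : Measurable fun p : Path × ℝ≥0 × ℝ≥0 => p.1.1 (p.2.1 + r * p.2.2) :=
    measurable_path_eval.comp (f := fun p : Path × ℝ≥0 × ℝ≥0 => (p.1, p.2.1 + r * p.2.2))
      (by fun_prop)
  have h2 : Measurable fun p : Path × ℝ≥0 × ℝ≥0 => p.1.1 p.2.1 :=
    measurable_path_eval.comp (f := fun p : Path × ℝ≥0 × ℝ≥0 => (p.1, p.2.1)) (by fun_prop)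
  fun_prop

lemma bddBelow_segment (hw : Continuous w) (a e : ℝ≥0) :
    BddBelow (segment m s w a e '' Set.Icc 0 1) :=
  (isCompact_Icc.image (continuous_segment_right hw a e)).bddBelow

/-- By continuity of the path, the infimum is below `c` if and only if the path is below `c` at one
of countably many dense time fractions. -/
lemma measurable_depth (m s : ℝ) :
    Measurable fun p : Path × ℝ≥0 × ℝ≥0 => depth m s p.1.1 p.2.1 p.2.2 := by
  refine Measurable.neg (measurable_of_Iio fun c => ?_)
  have : ((fun p : Path × ℝ≥0 × ℝ≥0 => sInf (segment m s p.1.1 p.2.1 p.2.2 '' Set.Icc 0 1)) ⁻¹'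
      Set.Iio c) = ⋃ n : ℕ, {p | segment m s p.1.1 p.2.1 p.2.2
        (TopologicalSpace.denseSeq (Set.Icc (0 : ℝ≥0) 1) n) < c} := by
    ext p
    simp only [Set.mem_preimage, Set.mem_Iio, Set.mem_iUnion, Set.mem_ofPred_eq]
    rw [csInf_lt_iff (bddBelow_segment p.1.2 _ _) ⟨_, 0, by simp, rfl⟩]
    constructor
    · rintro ⟨-, ⟨r, hr, rfl⟩, hlt⟩
      have ho : IsOpen {r : Set.Icc (0 : ℝ≥0) 1 | segment m s p.1.1 p.2.1 p.2.2 r < c} :=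
        isOpen_lt ((continuous_segment_right p.1.2 _ _).comp continuous_subtype_val)
          continuous_const
      obtain ⟨n, hn⟩ := (TopologicalSpace.denseRange_denseSeq _).exists_mem_open ho ⟨⟨r, hr⟩, hlt⟩
      exact ⟨n, hn⟩
    · rintro ⟨n, hn⟩
      exact ⟨_, ⟨_, (TopologicalSpace.denseSeq (Set.Icc (0 : ℝ≥0) 1) n).2, rfl⟩, hn⟩
  rw [this]
  exact MeasurableSet.iUnion fun n => (measurable_segment m s _) measurableSet_Iio

lemma measurable_height (m s : ℝ) :
    Measurable fun p : Path × ℝ≥0 × ℝ≥0 => height m s p.1.1 p.2.1 p.2.2 :=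
  (measurable_segment m s 1).add (measurable_depth m s)

lemma depth_nonneg (hw : Continuous w) (a e : ℝ≥0) : 0 ≤ depth m s w a e := by
  rw [depth, neg_nonneg]
  exact csInf_le (bddBelow_segment hw a e) ⟨0, by simp, by simp [segment]⟩

lemma height_nonneg (hw : Continuous w) (a e : ℝ≥0) : 0 ≤ height m s w a e := by
  rw [height, depth, ← sub_eq_add_neg, sub_nonneg]
  exact csInf_le (bddBelow_segment hw a e) ⟨1, by simp, rfl⟩

lemma lt_depth_iff (hw : Continuous w) (a e : ℝ≥0) (x : ℝ) :
    x < depth m s w a e ↔ ∃ t ≤ e, m * t + s * (w (a + t) - w a) < -x := by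
  rw [depth, lt_neg, csInf_lt_iff (bddBelow_segment hw a e) ⟨_, 0, by simp, rfl⟩]
  constructor
  · rintro ⟨-, ⟨r, hr, rfl⟩, h⟩
    refine ⟨r * e, mul_le_of_le_one_left zero_le hr.2, ?_⟩
    simpa [segment] using h
  · rintro ⟨t, ht, h⟩
    refine ⟨_, ⟨t / e, ⟨zero_le, div_le_one_of_le₀ ht zero_le⟩, rfl⟩, ?_⟩
    -- For `e = 0` the quotient is `0` by convention, which is right because then `t = 0`.
    have hte : t / e * e = t := by
      rcases eq_or_ne e 0 with rfl | he
      · simp [le_antisymm ht zero_le]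
      · exact div_mul_cancel₀ t he
    have hte' : ((t / e : ℝ≥0) : ℝ) * e = t := by rw [← NNReal.coe_mul, hte]
    rw [segment, hte', hte]
    exact h

end Blocks

end MMBM

/-! ### Independence of the past, and the waiting time for the next arrival. -/

namespace MMBM

variable {S Ω : Type*} [MeasurableSpace S] {m0 : MeasurableSpace Ω} {P : Measure Ω}
  [IsProbabilityMeasure P]

/-- The past of a process with independent increments is independent of a future increment. -/
lemma indepFun_past_increment {Z : ℝ≥0 → Ω → ℝ} (hZ : HasIndepIncrements Z P)
    (hm : ∀ t, Measurable (Z t)) (h0 : ∀ ω, Z 0 ω = 0) (t s : ℝ≥0) :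
    IndepFun (fun ω (u : Set.Iic t) => Z u ω) (fun ω => Z (t + s) ω - Z t ω) P := by
  refine IndepFun.process_indepFun (X := fun (u : Set.Iic t) => Z u) (fun u => hm u)
    ((hm _).sub (hm _)) fun I => ?_
  set I' : Finset ℝ≥0 := I.map (Function.Embedding.subtype _) with hI'
  set n := I'.card with hn
  have hle : ∀ u ∈ I', u ≤ t := fun u hu => by
    obtain ⟨v, -, rfl⟩ := Finset.mem_map.1 hu
    exact v.2
  -- `ρ` lists the finitely many past times in increasing order, then `t`, then `t + s` for ever;
  -- `τ` puts `0` in front. The increment of index `n + 1` along `τ` is the future one, and each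
  -- past value is a sum of increments of smaller index, since the process starts at `0`.
  let ρ : ℕ → ℝ≥0 := fun k => if h : k < n then I'.orderEmbOfFin hn.symm ⟨k, h⟩ else
    if k = n then t else t + s
  let τ : ℕ → ℝ≥0 := fun k => Nat.casesOn k 0 ρ
  have hρ : Monotone ρ := by
    refine monotone_nat_of_le_succ fun k => ?_
    simp only [ρ]
    rcases lt_trichotomy (k + 1) n with h | h | h
    · rw [dif_pos h, dif_pos (by omega)]
      exact (I'.orderEmbOfFin hn.symm).monotone (Fin.mk_le_mk.2 (Nat.le_succ k))
    · rw [dif_pos (by omega), dif_neg (by omega), if_pos h]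
      exact hle _ (Finset.orderEmbOfFin_mem _ _ _)
    · rw [dif_neg (by omega), dif_neg (by omega), if_neg (by omega : ¬ k + 1 = n)]
      split_ifs
      · exact le_self_add
      · exact le_rfl
  have hτ : Monotone τ := monotone_nat_of_le_succ fun k => by
    cases k with
    | zero => exact zero_le
    | succ k => exact hρ (Nat.le_succ k)
  have hex : ∀ i : I, ∃ k < n, ρ k = (i : Set.Iic t) := fun i => by
    have hi : ((i : Set.Iic t) : ℝ≥0) ∈ Set.range (I'.orderEmbOfFin hn.symm) := by
      rw [Finset.range_orderEmbOfFin]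
      exact Finset.mem_coe.2 (Finset.mem_map.2 ⟨i, i.2, rfl⟩)
    obtain ⟨k, hk⟩ := hi
    exact ⟨k, k.2, by simp only [ρ]; rw [dif_pos k.2]; exact hk⟩
  choose κ hκ hκρ using hex
  have hind := (hZ.nat hτ).indepFun_finset (Finset.range (n + 1)) {n + 1} (by simp)
    (fun i => (hm _).sub (hm _))
  have hφ : Measurable fun (y : Finset.range (n + 1) → ℝ) (i : I) =>
      ∑ j : Finset.range (n + 1), if (j : ℕ) < κ i + 1 then y j else 0 :=
    measurable_pi_lambda _ fun i => Finset.measurable_sum _ fun j _ => by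
      split_ifs
      · exact measurable_pi_apply j
      · exact measurable_const
  have hψ : Measurable fun (y : ({n + 1} : Finset ℕ) → ℝ) => y ⟨n + 1, by simp⟩ :=
    measurable_pi_apply _
  have hcomp := hind.comp hφ hψ
  have e1 : (fun ω (i : I) => Z (i : Set.Iic t) ω) =
      (fun (y : Finset.range (n + 1) → ℝ) (i : I) =>
        ∑ j : Finset.range (n + 1), if (j : ℕ) < κ i + 1 then y j else 0) ∘
      fun ω (j : Finset.range (n + 1)) => Z (τ (j + 1)) ω - Z (τ j) ω := by
    funext ω i
    have := Finset.sum_coe_sort (Finset.range (n + 1))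
      (fun j => if j < κ i + 1 then Z (τ (j + 1)) ω - Z (τ j) ω else 0)
    simp only [Function.comp_apply]
    rw [this, ← Finset.sum_filter]
    have hf : (Finset.range (n + 1)).filter (fun j => j < κ i + 1) = Finset.range (κ i + 1) := by
      ext j
      have := hκ i
      simp only [Finset.mem_filter, Finset.mem_range]
      omega
    rw [hf, Finset.sum_range_sub (fun j => Z (τ j) ω)]
    change Z _ ω = Z (ρ (κ i)) ω - Z 0 ω
    rw [hκρ, h0, sub_zero]
  have e2 : (fun ω => Z (t + s) ω - Z t ω) =
      (fun (y : ({n + 1} : Finset ℕ) → ℝ) => y ⟨n + 1, by simp⟩) ∘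
      fun ω (j : ({n + 1} : Finset ℕ)) => Z (τ (j + 1)) ω - Z (τ j) ω := by
    funext ω
    simp [τ, ρ]
  rw [e2]
  exact e1 ▸ hcomp

section Arrival

variable {B : ℝ≥0 → Ω → ℝ} {A : ℝ≥0 → Ω → ℕ} {X : ℕ → Ω → S} {q : ℝ}
  (h : IsRegularDrivers P B A X q)

include h

lemma exists_lt_arrival (t : ℝ≥0) (ω : Ω) : {s | A t ω < A (t + s) ω}.Nonempty := by
  obtain ⟨u, hu⟩ := h.surj_A ω (A t ω + 1)
  have htu : t ≤ u := by
    by_contra! hlt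
    have := h.mono_A ω hlt.le
    simp only at this
    omega
  refine ⟨u - t, ?_⟩
  change A t ω < A (t + (u - t)) ω
  rw [add_tsub_cancel_of_le htu]
  omega

/-- The count stays constant for a little while after every time, so the infimum is itself an
arrival and the strict inequality is correct. This turns the waiting time into events of the
counting process, from which its measurability, law and independence are read off. -/
lemma lt_nextArrival_iff (t s : ℝ≥0) (ω : Ω) : s < nextArrival A t ω ↔ A (t + s) ω = A t ω := by
  constructor
  · intro hs
    by_contra hne
    have : A t ω < A (t + s) ω := lt_of_le_of_ne (h.mono_A ω le_self_add) (Ne.symm hne)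
    exact absurd (csInf_le (OrderBot.bddBelow _) this : nextArrival A t ω ≤ s) (not_le.2 hs)
  · intro hs
    obtain ⟨u, hu, hAu⟩ := h.right_A ω (t + s)
    have htu : t ≤ u := le_self_add.trans hu.le
    have : u - t ≤ nextArrival A t ω := by
      refine le_csInf (exists_lt_arrival h t ω) fun v (hv : A t ω < A (t + v) ω) => ?_
      by_contra! hlt
      have h1 : t + v ≤ u := by
        rw [add_comm]; exact (lt_tsub_iff_right.1 hlt).le
      have := h.mono_A ω h1
      simp only at this
      omega
    exact lt_of_lt_of_le (lt_tsub_iff_left.2 hu) this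

lemma nextArrival_pos (t : ℝ≥0) (ω : Ω) : 0 < nextArrival A t ω :=
  (lt_nextArrival_iff h t 0 ω).2 (by rw [add_zero])

/-- The epoch of the next arrival does not change before it. -/
lemma add_nextArrival_eq {t t' : ℝ≥0} {ω : Ω} (htt : t ≤ t') (ht' : t' < t + nextArrival A t ω) :
    t' + nextArrival A t' ω = t + nextArrival A t ω := by
  have key : ∀ u, t' ≤ u → (u < t' + nextArrival A t' ω ↔ u < t + nextArrival A t ω) := by
    intro u hu
    have hA : A t' ω = A t ω := by
      have := (lt_nextArrival_iff h t (t' - t) ω).1 ((tsub_lt_iff_left htt).2 ht')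
      rwa [add_tsub_cancel_of_le htt] at this
    rw [← tsub_lt_iff_left hu, ← tsub_lt_iff_left (htt.trans hu), lt_nextArrival_iff h,
      lt_nextArrival_iff h, add_tsub_cancel_of_le hu, add_tsub_cancel_of_le (htt.trans hu), hA]
  apply le_antisymm
  · by_contra! hlt
    exact lt_irrefl _ ((key _ ht'.le).1 hlt)
  · by_contra! hlt
    exact lt_irrefl _ ((key _ le_self_add).2 hlt)

lemma measurable_nextArrival (t : ℝ≥0) : Measurable (nextArrival A t) := by
  refine measurable_of_Ioi fun s => ?_
  have : nextArrival A t ⁻¹' Set.Ioi s = {ω | A (t + s) ω = A t ω} := by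
    ext ω
    exact lt_nextArrival_iff h t s ω
  rw [this]
  exact measurableSet_eq_fun (h.measurable_A _) (h.measurable_A _)

lemma measure_lt_nextArrival (t s : ℝ≥0) :
    P {ω | s < nextArrival A t ω} = ENNReal.ofReal (Real.exp (-(q * s))) := by
  simp_rw [lt_nextArrival_iff h]
  exact h.law_A t s

/-- The waiting time for the next arrival is exponential. -/
lemma map_nextArrival (t : ℝ≥0) :
    P.map (fun ω => (nextArrival A t ω : ℝ)) = expMeasure q := by
  have hm : Measurable (fun ω => (nextArrival A t ω : ℝ)) :=
    (measurable_nextArrival h t).coe_nnreal_real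
  have : IsProbabilityMeasure (P.map fun ω => (nextArrival A t ω : ℝ)) :=
    Measure.isProbabilityMeasure_map hm.aemeasurable
  have : IsProbabilityMeasure (expMeasure q) := isProbabilityMeasure_expMeasure h.rate_pos
  refine Measure.ext_of_Iic _ _ fun a => ?_
  rcases lt_or_ge a 0 with ha | ha
  · rw [measure_mono_null (Set.Iic_subset_Iic.2 ha.le) (expMeasure_Iic_zero q),
      Measure.map_apply hm measurableSet_Iic]
    convert measure_empty (μ := P)
    ext ω
    simpa using ha.trans_le (nextArrival A t ω).2
  · lift a to ℝ≥0 using ha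
    have key : ∀ ρ : Measure ℝ, IsProbabilityMeasure ρ → ρ (Set.Iic a) = 1 - ρ (Set.Ioi a) := by
      intro ρ _
      rw [← Set.compl_Ioi, prob_compl_eq_one_sub measurableSet_Ioi]
    rw [key _ inferInstance, key _ inferInstance, expMeasure_Ioi h.rate_pos a.coe_nonneg,
      Measure.map_apply hm measurableSet_Ioi]
    congr 1
    simpa only [Set.preimage, Set.mem_Ioi, NNReal.coe_lt_coe] using measure_lt_nextArrival h t a

lemma map_nextArrival_nnreal (t : ℝ≥0) : P.map (nextArrival A t) = P.map (nextArrival A 0) := by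
  have hm := measurable_nextArrival h
  have : IsProbabilityMeasure (P.map (nextArrival A t)) :=
    Measure.isProbabilityMeasure_map (hm t).aemeasurable
  have : IsProbabilityMeasure (P.map (nextArrival A 0)) :=
    Measure.isProbabilityMeasure_map (hm 0).aemeasurable
  refine Measure.ext_of_Iic _ _ fun a => ?_
  rw [← Set.compl_Ioi, prob_compl_eq_one_sub measurableSet_Ioi,
    prob_compl_eq_one_sub measurableSet_Ioi, Measure.map_apply (hm t) measurableSet_Ioi,
    Measure.map_apply (hm 0) measurableSet_Ioi]
  congr 1
  exact (measure_lt_nextArrival h t a).trans (measure_lt_nextArrival h 0 a).symm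

/-- The events that the waiting time exceeds `a` form a generating π-system, and each says that the
increment over `[t, t + a]` vanishes, which is independent of the past. -/
lemma indepFun_pastArrivals_nextArrival (t : ℝ≥0) :
    IndepFun (fun ω (u : Set.Iic t) => A u ω) (nextArrival A t) P := by
  have hA : ∀ u, Measurable fun ω => (A u ω : ℝ) := fun u =>
    measurable_from_top.comp (h.measurable_A u)
  have hpast : Measurable fun ω (u : Set.Iic t) => A u ω :=
    measurable_pi_lambda _ fun u => h.measurable_A u
  have hpi : IsPiSystem (Set.range (fun a => nextArrival A t ⁻¹' Set.Ioi a)) := by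
    rintro - ⟨a, rfl⟩ - ⟨b, rfl⟩ -
    exact ⟨a ⊔ b, by rw [← Set.preimage_inter, Set.Ioi_inter_Ioi]⟩
  refine IndepSets.indep (hpast.comap_le) (measurable_nextArrival h t).comap_le
    (@MeasurableSpace.isPiSystem_measurableSet Ω (MeasurableSpace.comap _ inferInstance)) hpi
    (@MeasurableSpace.generateFrom_measurableSet Ω (MeasurableSpace.comap _ inferInstance)).symm
    ?_ ?_
  · have hb : NNReal.measurableSpace = MeasurableSpace.generateFrom (Set.range Set.Ioi) :=
      (BorelSpace.measurable_eq (α := ℝ≥0)).trans (borel_eq_generateFrom_Ioi ℝ≥0)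
    change MeasurableSpace.comap _ NNReal.measurableSpace = _
    rw [hb, MeasurableSpace.comap_generateFrom, ← Set.range_comp]
    rfl
  · rw [IndepSets_iff]
    rintro s₁ - ⟨s, hs, rfl⟩ ⟨a, rfl⟩
    have hind := (indepFun_past_increment h.indep_A hA (fun ω => by simp [h.A_zero]) t a)
    -- Independence of increments is stated for the real-valued counts; the floor recovers the
    -- integer-valued ones.
    have hcomp := hind.comp (φ := fun (y : Set.Iic t → ℝ) (u : Set.Iic t) => ⌊y u⌋₊) (ψ := id)
      (measurable_pi_lambda _ fun u => Nat.measurable_floor.comp (measurable_pi_apply u))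
      measurable_id
    have := hcomp.measure_inter_preimage_eq_mul s {0} hs (measurableSet_singleton 0)
    have e1 : ((fun (y : Set.Iic t → ℝ) (u : Set.Iic t) => ⌊y u⌋₊) ∘
        fun ω (u : Set.Iic t) => (A u ω : ℝ)) = fun ω (u : Set.Iic t) => A u ω := by
      funext ω u
      simp
    have e2 : (id ∘ fun ω => (A (t + a) ω : ℝ) - A t ω) ⁻¹' {0} =
        nextArrival A t ⁻¹' Set.Ioi a := by
      ext ω
      change (A (t + a) ω : ℝ) - A t ω = 0 ↔ a < nextArrival A t ω
      rw [lt_nextArrival_iff h, sub_eq_zero, Nat.cast_inj]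
    rw [e1, e2] at this
    exact this

end Arrival

end MMBM

/-! ### Blocks between a fixed time and the next arrival. -/

namespace MMBM

variable {S Ω : Type*} [MeasurableSpace S] {m0 : MeasurableSpace Ω}

section Block

/-- Depths and heights of the paths `μ i t + σ i w(t)` over `[a, a + e]`. -/
def block (μ σ : S → ℝ) (w : ℝ≥0 → ℝ) (a e : ℝ≥0) : S → ℝ × ℝ :=
  fun i => (depth (μ i) (σ i) w a e, height (μ i) (σ i) w a e)

variable (μ σ : S → ℝ)

lemma segment_shift (m s : ℝ) (w : ℝ≥0 → ℝ) (a e : ℝ≥0) :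
    segment m s (fun u => w (a + u) - w a) 0 e = segment m s w a e := by
  funext r
  simp [segment]

lemma block_shift (w : ℝ≥0 → ℝ) (a e : ℝ≥0) :
    block μ σ (fun u => w (a + u) - w a) 0 e = block μ σ w a e := by
  funext i
  simp only [block, depth, height, segment_shift]

lemma measurable_block :
    Measurable fun p : Path × ℝ≥0 × ℝ≥0 => block μ σ p.1.1 p.2.1 p.2.2 :=
  measurable_pi_lambda _ fun _ => (measurable_depth _ _).prodMk (measurable_height _ _)

lemma continuous_block {w : ℝ≥0 → ℝ} (hw : Continuous w) :
    Continuous fun p : ℝ≥0 × ℝ≥0 => block μ σ w p.1 p.2 :=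
  continuous_pi fun _ => (continuous_depth hw).prodMk (continuous_height hw)

/-- The block of the path `B` between time `t` and the next arrival. -/
def arrivalBlock (B : ℝ≥0 → Ω → ℝ) (A : ℝ≥0 → Ω → ℕ) (t : ℝ≥0) (ω : Ω) : S → ℝ × ℝ :=
  block μ σ (fun u => B u ω) t (nextArrival A t ω)

end Block

/-- The σ-algebra of the chain and of the past of `B` and `A` up to time `t`. -/
@[reducible]
def past (B : ℝ≥0 → Ω → ℝ) (A : ℝ≥0 → Ω → ℕ) (X : ℕ → Ω → S) (t : ℝ≥0) : MeasurableSpace Ω :=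
  MeasurableSpace.comap (fun ω k => X k ω) inferInstance ⊔
    (MeasurableSpace.comap (fun ω (u : Set.Iic t) => B u ω) inferInstance ⊔
      MeasurableSpace.comap (fun ω (u : Set.Iic t) => A u ω) inferInstance)

section Past

variable (B : ℝ≥0 → Ω → ℝ) (A : ℝ≥0 → Ω → ℕ) (X : ℕ → Ω → S)

lemma measurable_past_chain (t : ℝ≥0) : Measurable[past B A X t] fun ω k => X k ω :=
  (comap_measurable _).mono le_sup_left le_rfl

lemma measurable_past_brownian {u t : ℝ≥0} (hu : u ≤ t) : Measurable[past B A X t] (B u) := by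
  have : Measurable[past B A X t] (fun ω (u : Set.Iic t) => B u ω) :=
    (comap_measurable _).mono (le_sup_left.trans le_sup_right) le_rfl
  exact (measurable_pi_apply (⟨u, hu⟩ : Set.Iic t)).comp this

lemma measurable_past_arrival {u t : ℝ≥0} (hu : u ≤ t) : Measurable[past B A X t] (A u) := by
  have : Measurable[past B A X t] (fun ω (u : Set.Iic t) => A u ω) :=
    (comap_measurable _).mono (le_sup_right.trans le_sup_right) le_rfl
  exact (measurable_pi_apply (⟨u, hu⟩ : Set.Iic t)).comp this

lemma past_mono {s t : ℝ≥0} (hst : s ≤ t) : past B A X s ≤ past B A X t := by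
  refine sup_le (measurable_past_chain B A X t).comap_le (sup_le ?_ ?_)
  · exact (@measurable_pi_lambda Ω (Set.Iic s) (fun _ => ℝ) (past B A X t) _ _
      fun u => measurable_past_brownian B A X (u.2.trans hst)).comap_le
  · exact (@measurable_pi_lambda Ω (Set.Iic s) (fun _ => ℕ) (past B A X t) _ _
      fun u => measurable_past_arrival B A X (u.2.trans hst)).comap_le

end Past

variable {P : Measure Ω} [IsProbabilityMeasure P]
  {B : ℝ≥0 → Ω → ℝ} {A : ℝ≥0 → Ω → ℕ} {X : ℕ → Ω → S} {q : ℝ}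

/-- The increments of `B` after time `t`, as a random path. -/
def shiftPath (hB : ∀ ω, Continuous fun t => B t ω) (t : ℝ≥0) (ω : Ω) : Path :=
  ⟨fun u => B (t + u) ω - B t ω,
    ((hB ω).comp (continuous_const.add continuous_id)).sub continuous_const⟩

/-- Stated for an arbitrary σ-algebra: the waiting time must be measurable with respect to the
arrival process alone, in order to use its independence of the other sources. -/
lemma measurable_of_lt_iff {Ω : Type*} {_ : MeasurableSpace Ω} {A : ℝ≥0 → Ω → ℕ}
    (hA : ∀ u, Measurable (A u)) {t : ℝ≥0} {T : Ω → ℝ≥0}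
    (hT : ∀ s ω, s < T ω ↔ A (t + s) ω = A t ω) : Measurable T := by
  refine measurable_of_Ioi fun s => ?_
  have : T ⁻¹' Set.Ioi s = {ω | A (t + s) ω = A t ω} := by
    ext ω
    exact hT s ω
  rw [this]
  exact measurableSet_eq_fun (hA _) (hA _)

section Regular

variable (h : IsRegularDrivers P B A X q)

include h

lemma measurable_shiftPath (t : ℝ≥0) : Measurable (shiftPath h.continuous_B t) :=
  Measurable.subtype_mk (measurable_pi_lambda _ fun _ => (h.measurable_B _).sub (h.measurable_B _))

/-- The past is independent of the later increments of `B` and of the next arrival. -/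
lemma indep_past_future (t : ℝ≥0) :
    Indep (past B A X t) (MeasurableSpace.comap (shiftPath h.continuous_B t) inferInstance ⊔
      MeasurableSpace.comap (nextArrival A t) inferInstance) P := by
  have mX : Measurable fun ω k => X k ω := measurable_pi_lambda _ fun k => h.measurable_X k
  have mB : Measurable fun ω (u : Set.Iic t) => B u ω :=
    measurable_pi_lambda _ fun u => h.measurable_B u
  have mA : Measurable fun ω (u : Set.Iic t) => A u ω :=
    measurable_pi_lambda _ fun u => h.measurable_A u
  have mW := measurable_shiftPath h t
  have me := measurable_nextArrival h t
  refine indep_sup_sup mX.comap_le mB.comap_le mA.comap_le mW.comap_le me.comap_le ?_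
  rintro - - - - - ⟨c₁, h₁, rfl⟩ ⟨c₂, h₂, rfl⟩ ⟨c₃, h₃, rfl⟩ ⟨-, ⟨c₄, h₄, rfl⟩, rfl⟩ ⟨c₅, h₅, rfl⟩
  set s₁ := (fun ω k => X k ω) ⁻¹' c₁
  set s₂ := (fun ω (u : Set.Iic t) => B u ω) ⁻¹' c₂
  set s₃ := (fun ω (u : Set.Iic t) => A u ω) ⁻¹' c₃
  set s₄ := shiftPath h.continuous_B t ⁻¹' (Subtype.val ⁻¹' c₄) with hs₄
  set s₅ := nextArrival A t ⁻¹' c₅ with hs₅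
  -- functions of the arrival process
  have me' : Measurable[MeasurableSpace.comap (fun ω t => A t ω) inferInstance]
      (nextArrival A t) := measurable_of_lt_iff
    (fun u => (measurable_pi_apply u).comp (comap_measurable (fun ω t => A t ω)))
    (lt_nextArrival_iff h t)
  have mA' : Measurable[MeasurableSpace.comap (fun ω t => A t ω) inferInstance]
      (fun ω (u : Set.Iic t) => A u ω) :=
    @measurable_pi_lambda Ω (Set.Iic t) (fun _ => ℕ) (MeasurableSpace.comap _ _) _ _
      fun u => (measurable_pi_apply u.1).comp (comap_measurable (fun ω t => A t ω))
  have hAX := h.indep_A_X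
  have hBAX := h.indep_B_AX
  rw [IndepFun_iff] at hAX hBAX
  have leA : MeasurableSpace.comap (fun ω t => A t ω) inferInstance ≤
      MeasurableSpace.comap (fun ω => (fun t => A t ω, fun k => X k ω)) inferInstance :=
    (measurable_fst.comp (comap_measurable (fun ω => (fun t => A t ω, fun k => X k ω)))).comap_le
  have leX : MeasurableSpace.comap (fun ω k => X k ω) inferInstance ≤
      MeasurableSpace.comap (fun ω => (fun t => A t ω, fun k => X k ω)) inferInstance :=
    (measurable_snd.comp (comap_measurable (fun ω => (fun t => A t ω, fun k => X k ω)))).comap_le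
  have k₁ : MeasurableSet[MeasurableSpace.comap (fun ω k => X k ω) inferInstance] s₁ :=
    ⟨c₁, h₁, rfl⟩
  have k₃ := mA' h₃
  have k₅ := me' h₅
  have keyB : ∀ u, Measurable[MeasurableSpace.comap (fun ω t => B t ω) inferInstance] (B u) :=
    fun u => (measurable_pi_apply u).comp (comap_measurable (fun ω t => B t ω))
  have k₂ : MeasurableSet[MeasurableSpace.comap (fun ω t => B t ω) inferInstance] s₂ :=
    (@measurable_pi_lambda Ω (Set.Iic t) (fun _ => ℝ) (MeasurableSpace.comap _ _) _ _
      fun u => keyB u.1) h₂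
  have k₄ : MeasurableSet[MeasurableSpace.comap (fun ω t => B t ω) inferInstance] s₄ :=
    (@measurable_pi_lambda Ω ℝ≥0 (fun _ => ℝ) (MeasurableSpace.comap _ _) _ _
      fun u => (keyB (t + u)).sub (keyB t)) h₄
  -- The events are regrouped by source: `s₂`, `s₄` are Brownian, `s₃`, `s₅` concern the arrivals,
  -- `s₁` the chain. Independence of the sources separates the groups, and within a group past and
  -- future separate by `indepFun_shift` for `B` and the previous lemma for the arrivals.
  have i24 : P (s₂ ∩ s₄) = P s₂ * P s₄ := by
    rw [Set.inter_comm, mul_comm]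
    exact (h.brownian.indepFun_shift t).measure_inter_preimage_eq_mul c₄ c₂ h₄ h₂
  have i35 : P (s₃ ∩ s₅) = P s₃ * P s₅ :=
    (indepFun_pastArrivals_nextArrival h t).measure_inter_preimage_eq_mul c₃ c₅ h₃ h₅
  have i31 : P (s₃ ∩ s₁) = P s₃ * P s₁ := hAX _ _ k₃ k₁
  have i351 : P (s₃ ∩ s₅ ∩ s₁) = P (s₃ ∩ s₅) * P s₁ :=
    hAX _ _ (MeasurableSet.inter k₃ k₅) k₁
  have j1 : P (s₂ ∩ s₄ ∩ (s₃ ∩ s₅ ∩ s₁)) = P (s₂ ∩ s₄) * P (s₃ ∩ s₅ ∩ s₁) :=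
    hBAX _ _ (MeasurableSet.inter k₂ k₄)
      (MeasurableSet.inter (MeasurableSet.inter (leA _ k₃) (leA _ k₅)) (leX _ k₁))
  have j2 : P (s₂ ∩ (s₃ ∩ s₁)) = P s₂ * P (s₃ ∩ s₁) :=
    hBAX _ _ k₂ (MeasurableSet.inter (leA _ k₃) (leX _ k₁))
  have j3 : P (s₄ ∩ s₅) = P s₄ * P s₅ := hBAX _ _ k₄ (leA _ k₅)
  have e1 : s₁ ∩ (s₂ ∩ s₃) ∩ (s₄ ∩ s₅) = s₂ ∩ s₄ ∩ (s₃ ∩ s₅ ∩ s₁) := by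
    ext ω; simp only [Set.mem_inter_iff]; tauto
  have e2 : s₁ ∩ (s₂ ∩ s₃) = s₂ ∩ (s₃ ∩ s₁) := by
    ext ω; simp only [Set.mem_inter_iff]; tauto
  rw [e1, e2, j1, j2, j3, i351, i24, i35, i31]
  ring

/-- Shifted Brownian motions have the same finite-dimensional laws, hence the same law on the
product space; the σ-algebra on continuous paths is the trace of the product one. -/
lemma map_shiftPath (t : ℝ≥0) :
    P.map (shiftPath h.continuous_B t) = P.map (shiftPath h.continuous_B 0) := by
  have mm : ∀ t, Measurable fun ω u => B (t + u) ω - B t ω := fun t =>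
    measurable_pi_lambda _ fun _ => (h.measurable_B _).sub (h.measurable_B _)
  have key : P.map (fun ω u => B (t + u) ω - B t ω) = P.map (fun ω u => B (0 + u) ω - B 0 ω) := by
    refine (map_eq_iff_forall_finset_map_restrict_eq
      (X := fun u ω => B (t + u) ω - B t ω) (Y := fun u ω => B (0 + u) ω - B 0 ω)
      (mm t).aemeasurable (mm 0).aemeasurable).2 fun I => ?_
    rw [((h.brownian.shift t).hasLaw I).map_eq, ((h.brownian.shift 0).hasLaw I).map_eq]
  ext s ⟨c, hc, hs⟩
  rw [Measure.map_apply (measurable_shiftPath h t) ⟨c, hc, hs⟩,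
    Measure.map_apply (measurable_shiftPath h 0) ⟨c, hc, hs⟩, ← hs]
  have := congrArg (fun ρ => ρ c) key
  rwa [Measure.map_apply (mm t) hc, Measure.map_apply (mm 0) hc] at this

variable (μ σ : S → ℝ)

lemma arrivalBlock_eq (t : ℝ≥0) : arrivalBlock μ σ B A t =
    (fun p : Path × ℝ≥0 => block μ σ p.1.1 0 p.2) ∘
      fun ω => (shiftPath h.continuous_B t ω, nextArrival A t ω) := by
  funext ω
  exact (block_shift μ σ (fun u => B u ω) t _).symm

lemma measurable_block_zero : Measurable fun p : Path × ℝ≥0 => block μ σ p.1.1 0 p.2 :=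
  (measurable_block μ σ).comp (f := fun p : Path × ℝ≥0 => (p.1, (0 : ℝ≥0), p.2)) (by fun_prop)

lemma measurable_arrivalBlock (t : ℝ≥0) : Measurable (arrivalBlock μ σ B A t) := by
  rw [arrivalBlock_eq h]
  exact (measurable_block_zero h μ σ).comp
    ((measurable_shiftPath h t).prodMk (measurable_nextArrival h t))

lemma indepFun_shiftPath_nextArrival (t : ℝ≥0) :
    IndepFun (shiftPath h.continuous_B t) (nextArrival A t) P := by
  have hBA : IndepFun (fun ω t => B t ω) (fun ω t => A t ω) P :=
    h.indep_B_AX.comp measurable_id measurable_fst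
  rw [IndepFun_iff] at hBA ⊢
  rintro - - ⟨-, ⟨c₄, h₄, rfl⟩, rfl⟩ ⟨c₅, h₅, rfl⟩
  refine hBA _ _ ?_ ?_
  · exact (@measurable_pi_lambda Ω ℝ≥0 (fun _ => ℝ)
      (MeasurableSpace.comap (fun ω t => B t ω) inferInstance) _ _
      fun u => ((measurable_pi_apply (t + u)).comp (comap_measurable (fun ω t => B t ω))).sub
        ((measurable_pi_apply t).comp (comap_measurable (fun ω t => B t ω)))) h₄
  · exact measurable_of_lt_iff
      (fun u => (measurable_pi_apply u).comp (comap_measurable (fun ω t => A t ω)))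
      (lt_nextArrival_iff h t) h₅

/-- A block is a fixed function of the shifted path and the waiting time. These are independent and
neither law depends on `t`. -/
lemma map_arrivalBlock (t : ℝ≥0) :
    P.map (arrivalBlock μ σ B A t) = P.map (arrivalBlock μ σ B A 0) := by
  have key : ∀ t, P.map (arrivalBlock μ σ B A t) =
      ((P.map (shiftPath h.continuous_B t)).prod (P.map (nextArrival A t))).map
        (fun p : Path × ℝ≥0 => block μ σ p.1.1 0 p.2) := by
    intro t
    have hm := (measurable_shiftPath h t).prodMk (measurable_nextArrival h t)
    have hind := indepFun_shiftPath_nextArrival h t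
    rw [arrivalBlock_eq h, ← Measure.map_map (measurable_block_zero h μ σ) hm,
      (indepFun_iff_map_prod_eq_prod_map_map (measurable_shiftPath h t).aemeasurable
        (measurable_nextArrival h t).aemeasurable).1 hind]
  rw [key t, key 0, map_shiftPath h, map_nextArrival_nnreal h]

/-- The block started at a fixed time is independent of the past. -/
lemma measure_inter_arrivalBlock (t : ℝ≥0) {F : Set Ω} (hF : MeasurableSet[past B A X t] F)
    {C : Set (S → ℝ × ℝ)} (hC : MeasurableSet C) :
    P (F ∩ arrivalBlock μ σ B A t ⁻¹' C) = P F * P.map (arrivalBlock μ σ B A 0) C := by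
  rw [← map_arrivalBlock h μ σ t, Measure.map_apply (measurable_arrivalBlock h μ σ t) hC]
  refine (Indep_iff _ _ _).1 (indep_past_future h t) _ _ hF ?_
  rw [arrivalBlock_eq h]
  exact (measurable_block_zero h μ σ).comp
    (((comap_measurable (shiftPath h.continuous_B t)).mono le_sup_left le_rfl).prodMk
      ((comap_measurable (nextArrival A t)).mono le_sup_right le_rfl)) hC

end Regular

end MMBM

/-! ### The strong Markov property by approximation of random times on grids. -/

namespace MMBM

variable {S Ω : Type*} [MeasurableSpace S] {m0 : MeasurableSpace Ω} {P : Measure Ω}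
  [IsProbabilityMeasure P]
  {B : ℝ≥0 → Ω → ℝ} {A : ℝ≥0 → Ω → ℕ} {X : ℕ → Ω → S} {q : ℝ}

/-- The first point of the grid of mesh `1 / (m + 1)` strictly after `t`. -/
def gridAbove (m : ℕ) (t : ℝ≥0) : ℝ≥0 := (⌊(m + 1) * t⌋₊ + 1) / (m + 1)

lemma lt_gridAbove (m : ℕ) (t : ℝ≥0) : t < gridAbove m t := by
  rw [gridAbove, lt_div_iff₀ (by positivity), mul_comm]
  exact Nat.lt_floor_add_one _

lemma gridAbove_le (m : ℕ) (t : ℝ≥0) : gridAbove m t ≤ t + 1 / (m + 1) := by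
  have h : (⌊(m + 1) * t⌋₊ : ℝ≥0) ≤ (m + 1) * t := Nat.floor_le zero_le
  rw [gridAbove, add_div]
  gcongr
  rwa [div_le_iff₀ (by positivity), mul_comm t]

lemma tendsto_gridAbove (t : ℝ≥0) : Tendsto (fun m => gridAbove m t) atTop (𝓝 t) := by
  refine tendsto_of_tendsto_of_tendsto_of_le_of_le tendsto_const_nhds
    (h := fun m : ℕ => t + 1 / (m + 1)) ?_ (fun m => (lt_gridAbove m t).le)
    (fun m => gridAbove_le m t)
  simpa using tendsto_const_nhds.add (tendsto_one_div_add_atTop_nhds_zero_nat (𝕜 := ℝ≥0))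

lemma measurable_gridAbove (m : ℕ) : Measurable (gridAbove m) := by
  have : Measurable fun t : ℝ≥0 => ⌊(m + 1) * t⌋₊ :=
    Nat.measurable_floor.comp (measurable_const.mul measurable_id)
  exact ((measurable_from_top (f := fun n : ℕ => (n : ℝ≥0) + 1)).comp this).div_const _

section Regular

variable (h : IsRegularDrivers P B A X q)

include h

/-- The next arrival after `T` occurs by time `u` exactly when the count increases between some
dense time after `T` and `u`. Only deterministic times enter the count, which gives measurability at
a random `T`. -/
lemma add_nextArrival_le_iff (T u : ℝ≥0) (ω : Ω) :
    T + nextArrival A T ω ≤ u ↔ ∃ n : ℕ, T < TopologicalSpace.denseSeq ℝ≥0 n ∧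
      A (TopologicalSpace.denseSeq ℝ≥0 n) ω < A u ω := by
  constructor
  · intro hu
    have hT : T < T + nextArrival A T ω := lt_add_of_pos_right _ (nextArrival_pos h T ω)
    obtain ⟨n, hn⟩ := (TopologicalSpace.denseRange_denseSeq ℝ≥0).exists_mem_open isOpen_Ioo
      (Set.nonempty_Ioo.2 hT)
    refine ⟨n, hn.1, ?_⟩
    have h1 := (lt_nextArrival_iff h T (TopologicalSpace.denseSeq ℝ≥0 n - T) ω).1
      ((tsub_lt_iff_left hn.1.le).2 hn.2)
    rw [add_tsub_cancel_of_le hn.1.le] at h1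
    have h2 : ¬ A (T + (u - T)) ω = A T ω := by
      rw [← lt_nextArrival_iff h]
      exact not_lt.2 (le_tsub_of_add_le_left hu)
    have hTu : T ≤ u := hT.le.trans hu
    rw [add_tsub_cancel_of_le hTu] at h2
    rw [h1]
    exact lt_of_le_of_ne (h.mono_A ω hTu) (Ne.symm h2)
  · rintro ⟨n, hn, hA⟩
    by_contra! hlt
    have hru : TopologicalSpace.denseSeq ℝ≥0 n < u := by
      by_contra! hge
      exact absurd (h.mono_A ω hge) (not_le.2 hA)
    have hTu : T ≤ u := (hn.trans hru).le
    have h1 := (lt_nextArrival_iff h T (u - T) ω).1 ((tsub_lt_iff_left hTu).2 hlt)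
    rw [add_tsub_cancel_of_le hTu] at h1
    rw [h1] at hA
    exact absurd (h.mono_A ω hn.le) (not_le.2 hA)

lemma measurable_nextArrival_comp {T : Ω → ℝ≥0} (hT : Measurable T) :
    Measurable fun ω => nextArrival A (T ω) ω := by
  have hD : Measurable fun ω => T ω + nextArrival A (T ω) ω := by
    refine measurable_of_Iic fun u => ?_
    have : (fun ω => T ω + nextArrival A (T ω) ω) ⁻¹' Set.Iic u =
        ⋃ n : ℕ, {ω | T ω < TopologicalSpace.denseSeq ℝ≥0 n} ∩
          {ω | A (TopologicalSpace.denseSeq ℝ≥0 n) ω < A u ω} := by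
      ext ω
      simp only [Set.mem_preimage, Set.mem_Iic, add_nextArrival_le_iff h, Set.mem_iUnion,
        Set.mem_inter_iff, Set.mem_ofPred_eq]
    rw [this]
    exact MeasurableSet.iUnion fun n => (measurableSet_lt hT measurable_const).inter
      (measurableSet_lt (h.measurable_A _) (h.measurable_A _))
  have e : (fun ω => nextArrival A (T ω) ω) = fun ω => T ω + nextArrival A (T ω) ω - T ω := by
    funext ω
    rw [add_tsub_cancel_left]
  rw [e]
  exact hD.sub hT

/-- The driving Brownian motion as a random path. -/
lemma measurable_path : Measurable fun ω => (⟨fun u => B u ω, h.continuous_B ω⟩ : Path) :=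
  Measurable.subtype_mk (measurable_pi_lambda _ fun u => h.measurable_B u)

variable (μ σ : S → ℝ)

lemma measurable_arrivalBlock_comp {T : Ω → ℝ≥0} (hT : Measurable T) :
    Measurable fun ω => arrivalBlock μ σ B A (T ω) ω := by
  have hg : Measurable fun ω => ((⟨fun u => B u ω, h.continuous_B ω⟩ : Path), T ω,
      nextArrival A (T ω) ω) :=
    (measurable_path h).prodMk (hT.prodMk (measurable_nextArrival_comp h hT))
  have e : (fun ω => arrivalBlock μ σ B A (T ω) ω) =
      (fun p : Path × ℝ≥0 × ℝ≥0 => block μ σ p.1.1 p.2.1 p.2.2) ∘ fun ω =>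
        ((⟨fun u => B u ω, h.continuous_B ω⟩ : Path), T ω, nextArrival A (T ω) ω) := rfl
  rw [e]
  exact (measurable_block μ σ).comp hg

/-- Once the grid point lies before the next arrival after `t`, the block started there ends at that
same arrival. So start and duration both converge, and blocks are continuous in these. -/
lemma tendsto_arrivalBlock_gridAbove (t : ℝ≥0) (ω : Ω) :
    Tendsto (fun m => arrivalBlock μ σ B A (gridAbove m t) ω) atTop
      (𝓝 (arrivalBlock μ σ B A t ω)) := by
  have hlt : t < t + nextArrival A t ω := lt_add_of_pos_right _ (nextArrival_pos h t ω)
  have h1 : ∀ᶠ m in atTop, gridAbove m t < t + nextArrival A t ω :=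
    (tendsto_gridAbove t).eventually_lt_const hlt
  have h2 : Tendsto (fun m => t + nextArrival A t ω - gridAbove m t) atTop
      (𝓝 (nextArrival A t ω)) := by
    have := (tendsto_const_nhds (x := t + nextArrival A t ω)).sub (tendsto_gridAbove t)
    rwa [add_tsub_cancel_left] at this
  have h3 : Tendsto (fun m => nextArrival A (gridAbove m t) ω) atTop
      (𝓝 (nextArrival A t ω)) := by
    refine h2.congr' (h1.mono fun m hm => ?_)
    rw [← add_nextArrival_eq h (lt_gridAbove m t).le hm, add_tsub_cancel_left]
  have h4 : Tendsto (fun m => (gridAbove m t, nextArrival A (gridAbove m t) ω)) atTop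
      (𝓝 (t, nextArrival A t ω)) := (tendsto_gridAbove t).prodMk_nhds h3
  have h5 := (continuous_block μ σ (h.continuous_B ω)).tendsto (t, nextArrival A t ω)
  have e : (fun m => arrivalBlock μ σ B A (gridAbove m t) ω) =
      (fun p : ℝ≥0 × ℝ≥0 => block μ σ (fun u => B u ω) p.1 p.2) ∘ fun m =>
        (gridAbove m t, nextArrival A (gridAbove m t) ω) := rfl
  have e' : arrivalBlock μ σ B A t ω = block μ σ (fun u => B u ω) t (nextArrival A t ω) := rfl
  rw [e, e']
  exact h5.comp h4

/-- On the event that `T` lies in a given grid cell, the grid point above it is a deterministic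
time, at which the cell is known; the fixed-time property applies cell by cell. -/
lemma measure_inter_arrivalBlock_gridAbove {T : Ω → ℝ≥0} (hT : Measurable T) {E : Set Ω}
    (hE : MeasurableSet E)
    (hET : ∀ t, MeasurableSet[past B A X t] (E ∩ {ω | T ω < t})) (m : ℕ)
    {C : Set (S → ℝ × ℝ)} (hC : MeasurableSet C) :
    P (E ∩ (fun ω => arrivalBlock μ σ B A (gridAbove m (T ω)) ω) ⁻¹' C) =
      P E * P.map (arrivalBlock μ σ B A 0) C := by
  let N : Ω → ℕ := fun ω => ⌊(m + 1) * T ω⌋₊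
  have hN : Measurable N := Nat.measurable_floor.comp (measurable_const.mul hT)
  have key : ∀ {F : Set Ω}, MeasurableSet F → P F = ∑' k, P (F ∩ N ⁻¹' {k}) := by
    intro F hF
    rw [← measure_iUnion]
    · rw [← Set.inter_iUnion, ← Set.preimage_iUnion, Set.iUnion_of_singleton, Set.preimage_univ,
        Set.inter_univ]
    · intro i j hij
      refine Set.disjoint_left.2 fun ω hi hj => hij ?_
      exact (Set.mem_singleton_iff.1 hi.2).symm.trans (Set.mem_singleton_iff.1 hj.2)
    · exact fun k => hF.inter (hN (measurableSet_singleton k))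
  have hmg : Measurable fun ω => arrivalBlock μ σ B A (gridAbove m (T ω)) ω :=
    measurable_arrivalBlock_comp h μ σ ((measurable_gridAbove m).comp hT)
  rw [key (hE.inter (hmg hC)), key hE, ← ENNReal.tsum_mul_right]
  congr 1
  funext k
  have hm : (0 : ℝ≥0) < m + 1 := by positivity
  have hset : E ∩ N ⁻¹' {k} = (E ∩ {ω | T ω < (k + 1) / (m + 1)}) \
      (E ∩ {ω | T ω < k / (m + 1)}) := by
    ext ω
    have : N ω = k ↔ (k : ℝ≥0) ≤ (m + 1) * T ω ∧ (m + 1) * T ω < k + 1 :=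
      Nat.floor_eq_iff zero_le
    simp only [Set.mem_inter_iff, Set.mem_preimage, Set.mem_singleton_iff, this, Set.mem_sdiff,
      Set.mem_ofPred_eq, lt_div_iff₀ hm, mul_comm (T ω)]
    grind
  have hpast : MeasurableSet[past B A X ((k + 1) / (m + 1))] (E ∩ N ⁻¹' {k}) := by
    rw [hset]
    refine MeasurableSet.diff (hET _) (past_mono B A X ?_ _ (hET _))
    gcongr
    exact le_self_add
  rw [← measure_inter_arrivalBlock h μ σ _ hpast hC]
  congr 1
  ext ω
  simp only [Set.mem_inter_iff, Set.mem_preimage, Set.mem_singleton_iff]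
  have : N ω = k → gridAbove m (T ω) = (k + 1) / (m + 1) := fun hk => by
    rw [gridAbove, ← hk]
  constructor
  · rintro ⟨⟨h1, h2⟩, h3⟩
    exact ⟨⟨h1, h3⟩, this h3 ▸ h2⟩
  · rintro ⟨⟨h1, h3⟩, h2⟩
    exact ⟨⟨h1, (this h3).symm ▸ h2⟩, h3⟩

/-- **Strong Markov property** for the block started at a random time. -/
theorem strongMarkov_arrivalBlock [Finite S] {T : Ω → ℝ≥0} (hT : Measurable T) {E : Set Ω}
    (hE : MeasurableSet E)
    (hET : ∀ t, MeasurableSet[past B A X t] (E ∩ {ω | T ω < t})) {C : Set (S → ℝ × ℝ)}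
    (hC : MeasurableSet C) :
    P (E ∩ (fun ω => arrivalBlock μ σ B A (T ω) ω) ⁻¹' C) =
      P E * P.map (arrivalBlock μ σ B A 0) C := by
  cases nonempty_fintype S
  have hm := measurable_arrivalBlock_comp h μ σ hT
  have hmg : ∀ m, Measurable fun ω => arrivalBlock μ σ B A (gridAbove m (T ω)) ω := fun m =>
    measurable_arrivalBlock_comp h μ σ ((measurable_gridAbove m).comp hT)
  have h0 := measurable_arrivalBlock h μ σ 0
  suffices hmap : (P.restrict E).map (fun ω => arrivalBlock μ σ B A (T ω) ω) =
      P E • P.map (arrivalBlock μ σ B A 0) by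
    have := congrArg (fun ρ => ρ C) hmap
    simp only [Measure.smul_apply, smul_eq_mul] at this
    rwa [Measure.map_apply hm hC, Measure.restrict_apply (hm hC), Set.inter_comm] at this
  have hgrid : ∀ m, (P.restrict E).map (fun ω => arrivalBlock μ σ B A (gridAbove m (T ω)) ω) =
      P E • P.map (arrivalBlock μ σ B A 0) := by
    intro m
    ext C hC
    rw [Measure.map_apply (hmg m) hC, Measure.restrict_apply (hmg m hC), Set.inter_comm]
    exact measure_inter_arrivalBlock_gridAbove h μ σ hT hE hET m hC
  have : IsFiniteMeasure (P E • P.map (arrivalBlock μ σ B A 0)) := by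
    rw [← hgrid 0]; infer_instance
  -- A finite measure is determined by its integrals of bounded continuous functions, and these pass
  -- to the limit along the grids by dominated convergence.
  refine ext_of_forall_lintegral_eq_of_IsFiniteMeasure fun f => ?_
  have hf : Measurable fun z => (f z : ℝ≥0∞) := f.continuous.measurable.coe_nnreal_ennreal
  rw [lintegral_map hf hm]
  have hlim : Tendsto (fun m => ∫⁻ ω in E, f (arrivalBlock μ σ B A (gridAbove m (T ω)) ω) ∂P) atTop
      (𝓝 (∫⁻ ω in E, f (arrivalBlock μ σ B A (T ω) ω) ∂P)) := by
    refine tendsto_lintegral_of_dominated_convergence (fun _ => ((nndist f 0 : ℝ≥0) : ℝ≥0∞))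
      (fun m => hf.comp (hmg m)) (fun m => ae_of_all _ fun ω => ?_) ?_ (ae_of_all _ fun ω => ?_)
    · exact ENNReal.coe_le_coe.2 (BoundedContinuousFunction.NNReal.upper_bound f _)
    · simp [ENNReal.mul_eq_top]
    · exact ENNReal.tendsto_coe.2 ((f.continuous.tendsto _).comp
        (tendsto_arrivalBlock_gridAbove h μ σ (T ω) ω))
  refine tendsto_nhds_unique hlim ?_
  refine tendsto_const_nhds.congr fun m => ?_
  rw [← hgrid m, lintegral_map hf (hmg m)]

end Regular

end MMBM

/-! ### Passage times and the Markov property of the first block. -/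

namespace MMBM

section Passage

variable {m s : ℝ} {w : ℝ≥0 → ℝ}

/-- The passage time of the path `m t + s w(t)` below the level `-x`. -/
def passage (m s : ℝ) (w : ℝ≥0 → ℝ) (x : ℝ) : ℝ≥0 := sInf {t : ℝ≥0 | m * t + s * w t < -x}

lemma isOpen_below (hw : Continuous w) (x : ℝ) : IsOpen {t : ℝ≥0 | m * t + s * w t < -x} :=
  isOpen_lt (by fun_prop) continuous_const

lemma passage_lt_iff {x : ℝ} (hne : {t : ℝ≥0 | m * t + s * w t < -x}.Nonempty) (t : ℝ≥0) :
    passage m s w x < t ↔ ∃ u < t, m * u + s * w u < -x := by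
  rw [passage, csInf_lt_iff (OrderBot.bddBelow _) hne]
  exact ⟨fun ⟨u, hu, hut⟩ => ⟨u, hut, hu⟩, fun ⟨u, hut, hu⟩ => ⟨u, hu, hut⟩⟩

lemma passage_le {x : ℝ} {t : ℝ≥0} (ht : m * t + s * w t < -x) : passage m s w x ≤ t :=
  csInf_le (OrderBot.bddBelow _) ht

lemma passage_value (hw : Continuous w) (hw0 : w 0 = 0) {x : ℝ} (hx : 0 ≤ x)
    (hne : {t : ℝ≥0 | m * t + s * w t < -x}.Nonempty) :
    m * passage m s w x + s * w (passage m s w x) = -x := by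
  have hcont : Continuous fun t : ℝ≥0 => m * t + s * w t := by fun_prop
  apply le_antisymm
  · have hmem : passage m s w x ∈ closure {t : ℝ≥0 | m * t + s * w t < -x} :=
      csInf_mem_closure hne (OrderBot.bddBelow _)
    exact closure_lt_subset_le hcont continuous_const hmem
  · by_contra! hlt
    have h0 : (0 : ℝ≥0) < passage m s w x := by
      rw [pos_iff_ne_zero]
      intro h0
      rw [h0, hw0] at hlt
      simp only [NNReal.coe_zero, mul_zero, add_zero] at hlt
      linarith
    have hev : ∀ᶠ t in 𝓝[<] passage m s w x, m * t + s * w t < -x :=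
      nhdsWithin_le_nhds ((isOpen_below hw x).mem_nhds hlt)
    have : (𝓝[<] passage m s w x).NeBot := nhdsLT_neBot_of_exists_lt ⟨0, h0⟩
    obtain ⟨t, ht, htlt⟩ := (hev.and self_mem_nhdsWithin).exists
    exact absurd (passage_le ht) (not_le.2 htlt)

lemma passage_lt_of_mem (hw : Continuous w) (hw0 : w 0 = 0) {x : ℝ} (hx : 0 ≤ x) {t : ℝ≥0}
    (ht : m * t + s * w t < -x) : passage m s w x < t := by
  refine lt_of_le_of_ne (passage_le ht) fun heq => ?_
  have := passage_value hw hw0 hx ⟨t, ht⟩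
  rw [heq] at this
  exact absurd this ht.ne

variable {e : ℝ≥0} {x : ℝ}

lemma lt_depth_zero_iff (hw : Continuous w) (hw0 : w 0 = 0) (e : ℝ≥0) (x : ℝ) :
    x < depth m s w 0 e ↔ ∃ t ≤ e, m * t + s * w t < -x := by
  rw [lt_depth_iff hw]
  simp [hw0]

lemma passage_lt (hw : Continuous w) (hw0 : w 0 = 0) (hx : 0 ≤ x) (hd : x < depth m s w 0 e) :
    passage m s w x < e := by
  obtain ⟨t, hte, ht⟩ := (lt_depth_zero_iff hw hw0 e x).1 hd
  exact (passage_lt_of_mem hw hw0 hx ht).trans_le hte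

/-- By continuity the path is exactly at `-x` at the passage time, and it is not below `-x` earlier.
So what remains is the depth below this new starting point, before the same end time. -/
lemma depth_passage (hw : Continuous w) (hw0 : w 0 = 0) (hx : 0 ≤ x)
    (hd : x < depth m s w 0 e) :
    depth m s w (passage m s w x) (e - passage m s w x) = depth m s w 0 e - x := by
  set T := passage m s w x with hT
  have hTe : T < e := passage_lt hw hw0 hx hd
  obtain ⟨t₀, -, ht₀⟩ := (lt_depth_zero_iff hw hw0 e x).1 hd
  have hv : m * T + s * w T = -x := passage_value hw hw0 hx ⟨t₀, ht₀⟩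
  have key : ∀ y, 0 ≤ y → (y < depth m s w T (e - T) ↔ y < depth m s w 0 e - x) := by
    intro y hy
    rw [lt_depth_iff hw, lt_sub_iff_add_lt, lt_depth_zero_iff hw hw0]
    constructor
    · rintro ⟨t, ht, hlt⟩
      refine ⟨T + t, ?_, ?_⟩
      · rw [add_comm]
        exact (add_le_add_left ht T).trans (tsub_add_cancel_of_le hTe.le).le
      · push_cast
        linarith
    · rintro ⟨t, ht, hlt⟩
      have hTt : T ≤ t := passage_le (by linarith)
      refine ⟨t - T, tsub_le_tsub_right ht T, ?_⟩
      rw [add_tsub_cancel_of_le hTt, NNReal.coe_sub hTt]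
      linarith
  have h1 : 0 < depth m s w 0 e - x := sub_pos.2 hd
  have h2 : 0 ≤ depth m s w T (e - T) := depth_nonneg hw _ _
  apply le_antisymm
  · by_contra! hlt
    exact lt_irrefl _ ((key _ h1.le).1 hlt)
  · by_contra! hlt
    exact lt_irrefl _ ((key _ h2).2 hlt)

/-- Restarting at the passage time changes neither the end point of the path nor its minimum. -/
lemma height_passage (hw : Continuous w) (hw0 : w 0 = 0) (hx : 0 ≤ x)
    (hd : x < depth m s w 0 e) :
    height m s w (passage m s w x) (e - passage m s w x) = height m s w 0 e := by
  have hTe : passage m s w x < e := passage_lt hw hw0 hx hd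
  obtain ⟨t₀, -, ht₀⟩ := (lt_depth_zero_iff hw hw0 e x).1 hd
  have hv := passage_value hw hw0 hx ⟨t₀, ht₀⟩
  rw [height, height, depth_passage hw hw0 hx hd]
  simp only [segment, one_mul, zero_add, add_tsub_cancel_of_le hTe.le, NNReal.coe_sub hTe.le,
    NNReal.coe_one, hw0]
  linarith

end Passage

variable {S Ω : Type*} [MeasurableSpace S] {m0 : MeasurableSpace Ω} {P : Measure Ω}
  [IsProbabilityMeasure P]
  {B : ℝ≥0 → Ω → ℝ} {A : ℝ≥0 → Ω → ℕ} {X : ℕ → Ω → S} {q : ℝ}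
  (h : IsRegularDrivers P B A X q)

include h

lemma measurable_passage (m s x : ℝ) : Measurable fun ω => passage m s (fun u => B u ω) x := by
  have hden : ∀ (U : Set ℝ≥0), IsOpen U →
      ((∃ u ∈ U, True) ↔ ∃ n, TopologicalSpace.denseSeq ℝ≥0 n ∈ U) := fun U hU =>
    ⟨fun ⟨u, hu, _⟩ => (TopologicalSpace.denseRange_denseSeq ℝ≥0).exists_mem_open hU ⟨u, hu⟩,
      fun ⟨n, hn⟩ => ⟨_, hn, trivial⟩⟩
  have hmeas : ∀ u : ℝ≥0, MeasurableSet {ω | m * u + s * B u ω < -x} := fun u =>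
    measurableSet_lt (measurable_const.add ((h.measurable_B u).const_mul s)) measurable_const
  refine measurable_of_Iio fun t => ?_
  -- The second set of the union accounts for paths that never go below `-x`: there the infimum of
  -- the empty set is `0`, so the condition reduces to `0 < t`.
  have hset : (fun ω => passage m s (fun u => B u ω) x) ⁻¹' Set.Iio t =
      (⋃ n, {ω | TopologicalSpace.denseSeq ℝ≥0 n < t ∧
        m * TopologicalSpace.denseSeq ℝ≥0 n + s * B (TopologicalSpace.denseSeq ℝ≥0 n) ω < -x}) ∪
      ({_ω | 0 < t} ∩ (⋃ n, {ω |
        m * TopologicalSpace.denseSeq ℝ≥0 n +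
          s * B (TopologicalSpace.denseSeq ℝ≥0 n) ω < -x})ᶜ) := by
    ext ω
    have hop := isOpen_below (m := m) (s := s) (h.continuous_B ω) x
    simp only [Set.mem_preimage, Set.mem_Iio, Set.mem_union, Set.mem_iUnion, Set.mem_inter_iff,
      Set.mem_compl_iff, Set.mem_ofPred_eq]
    rcases Set.eq_empty_or_nonempty {t : ℝ≥0 | m * t + s * B t ω < -x} with he | hne
    · have h1 : ∀ u : ℝ≥0, ¬ m * u + s * B u ω < -x := fun u hu => by
        have : u ∈ {t : ℝ≥0 | m * t + s * B t ω < -x} := hu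
        rw [he] at this
        exact this
      have h2 : passage m s (fun u => B u ω) x = 0 := by
        rw [passage, he, NNReal.sInf_empty]
      simp [h1, h2]
    · have h1 := (hden _ hop).1 ⟨hne.some, hne.some_mem, trivial⟩
      have h2 := hden _ (hop.inter (isOpen_Iio (a := t)))
      rw [passage_lt_iff hne]
      constructor
      · rintro ⟨u, hu, hlt⟩
        obtain ⟨n, hn⟩ := h2.1 ⟨u, ⟨hlt, hu⟩, trivial⟩
        exact Or.inl ⟨n, hn.2, hn.1⟩
      · rintro (⟨n, hn⟩ | ⟨_, hn⟩)
        · exact ⟨_, hn.1, hn.2⟩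
        · exact absurd h1 hn
  rw [hset]
  refine MeasurableSet.union (MeasurableSet.iUnion fun n => ?_)
    (MeasurableSet.inter (MeasurableSet.const _) (MeasurableSet.iUnion fun n => hmeas _).compl)
  exact (MeasurableSet.const _).inter (hmeas _)

variable [Finite S] (μ σ : S → ℝ)

/-- The Markov property of the first block at the passage time below `-x`. -/
lemma measure_depth_passage (i : S) {x : ℝ} (hx : 0 ≤ x) {C : Set (ℝ × ℝ)}
    (hC : MeasurableSet C) :
    P {ω | x < (arrivalBlock μ σ B A 0 ω i).1 ∧
        ((arrivalBlock μ σ B A 0 ω i).1 - x, (arrivalBlock μ σ B A 0 ω i).2) ∈ C} =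
      P {ω | x < (arrivalBlock μ σ B A 0 ω i).1} * P {ω | arrivalBlock μ σ B A 0 ω i ∈ C} := by
  have h0 := measurable_arrivalBlock h μ σ 0
  have h0i : Measurable fun ω => arrivalBlock μ σ B A 0 ω i := (measurable_pi_apply i).comp h0
  set E := {ω | x < (arrivalBlock μ σ B A 0 ω i).1} with hE
  have hEm : MeasurableSet E := measurableSet_lt measurable_const h0i.fst
  let T : Ω → ℝ≥0 := fun ω => passage (μ i) (σ i) (fun u => B u ω) x
  have hTm : Measurable T := measurable_passage h _ _ _
  have hET : ∀ t, MeasurableSet[past B A X t] (E ∩ {ω | T ω < t}) := by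
    intro t
    -- Depth beyond `x` with passage before `t` means that at some dense time before `t` the path is
    -- below `-x` and no arrival has occurred yet. All of this is known at time `t`, although the
    -- depth itself is not.
    have hset : E ∩ {ω | T ω < t} = ⋃ n, {ω | TopologicalSpace.denseSeq ℝ≥0 n < t ∧
        (μ i * TopologicalSpace.denseSeq ℝ≥0 n + σ i * B (TopologicalSpace.denseSeq ℝ≥0 n) ω < -x
          ∧ A (TopologicalSpace.denseSeq ℝ≥0 n) ω = A 0 ω)} := by
      ext ω
      have hw := h.continuous_B ω
      have hw0 := h.B_zero ω
      simp only [Set.mem_inter_iff, Set.mem_iUnion, Set.mem_ofPred_eq, hE]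
      have hA : ∀ u, u < nextArrival A 0 ω ↔ A u ω = A 0 ω := fun u => by
        have := lt_nextArrival_iff h 0 u ω
        rwa [zero_add] at this
      constructor
      · rintro ⟨hd, ht⟩
        have hTe : T ω < nextArrival A 0 ω := passage_lt hw hw0 hx hd
        obtain ⟨t₀, -, ht₀⟩ := (lt_depth_zero_iff hw hw0 _ x).1 hd
        obtain ⟨u, hu, hlt⟩ := (passage_lt_iff (m := μ i) (s := σ i)
          (w := fun u => B u ω) ⟨t₀, ht₀⟩ _).1 (lt_min ht hTe)
        obtain ⟨n, hn⟩ := (TopologicalSpace.denseRange_denseSeq ℝ≥0).exists_mem_open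
          ((isOpen_below hw x).inter isOpen_Iio) ⟨u, hlt, hu⟩
        exact ⟨n, (lt_min_iff.1 hn.2).1, hn.1, (hA _).1 (lt_min_iff.1 hn.2).2⟩
      · rintro ⟨n, hnt, hlt, hAn⟩
        exact ⟨(lt_depth_zero_iff hw hw0 _ x).2 ⟨_, ((hA _).2 hAn).le, hlt⟩,
          (passage_le hlt).trans_lt hnt⟩
    rw [hset]
    refine @MeasurableSet.iUnion _ _ (past B A X t) _ _ fun n => ?_
    by_cases hn : TopologicalSpace.denseSeq ℝ≥0 n < t
    · have e1 : {ω | TopologicalSpace.denseSeq ℝ≥0 n < t ∧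
          (μ i * TopologicalSpace.denseSeq ℝ≥0 n + σ i * B (TopologicalSpace.denseSeq ℝ≥0 n) ω < -x
            ∧ A (TopologicalSpace.denseSeq ℝ≥0 n) ω = A 0 ω)} =
          B (TopologicalSpace.denseSeq ℝ≥0 n) ⁻¹'
            {y | μ i * TopologicalSpace.denseSeq ℝ≥0 n + σ i * y < -x} ∩
          (fun ω => (A (TopologicalSpace.denseSeq ℝ≥0 n) ω, A 0 ω)) ⁻¹' {y | y.1 = y.2} := by
        ext ω
        simp only [Set.mem_ofPred_eq, Set.mem_inter_iff, Set.mem_preimage]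
        exact ⟨fun hh => hh.2, fun hh => ⟨hn, hh⟩⟩
      rw [e1]
      refine @MeasurableSet.inter _ (past B A X t) _ _ ?_ ?_
      · exact measurable_past_brownian B A X hn.le
          (measurableSet_lt (by fun_prop) measurable_const)
      · exact ((measurable_past_arrival B A X hn.le).prodMk
          (measurable_past_arrival B A X zero_le))
          (measurableSet_eq_fun (by fun_prop) (by fun_prop))
    · convert @MeasurableSet.empty _ (past B A X t)
      ext ω
      simp [hn]
  have hCi : MeasurableSet {z : S → ℝ × ℝ | z i ∈ C} := measurable_pi_apply i hC
  have key := strongMarkov_arrivalBlock h μ σ hTm hEm hET hCi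
  rw [Measure.map_apply h0 hCi] at key
  rw [show {ω | arrivalBlock μ σ B A 0 ω i ∈ C} =
    arrivalBlock μ σ B A 0 ⁻¹' {z : S → ℝ × ℝ | z i ∈ C} from rfl, ← key]
  congr 1
  ext ω
  simp only [Set.mem_ofPred_eq, Set.mem_inter_iff, Set.mem_preimage, hE]
  refine and_congr_right fun hd => ?_
  have hw := h.continuous_B ω
  have hw0 := h.B_zero ω
  have hTe : T ω < nextArrival A 0 ω := passage_lt hw hw0 hx hd
  -- On the event considered, passage precedes the first arrival, so the block started at `T` ends
  -- at that arrival; its depth is the old one minus `x` and its height is unchanged.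
  have hnext : nextArrival A (T ω) ω = nextArrival A 0 ω - T ω := by
    have := add_nextArrival_eq h (t := 0) zero_le (by rwa [zero_add])
    rw [zero_add] at this
    rw [← this, add_tsub_cancel_left]
  have e1 : arrivalBlock μ σ B A (T ω) ω i =
      ((arrivalBlock μ σ B A 0 ω i).1 - x, (arrivalBlock μ σ B A 0 ω i).2) := by
    simp only [arrivalBlock, block, hnext]
    exact Prod.ext (depth_passage hw hw0 hx hd) (height_passage hw hw0 hx hd)
  rw [e1]

end MMBM

/-! ### Characteristic functions and the Wiener–Hopf factorization. -/

namespace MMBM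

section ExponentialCharFun

variable {r : ℝ}

lemma integral_cexp_expMeasure (hr : 0 < r) {c : ℂ} (hc : c.re ≤ 0) :
    ∫ x : ℝ, Complex.exp (c * x) ∂expMeasure r = r / (r - c) := by
  have hre : (c - r).re < 0 := by
    rw [Complex.sub_re, Complex.ofReal_re]
    linarith
  have hne : c - r ≠ 0 := fun h0 => by rw [h0] at hre; simp at hre
  have h1 : ∫ x : ℝ, Complex.exp (c * x) ∂expMeasure r =
      ∫ x : ℝ, (exponentialPDF r x).toReal • Complex.exp (c * x) := by
    rw [expMeasure, gammaMeasure, integral_withDensity_eq_integral_toReal_smul]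
    · rfl
    · exact (measurable_gammaPDFReal 1 r).ennreal_ofReal
    · exact ae_of_all _ fun x => ENNReal.ofReal_lt_top
  have h2 : (fun x : ℝ => (exponentialPDF r x).toReal • Complex.exp (c * x)) =
      (Set.Ici (0 : ℝ)).indicator fun x : ℝ => (r : ℂ) * Complex.exp ((c - r) * x) := by
    funext x
    rcases lt_or_ge x 0 with hx | hx
    · rw [exponentialPDF_of_neg hx, Set.indicator_of_notMem (by simpa using hx)]
      simp
    · rw [exponentialPDF_of_nonneg hx, Set.indicator_of_mem (Set.mem_Ici.2 hx),
        ENNReal.toReal_ofReal (by positivity), Complex.real_smul, Complex.ofReal_mul,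
        Complex.ofReal_exp, mul_assoc, ← Complex.exp_add]
      congr 2
      push_cast
      ring
  rw [h1, h2, integral_indicator measurableSet_Ici, integral_Ici_eq_integral_Ioi,
    integral_const_mul, integral_exp_mul_complex_Ioi hre]
  have hne' : (r : ℂ) - c ≠ 0 := fun h0 => hne (by rw [← neg_sub, h0, neg_zero])
  simp only [Complex.ofReal_zero, mul_zero, Complex.exp_zero]
  field_simp
  ring

lemma charFun_expMeasure (hr : 0 < r) (t : ℝ) :
    charFun (expMeasure r) t = r / (r - t * Complex.I) := by
  rw [charFun_apply_real, ← integral_cexp_expMeasure hr (c := t * Complex.I) (by simp)]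
  congr 1
  funext x
  ring_nf

lemma eq_expMeasure {ρ : Measure ℝ} [IsProbabilityMeasure ρ] (hr : 0 < r)
    (h0 : ρ (Set.Iio 0) = 0)
    (h : ∀ x, 0 ≤ x → ρ (Set.Ioi x) = ENNReal.ofReal (Real.exp (-(r * x)))) :
    ρ = expMeasure r := by
  have : IsProbabilityMeasure (expMeasure r) := isProbabilityMeasure_expMeasure hr
  refine Measure.ext_of_Iic _ _ fun a => ?_
  rcases lt_or_ge a 0 with ha | ha
  · rw [measure_mono_null (Set.Iic_subset_Iic.2 ha.le) (expMeasure_Iic_zero r),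
      measure_mono_null (fun y hy => lt_of_le_of_lt hy ha : Set.Iic a ⊆ Set.Iio 0) h0]
  · rw [← Set.compl_Ioi, prob_compl_eq_one_sub measurableSet_Ioi,
      prob_compl_eq_one_sub measurableSet_Ioi, expMeasure_Ioi hr ha, h a ha]

/-- The law of the difference of two independent exponential variables. -/
def diffExpMeasure (et om : ℝ) : Measure ℝ :=
  ((expMeasure et).prod ((expMeasure om).map (-1 * ·))).map fun p => p.1 + p.2

variable {om et : ℝ}

lemma charFun_diffExpMeasure (het : 0 < et) (hom : 0 < om) (t : ℝ) :
    charFun (diffExpMeasure et om) t =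
      et / (et - t * Complex.I) * (om / (om + t * Complex.I)) := by
  have := isProbabilityMeasure_expMeasure het
  have := isProbabilityMeasure_expMeasure hom
  have : IsProbabilityMeasure ((expMeasure om).map (-1 * ·)) :=
    Measure.isProbabilityMeasure_map (by fun_prop)
  rw [diffExpMeasure, charFun_map_add_prod_eq_mul, Pi.mul_apply, charFun_expMeasure het,
    charFun_map_mul, charFun_expMeasure hom]
  push_cast
  ring_nf

/-- Given the value `l` of the positive part, the other exponential variable must exceed `x + l`;
memorylessness gives the factor `e^{-ωx}` whatever `l` is. -/
lemma diffExpMeasure_Iio (het : 0 < et) (hom : 0 < om) {x : ℝ} (hx : 0 ≤ x) :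
    diffExpMeasure et om (Set.Iio (-x)) =
      ENNReal.ofReal (Real.exp (-(om * x))) * diffExpMeasure et om (Set.Iio 0) := by
  have := isProbabilityMeasure_expMeasure het
  have := isProbabilityMeasure_expMeasure hom
  have : IsProbabilityMeasure ((expMeasure om).map (-1 * ·)) :=
    Measure.isProbabilityMeasure_map (by fun_prop)
  have key : ∀ y, 0 ≤ y → diffExpMeasure et om (Set.Iio (-y)) =
      ∫⁻ l, ENNReal.ofReal (Real.exp (-(om * y))) * ENNReal.ofReal (Real.exp (-(om * l)))
        ∂expMeasure et := by
    intro y hy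
    have hm : Measurable fun p : ℝ × ℝ => p.1 + p.2 := by fun_prop
    rw [diffExpMeasure, Measure.map_apply hm measurableSet_Iio,
      Measure.prod_apply (hm measurableSet_Iio)]
    refine lintegral_congr_ae ?_
    filter_upwards [ae_pos_expMeasure et] with l hl
    rw [Measure.map_apply (by fun_prop) (measurable_prodMk_left (hm measurableSet_Iio))]
    have hset : ((-1 * ·) : ℝ → ℝ) ⁻¹' (Prod.mk l ⁻¹' ((fun p : ℝ × ℝ => p.1 + p.2) ⁻¹'
        Set.Iio (-y))) = Set.Ioi (y + l) := by
      ext z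
      simp only [Set.mem_preimage, Set.mem_Iio, Set.mem_Ioi]
      constructor <;> intro hz <;> linarith
    rw [hset, expMeasure_Ioi hom (by positivity), ← ENNReal.ofReal_mul (Real.exp_nonneg _),
      ← Real.exp_add]
    congr 2
    ring
  have h0 := key 0 le_rfl
  rw [neg_zero] at h0
  rw [key x hx, h0, lintegral_const_mul _ (by fun_prop)]
  simp

lemma diffExpMeasure_Iio_zero_pos (het : 0 < et) (hom : 0 < om) :
    diffExpMeasure et om (Set.Iio 0) ≠ 0 := by
  have := isProbabilityMeasure_expMeasure het
  have := isProbabilityMeasure_expMeasure hom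
  have : IsProbabilityMeasure ((expMeasure om).map (-1 * ·)) :=
    Measure.isProbabilityMeasure_map (by fun_prop)
  have hm : Measurable fun p : ℝ × ℝ => p.1 + p.2 := by fun_prop
  rw [diffExpMeasure, Measure.map_apply hm measurableSet_Iio]
  have h1 : expMeasure et (Set.Iic 1) ≠ 0 := by
    rw [← Set.compl_Ioi, prob_compl_eq_one_sub measurableSet_Ioi, expMeasure_Ioi het zero_le_one]
    refine (tsub_pos_of_lt ?_).ne'
    rw [ENNReal.ofReal_lt_one, Real.exp_lt_one_iff]
    linarith
  have h2 : (expMeasure om).map (-1 * ·) (Set.Iio (-1)) ≠ 0 := by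
    rw [Measure.map_apply (by fun_prop) measurableSet_Iio]
    have : ((-1 * ·) : ℝ → ℝ) ⁻¹' Set.Iio (-1) = Set.Ioi 1 := by
      ext z
      simp
    rw [this, expMeasure_Ioi hom zero_le_one]
    simp [Real.exp_pos]
  have h3 : ((expMeasure et).prod ((expMeasure om).map (-1 * ·)))
      (Set.Iic 1 ×ˢ Set.Iio (-1)) ≠ 0 := by
    rw [Measure.prod_prod]
    exact mul_ne_zero h1 h2
  refine fun h0 => h3 (measure_mono_null ?_ h0)
  rintro ⟨a, b⟩ ⟨ha, hb⟩
  simp only [Set.mem_Iic, Set.mem_Iio, Set.mem_preimage] at ha hb ⊢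
  linarith

end ExponentialCharFun

variable {S Ω : Type*} [MeasurableSpace S] {m0 : MeasurableSpace Ω} {P : Measure Ω}
  [IsProbabilityMeasure P]
  {B : ℝ≥0 → Ω → ℝ} {A : ℝ≥0 → Ω → ℕ} {X : ℕ → Ω → S} {q : ℝ}
  (h : IsRegularDrivers P B A X q)

include h

/-- The displacement of `m t + s B(t)` until the first arrival. -/
lemma charFun_endpoint (m s u : ℝ) :
    charFun (P.map fun ω => m * nextArrival A 0 ω + s * B (nextArrival A 0 ω) ω) u =
      q / (q - (u * m * Complex.I - u ^ 2 * s ^ 2 / 2)) := by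
  have hW := measurable_shiftPath h 0
  have he := measurable_nextArrival h 0
  set g : Path × ℝ≥0 → ℂ := fun p => Complex.exp (u * (m * p.2 + s * p.1.1 p.2 : ℝ) * Complex.I)
    with hg
  have hgm : Measurable g := by
    have h1 : Measurable fun p : Path × ℝ≥0 => m * p.2 + s * p.1.1 p.2 :=
      ((measurable_snd.coe_nnreal_real).const_mul m).add (measurable_path_eval.const_mul s)
    exact Complex.measurable_exp.comp
      (((Complex.measurable_ofReal.comp h1).const_mul _).mul_const _)
  have hval : ∀ ω, (fun ω => m * nextArrival A 0 ω + s * B (nextArrival A 0 ω) ω) ω =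
      m * nextArrival A 0 ω + s * (shiftPath h.continuous_B 0 ω).1 (nextArrival A 0 ω) := by
    intro ω
    simp [shiftPath, h.B_zero]
  have hgn : ∀ p, ‖g p‖ = 1 := fun p => by
    rw [hg]
    simp only
    rw [← Complex.ofReal_mul, Complex.norm_exp_ofReal_mul_I]
  have hYm : Measurable fun ω => m * nextArrival A 0 ω + s * B (nextArrival A 0 ω) ω := by
    have : (fun ω => m * nextArrival A 0 ω + s * B (nextArrival A 0 ω) ω) =
        (fun p : Path × ℝ≥0 => m * p.2 + s * p.1.1 p.2) ∘
          fun ω => (shiftPath h.continuous_B 0 ω, nextArrival A 0 ω) := funext hval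
    rw [this]
    exact (((measurable_snd.coe_nnreal_real).const_mul m).add
      (measurable_path_eval.const_mul s)).comp (hW.prodMk he)
  have hprobW : IsProbabilityMeasure (P.map (shiftPath h.continuous_B 0)) :=
    Measure.isProbabilityMeasure_map hW.aemeasurable
  have hprobe : IsProbabilityMeasure (P.map (nextArrival A 0)) :=
    Measure.isProbabilityMeasure_map he.aemeasurable
  rw [charFun_apply_real, integral_map hYm.aemeasurable
    (by fun_prop : Continuous fun x : ℝ => Complex.exp (u * x * Complex.I)).aestronglyMeasurable]
  have e1 : ∫ ω, Complex.exp (u * ((m * nextArrival A 0 ω + s * B (nextArrival A 0 ω) ω : ℝ) : ℂ)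
      * Complex.I) ∂P =
      ∫ ω, g (shiftPath h.continuous_B 0 ω, nextArrival A 0 ω) ∂P := by
    congr 1
    funext ω
    rw [show (m * nextArrival A 0 ω + s * B (nextArrival A 0 ω) ω) = _ from hval ω]
  rw [e1, ← integral_map (hW.prodMk he).aemeasurable hgm.aestronglyMeasurable,
    (indepFun_iff_map_prod_eq_prod_map_map hW.aemeasurable he.aemeasurable).1
      (indepFun_shiftPath_nextArrival h 0), integral_prod_symm]
  swap
  · exact (integrable_const (1 : ℝ)).mono hgm.aestronglyMeasurable
      (ae_of_all _ fun p => by rw [hgn p]; simp)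
  -- The Brownian path is integrated out first, at a frozen time `e`, where its value is Gaussian;
  -- the exponential time is integrated afterwards.
  have e2 : ∀ e : ℝ≥0, ∫ w, g (w, e) ∂(P.map (shiftPath h.continuous_B 0)) =
      Complex.exp ((u * m * Complex.I - u ^ 2 * s ^ 2 / 2) * (e : ℝ)) := by
    intro e
    have hge : Measurable fun w : Path => g (w, e) :=
      hgm.comp (measurable_id.prodMk measurable_const)
    rw [integral_map hW.aemeasurable hge.aestronglyMeasurable]
    have e3 : ∀ ω, g (shiftPath h.continuous_B 0 ω, e) =
        Complex.exp (u * m * e * Complex.I) * Complex.exp ((u * s : ℝ) * B e ω * Complex.I) := by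
      intro ω
      rw [hg, ← Complex.exp_add]
      simp only [shiftPath, h.B_zero, zero_add, sub_zero]
      congr 1
      push_cast
      ring
    simp_rw [e3]
    rw [integral_const_mul]
    have e4 : ∫ ω, Complex.exp ((u * s : ℝ) * B e ω * Complex.I) ∂P =
        charFun (gaussianReal 0 e) (u * s) := by
      rw [← (h.brownian.hasLaw_eval e).map_eq, charFun_apply_real,
        integral_map (h.measurable_B e).aemeasurable
          (by fun_prop : Continuous fun x : ℝ =>
            Complex.exp ((u * s : ℝ) * x * Complex.I)).aestronglyMeasurable]
    rw [e4, charFun_gaussianReal, ← Complex.exp_add]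
    congr 1
    push_cast
    ring
  simp_rw [e2]
  rw [integral_map he.aemeasurable (by fun_prop : Continuous fun e : ℝ≥0 =>
      Complex.exp ((u * m * Complex.I - u ^ 2 * s ^ 2 / 2) * (e : ℝ))).aestronglyMeasurable]
  have e5 := integral_map (μ := P) (φ := fun ω => (nextArrival A 0 ω : ℝ))
    he.coe_nnreal_real.aemeasurable (f := fun x : ℝ =>
      Complex.exp ((u * m * Complex.I - u ^ 2 * s ^ 2 / 2) * x))
    (by fun_prop : Continuous fun x : ℝ =>
      Complex.exp ((u * m * Complex.I - u ^ 2 * s ^ 2 / 2) * x)).aestronglyMeasurable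
  rw [← e5, map_nextArrival h, integral_cexp_expMeasure h.rate_pos]
  have : (u * m * Complex.I - u ^ 2 * s ^ 2 / 2 : ℂ) =
      ((-(u ^ 2 * s ^ 2 / 2) : ℝ) : ℂ) + ((u * m : ℝ) : ℂ) * Complex.I := by
    push_cast
    ring
  rw [this, Complex.add_re, Complex.ofReal_re, Complex.re_ofReal_mul, Complex.I_re, mul_zero,
    add_zero]
  have := mul_nonneg (sq_nonneg u) (sq_nonneg s)
  linarith

variable [Finite S] (μ σ : S → ℝ)

/-- The **Wiener–Hopf factorization** at an exponential time: the depth and the height of the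
first block are independent and exponential. -/
theorem map_arrivalBlock_apply (i : S) {om et : ℝ} (hom : 0 < om) (het : 0 < et) (hσ : 0 < σ i)
    (hsub : om - et = 2 * (μ i * (σ i ^ 2)⁻¹)) (hmul : om * et = 2 * q * (σ i ^ 2)⁻¹) :
    P.map (fun ω => arrivalBlock μ σ B A 0 ω i) = (expMeasure om).prod (expMeasure et) := by
  have h0 : Measurable fun ω => arrivalBlock μ σ B A 0 ω i :=
    (measurable_pi_apply i).comp (measurable_arrivalBlock h μ σ 0)
  set ℓ : Ω → ℝ := fun ω => (arrivalBlock μ σ B A 0 ω i).1 with hℓ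
  set H : Ω → ℝ := fun ω => (arrivalBlock μ σ B A 0 ω i).2 with hH
  have hℓm : Measurable ℓ := h0.fst
  have hHm : Measurable H := h0.snd
  have hℓ0 : ∀ ω, 0 ≤ ℓ ω := fun ω => depth_nonneg (h.continuous_B ω) _ _
  have hY : ∀ ω, H ω + -1 * ℓ ω = μ i * nextArrival A 0 ω + σ i * B (nextArrival A 0 ω) ω := by
    intro ω
    simp only [hH, hℓ, arrivalBlock, block, height, segment, h.B_zero]
    simp
  have hYm : Measurable fun ω => H ω + -1 * ℓ ω := hHm.add (hℓm.const_mul _)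
  have := isProbabilityMeasure_expMeasure het
  have := isProbabilityMeasure_expMeasure hom
  have : IsProbabilityMeasure ((expMeasure om).map (-1 * ·)) :=
    Measure.isProbabilityMeasure_map (by fun_prop)
  have : IsProbabilityMeasure (diffExpMeasure et om) :=
    Measure.isProbabilityMeasure_map (by fun_prop)
  have : IsProbabilityMeasure (P.map fun ω => H ω + -1 * ℓ ω) :=
    Measure.isProbabilityMeasure_map hYm.aemeasurable
  have : IsProbabilityMeasure (P.map H) := Measure.isProbabilityMeasure_map hHm.aemeasurable
  have : IsProbabilityMeasure (P.map ℓ) := Measure.isProbabilityMeasure_map hℓm.aemeasurable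
  have hden : ∀ {r : ℝ}, 0 < r → ∀ u : ℝ, (r : ℂ) - u * Complex.I ≠ 0 := fun hr u h0 => by
    have := congrArg Complex.re h0
    simp at this
    exact hr.ne' this
  have hden' : ∀ {r : ℝ}, 0 < r → ∀ u : ℝ, (r : ℂ) + u * Complex.I ≠ 0 := fun hr u h0 => by
    have := congrArg Complex.re h0
    simp at this
    exact hr.ne' this
  -- The denominator of the characteristic function of the end point is quadratic and factors as
  -- `(σ²/2)(η - iu)(ω + iu)`, by the sum and product relations for `ω` and `η`. So the end point is
  -- distributed like a difference of independent exponentials.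
  have hlawY : P.map (fun ω => H ω + -1 * ℓ ω) = diffExpMeasure et om := by
    refine Measure.ext_of_charFun (funext fun u => ?_)
    rw [charFun_diffExpMeasure het hom, funext hY, charFun_endpoint h]
    have hσ1 : (σ i : ℂ) ≠ 0 := by exact_mod_cast hσ.ne'
    have hq : (q : ℂ) - (u * μ i * Complex.I - u ^ 2 * σ i ^ 2 / 2) =
        σ i ^ 2 / 2 * (((et : ℂ) - u * Complex.I) * (om + u * Complex.I)) := by
      have hs : ((om : ℂ) - et) * σ i ^ 2 = 2 * μ i := by
        have : (om - et) * σ i ^ 2 = 2 * μ i := by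
          rw [hsub]; field_simp
        exact_mod_cast this
      have hm : ((om : ℂ) * et) * σ i ^ 2 = 2 * q := by
        have : (om * et) * σ i ^ 2 = 2 * q := by
          rw [hmul]; field_simp
        exact_mod_cast this
      linear_combination (-1 / 2 : ℂ) * hm + (1 / 2 : ℂ) * u * Complex.I * hs +
        (σ i ^ 2 / 2 * u ^ 2 : ℂ) * Complex.I_sq
    have hqq : (q : ℂ) = σ i ^ 2 / 2 * (et * om) := by
      have : q = σ i ^ 2 / 2 * (et * om) := by
        rw [mul_comm et, hmul]; field_simp
      exact_mod_cast this
    rw [hq, hqq]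
    have h1 := hden het u
    have h2 := hden' hom u
    field_simp
  have hpass := fun (x : ℝ) (hx : 0 ≤ x) (C : Set (ℝ × ℝ)) (hC : MeasurableSet C) =>
    measure_depth_passage h μ σ i hx hC
  -- Since heights are nonnegative, an end point below `-x` forces the depth to exceed `x`. The
  -- Markov property then gives `P(Y < -x) = P(ℓ > x) P(Y < 0)`, while the law of `Y = H - ℓ` gives
  -- `e^{-ωx} P(Y < 0)`; the positive factor `P(Y < 0)` cancels.
  have hG : ∀ x, 0 ≤ x → P {ω | x < ℓ ω} = ENNReal.ofReal (Real.exp (-(om * x))) := by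
    intro x hx
    have hC : MeasurableSet {z : ℝ × ℝ | z.2 + -1 * z.1 < 0} :=
      measurableSet_lt (by fun_prop) measurable_const
    have h1 := hpass x hx _ hC
    have h2 := diffExpMeasure_Iio het hom hx
    rw [← hlawY, Measure.map_apply hYm measurableSet_Iio,
      Measure.map_apply hYm measurableSet_Iio] at h2
    have e1 : {ω | x < ℓ ω ∧ (ℓ ω - x, H ω) ∈ {z : ℝ × ℝ | z.2 + -1 * z.1 < 0}} =
        (fun ω => H ω + -1 * ℓ ω) ⁻¹' Set.Iio (-x) := by
      ext ω
      have hH0 : 0 ≤ H ω := height_nonneg (h.continuous_B ω) _ _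
      simp only [Set.mem_ofPred_eq, Set.mem_preimage, Set.mem_Iio]
      constructor
      · rintro ⟨-, h2⟩; linarith
      · intro h2; constructor <;> linarith
    have h3 : (P {ω | H ω + -1 * ℓ ω < 0}) ≠ 0 := by
      have := diffExpMeasure_Iio_zero_pos het hom
      rwa [← hlawY, Measure.map_apply hYm measurableSet_Iio] at this
    have h1' : P {ω | x < ℓ ω ∧ (ℓ ω - x, H ω) ∈ {z : ℝ × ℝ | z.2 + -1 * z.1 < 0}} =
      P {ω | x < ℓ ω} * P {ω | H ω + -1 * ℓ ω < 0} := h1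
    rw [e1, h2] at h1'
    exact ((ENNReal.mul_left_inj h3 (measure_ne_top _ _)).1 h1').symm
  have hlawℓ : P.map ℓ = expMeasure om := by
    refine eq_expMeasure hom ?_ fun x hx => ?_
    · rw [Measure.map_apply hℓm measurableSet_Iio]
      convert measure_empty (μ := P)
      ext ω
      simpa using hℓ0 ω
    · rw [Measure.map_apply hℓm measurableSet_Ioi]
      exact hG x hx
  -- The Markov property at the passage time, applied to an event about the height alone.
  have hind : IndepFun ℓ H P := by
    have hpi : IsPiSystem (Set.range (fun a => ℓ ⁻¹' Set.Ioi a)) := by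
      rintro - ⟨a, rfl⟩ - ⟨b, rfl⟩ -
      exact ⟨a ⊔ b, by rw [← Set.preimage_inter, Set.Ioi_inter_Ioi]⟩
    refine IndepSets.indep hℓm.comap_le hHm.comap_le hpi
      (@MeasurableSpace.isPiSystem_measurableSet Ω (MeasurableSpace.comap H inferInstance)) ?_
      (@MeasurableSpace.generateFrom_measurableSet Ω (MeasurableSpace.comap H inferInstance)).symm
      ?_
    · have hb : Real.measurableSpace = MeasurableSpace.generateFrom (Set.range Set.Ioi) :=
        (BorelSpace.measurable_eq (α := ℝ)).trans (borel_eq_generateFrom_Ioi ℝ)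
      change MeasurableSpace.comap _ Real.measurableSpace = _
      rw [hb, MeasurableSpace.comap_generateFrom, ← Set.range_comp]
      rfl
    · rw [IndepSets_iff]
      rintro - - ⟨a, rfl⟩ ⟨s, hs, rfl⟩
      rcases lt_or_ge a 0 with ha | ha
      · have : (fun a => ℓ ⁻¹' Set.Ioi a) a = Set.univ := by
          ext ω
          simpa using ha.trans_le (hℓ0 ω)
        rw [this, Set.univ_inter, measure_univ, one_mul]
      · exact hpass a ha {z | z.2 ∈ s} (measurable_snd hs)
  -- By independence the characteristic function of `H - ℓ` is a product whose factor for `-ℓ` is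
  -- known and nowhere zero; dividing by it leaves that of `H`.
  have hlawH : P.map H = expMeasure et := by
    refine Measure.ext_of_charFun (funext fun u => ?_)
    have h1 : charFun (P.map fun ω => H ω + -1 * ℓ ω) u =
        charFun (P.map H) u * (om / (om + u * Complex.I)) := by
      have hi : IndepFun H (fun ω => -1 * ℓ ω) P :=
        hind.symm.comp measurable_id (measurable_const_mul (-1))
      rw [hi.charFun_map_fun_add_eq_mul hHm.aemeasurable (hℓm.const_mul _).aemeasurable,
        Pi.mul_apply, charFun_map_mul_comp hℓm.aemeasurable, hlawℓ, charFun_expMeasure hom]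
      push_cast
      ring_nf
    rw [hlawY, charFun_diffExpMeasure het hom] at h1
    have hne : (om : ℂ) / (om + u * Complex.I) ≠ 0 :=
      div_ne_zero (by exact_mod_cast hom.ne') (hden' hom u)
    rw [charFun_expMeasure het]
    exact (mul_right_cancel₀ hne h1).symm
  have := (indepFun_iff_map_prod_eq_prod_map_map hℓm.aemeasurable hHm.aemeasurable).1 hind
  rw [hlawℓ, hlawH] at this
  exact this

end MMBM

/-! ### The sequence of blocks between successive arrivals. -/

namespace MMBM

/-- The epoch of the `k`-th arrival. -/
def epoch {Ω : Type*} (A : ℝ≥0 → Ω → ℕ) (k : ℕ) (ω : Ω) : ℝ≥0 := sInf {t | k ≤ A t ω}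

section Generic

variable {S Ω : Type*} [MeasurableSpace S] {_ : MeasurableSpace Ω} (μ σ : S → ℝ)

lemma measurable_block_comp {w : ℝ≥0 → Ω → ℝ} (hw : ∀ u, Measurable (w u))
    (hc : ∀ ω, Continuous fun u => w u ω) {a e : Ω → ℝ≥0} (ha : Measurable a) (he : Measurable e) :
    Measurable fun ω => block μ σ (fun u => w u ω) (a ω) (e ω) := by
  have hp : Measurable fun ω => (⟨fun u => w u ω, hc ω⟩ : Path) :=
    Measurable.subtype_mk (measurable_pi_lambda _ hw)
  have hg : Measurable fun ω => ((⟨fun u => w u ω, hc ω⟩ : Path), a ω, e ω) :=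
    hp.prodMk (ha.prodMk he)
  have e : (fun ω => block μ σ (fun u => w u ω) (a ω) (e ω)) =
      (fun p : Path × ℝ≥0 × ℝ≥0 => block μ σ p.1.1 p.2.1 p.2.2) ∘ fun ω =>
        ((⟨fun u => w u ω, hc ω⟩ : Path), a ω, e ω) := rfl
  rw [e]
  exact (measurable_block μ σ).comp hg

lemma block_congr {w w' : ℝ≥0 → ℝ} {a e : ℝ≥0} (hw : ∀ u ≤ a + e, w u = w' u) :
    block μ σ w a e = block μ σ w' a e := by
  have hseg : ∀ m s : ℝ, ∀ r ∈ Set.Icc (0 : ℝ≥0) 1, segment m s w a e r = segment m s w' a e r := by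
    intro m s r hr
    rw [segment, segment, hw a le_self_add, hw (a + r * e)
      (add_le_add_right (mul_le_of_le_one_left zero_le hr.2) a)]
  have hdep : ∀ m s : ℝ, depth m s w a e = depth m s w' a e := fun m s => by
    rw [depth, depth, Set.image_congr (hseg m s)]
  funext i
  rw [block, block, height, height, hdep, hseg _ _ 1 (by simp)]

/-- The truncation is what makes an epoch observable by time `t`, using only counts up to `t`. -/
lemma measurable_min_epoch {A : ℝ≥0 → Ω → ℕ} {t : ℝ≥0} (hA : ∀ u ≤ t, Measurable (A u))
    (hle : ∀ k u ω, k ≤ A u ω ↔ epoch A k ω ≤ u) (k : ℕ) :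
    Measurable fun ω => min (epoch A k ω) t := by
  refine measurable_of_Iic fun c => ?_
  rcases le_or_gt t c with hc | hc
  · convert MeasurableSet.univ
    ext ω
    simp [hc]
  · have : (fun ω => min (epoch A k ω) t) ⁻¹' Set.Iic c = {ω | k ≤ A c ω} := by
      ext ω
      simp only [Set.mem_preimage, Set.mem_Iic, min_le_iff, not_le.2 hc, or_false,
        Set.mem_ofPred_eq, hle]
    rw [this]
    exact hA c hc.le measurableSet_Ici

lemma measurable_epoch {A : ℝ≥0 → Ω → ℕ} (hA : ∀ u, Measurable (A u))
    (hle : ∀ k u ω, k ≤ A u ω ↔ epoch A k ω ≤ u) (k : ℕ) : Measurable (epoch A k) := by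
  refine measurable_of_Iic fun c => ?_
  have : epoch A k ⁻¹' Set.Iic c = {ω | k ≤ A c ω} := by
    ext ω
    simp only [Set.mem_preimage, Set.mem_Iic, Set.mem_ofPred_eq, hle]
  rw [this]
  exact hA c measurableSet_Ici

end Generic

/-- A Markov chain `X` and random blocks `ξ k`, the `k`-th block being independent of the chain and
of the previous blocks, with independent exponential coordinates. -/
structure IsCycleChain {S Ω : Type*} [MeasurableSpace S] [MeasurableSpace Ω] (P : Measure Ω)
    (X : ℕ → Ω → S) (ξ : ℕ → Ω → S → ℝ × ℝ) (p : S → ℝ) (K : Matrix S S ℝ) (om et : S → ℝ) :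
    Prop where
  chain : IsMarkovChain X p K P
  measurable_block : ∀ k, Measurable (ξ k)
  nonneg : ∀ k ω i, 0 ≤ (ξ k ω i).1 ∧ 0 ≤ (ξ k ω i).2
  law : ∀ k i, P.map (fun ω => ξ k ω i) = (expMeasure (om i)).prod (expMeasure (et i))
  indep_past : ∀ k, IndepFun (fun ω => (fun j => X j ω, fun j => if j < k then ξ j ω else 0))
    (ξ k) P
  indep_chain : IndepFun (fun ω j => ξ j ω) (fun ω j => X j ω) P

variable {S Ω : Type*} [MeasurableSpace S] {m0 : MeasurableSpace Ω} {P : Measure Ω}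
  [IsProbabilityMeasure P]
  {B : ℝ≥0 → Ω → ℝ} {A : ℝ≥0 → Ω → ℕ} {X : ℕ → Ω → S} {q : ℝ}
  (h : IsRegularDrivers P B A X q)

section

include h

lemma le_arrival_iff (k : ℕ) (t : ℝ≥0) (ω : Ω) : k ≤ A t ω ↔ epoch A k ω ≤ t := by
  constructor
  · exact fun hk => csInf_le (OrderBot.bddBelow _) hk
  · intro hle
    by_contra! hlt
    obtain ⟨s, hs, hAs⟩ := h.right_A ω t
    obtain ⟨u, hu⟩ := h.surj_A ω k
    have : s ≤ epoch A k ω := le_csInf ⟨u, hu.ge⟩ fun v (hv : k ≤ A v ω) => by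
      by_contra! hvs
      have := h.mono_A ω hvs.le
      simp only at this
      omega
    exact absurd (hs.trans_le this) (not_lt.2 hle)

lemma arrival_epoch (k : ℕ) (ω : Ω) : A (epoch A k ω) ω = k := by
  refine le_antisymm ?_ ((le_arrival_iff h k _ ω).2 le_rfl)
  obtain ⟨u, hu⟩ := h.surj_A ω k
  have := h.mono_A ω ((le_arrival_iff h k u ω).1 hu.ge)
  simp only at this
  omega

lemma epoch_mono (ω : Ω) : Monotone fun k => epoch A k ω := fun j k hjk => by
  refine (le_arrival_iff h j _ ω).1 ?_
  rw [arrival_epoch h]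
  exact hjk

lemma nextArrival_epoch (k : ℕ) (ω : Ω) :
    nextArrival A (epoch A k ω) ω = epoch A (k + 1) ω - epoch A k ω := by
  have hle : epoch A k ω ≤ epoch A (k + 1) ω := epoch_mono h ω (Nat.le_succ k)
  refine eq_of_forall_lt_iff fun s => ?_
  rw [lt_nextArrival_iff h, arrival_epoch h, lt_tsub_iff_left, ← not_le, ← le_arrival_iff h]
  have := (le_arrival_iff h k (epoch A k ω + s) ω).2 le_self_add
  omega

end

/-- The block of the path between the `k`-th arrival and the next one. -/
def cycleBlock (μ σ : S → ℝ) (B : ℝ≥0 → Ω → ℝ) (A : ℝ≥0 → Ω → ℕ) (k : ℕ) (ω : Ω) : S → ℝ × ℝ :=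
  block μ σ (fun u => B u ω) (epoch A k ω) (epoch A (k + 1) ω - epoch A k ω)

section

include h

variable (μ σ : S → ℝ)

lemma cycleBlock_eq (k : ℕ) (ω : Ω) :
    cycleBlock μ σ B A k ω = arrivalBlock μ σ B A (epoch A k ω) ω := by
  rw [cycleBlock, arrivalBlock, nextArrival_epoch h]

lemma measurable_cycleBlock (k : ℕ) : Measurable (cycleBlock μ σ B A k) := by
  have he := measurable_epoch h.measurable_A (le_arrival_iff h)
  exact measurable_block_comp μ σ h.measurable_B h.continuous_B (he k) ((he (k + 1)).sub (he k))

/-- The history of the chain and of the first `k` blocks. -/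
lemma measurable_history (k : ℕ) : Measurable fun ω =>
    (fun j => X j ω, fun j => if j < k then cycleBlock μ σ B A j ω else 0) := by
  refine (measurable_pi_lambda _ h.measurable_X).prodMk (measurable_pi_lambda _ fun j => ?_)
  split_ifs
  · exact measurable_cycleBlock h μ σ j
  · exact measurable_const

/-- On the event that the `k`-th epoch precedes `t`, the first `k` blocks use the path only up to
`t`. They may be replaced by blocks of the path stopped at `t` between truncated epochs, which are
measurable in the past. -/
lemma measurableSet_past_history (k : ℕ) {C : Set ((ℕ → S) × (ℕ → S → ℝ × ℝ))}
    (hC : MeasurableSet C) (t : ℝ≥0) :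
    MeasurableSet[past B A X t] ((fun ω =>
      (fun j => X j ω, fun j => if j < k then cycleBlock μ σ B A j ω else 0)) ⁻¹' C ∩
      {ω | epoch A k ω < t}) := by
  have hE : ∀ j, Measurable[past B A X t] fun ω => min (epoch A j ω) t := fun j =>
    measurable_min_epoch (fun u hu => measurable_past_arrival B A X hu) (le_arrival_iff h) j
  have hblk : ∀ j, Measurable[past B A X t] fun ω => block μ σ (fun u => B (min u t) ω)
      (min (epoch A j ω) t) (min (epoch A (j + 1) ω) t - min (epoch A j ω) t) := fun j =>
    measurable_block_comp μ σ (w := fun u ω => B (min u t) ω)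
      (fun u => measurable_past_brownian B A X (min_le_right _ _))
      (fun ω => (h.continuous_B ω).comp (by fun_prop)) (hE j) ((hE (j + 1)).sub (hE j))
  have hset : ((fun ω =>
      (fun j => X j ω, fun j => if j < k then cycleBlock μ σ B A j ω else 0)) ⁻¹' C ∩
      {ω | epoch A k ω < t}) = ((fun ω => (fun j => X j ω, fun j => if j < k then
        block μ σ (fun u => B (min u t) ω) (min (epoch A j ω) t)
          (min (epoch A (j + 1) ω) t - min (epoch A j ω) t) else 0)) ⁻¹' C ∩
      {ω | min (epoch A k ω) t < t}) := by
    ext ω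
    have h1 : min (epoch A k ω) t < t ↔ epoch A k ω < t := by simp
    simp only [Set.mem_inter_iff, Set.mem_preimage, Set.mem_ofPred_eq, h1]
    refine and_congr_left fun hlt => ?_
    have : ∀ j, (if j < k then cycleBlock μ σ B A j ω else 0) = if j < k then
        block μ σ (fun u => B (min u t) ω) (min (epoch A j ω) t)
          (min (epoch A (j + 1) ω) t - min (epoch A j ω) t) else 0 := by
      intro j
      split_ifs with hj
      · have h2 : epoch A (j + 1) ω ≤ t := (epoch_mono h ω hj).trans hlt.le
        have h3 : epoch A j ω ≤ epoch A (j + 1) ω := epoch_mono h ω (Nat.le_succ j)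
        rw [min_eq_left h2, min_eq_left (h3.trans h2), cycleBlock]
        refine block_congr μ σ fun u hu => ?_
        rw [add_tsub_cancel_of_le h3] at hu
        rw [min_eq_left (hu.trans h2)]
      · rfl
    rw [funext this]
  rw [hset]
  refine @MeasurableSet.inter _ (past B A X t) _ _ ?_ ?_
  · refine (Measurable.prodMk (measurable_past_chain B A X t)
      (@measurable_pi_lambda _ _ _ (past B A X t) _ _ fun j => ?_)) hC
    split_ifs
    · exact hblk j
    · exact measurable_const
  · exact hE k measurableSet_Iio

variable [Finite S]

lemma measure_history_inter_cycleBlock (k : ℕ) {C : Set ((ℕ → S) × (ℕ → S → ℝ × ℝ))}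
    (hC : MeasurableSet C) {C' : Set (S → ℝ × ℝ)} (hC' : MeasurableSet C') :
    P ((fun ω => (fun j => X j ω, fun j => if j < k then cycleBlock μ σ B A j ω else 0)) ⁻¹' C ∩
      cycleBlock μ σ B A k ⁻¹' C') =
    P ((fun ω => (fun j => X j ω, fun j => if j < k then cycleBlock μ σ B A j ω else 0)) ⁻¹' C) *
      P.map (arrivalBlock μ σ B A 0) C' := by
  rw [← strongMarkov_arrivalBlock h μ σ (measurable_epoch h.measurable_A (le_arrival_iff h) k)
    (measurable_history h μ σ k hC) (measurableSet_past_history h μ σ k hC) hC']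
  simp_rw [← cycleBlock_eq h]

lemma map_cycleBlock (k : ℕ) :
    P.map (cycleBlock μ σ B A k) = P.map (arrivalBlock μ σ B A 0) := by
  ext C' hC'
  have := measure_history_inter_cycleBlock h μ σ k MeasurableSet.univ hC'
  rwa [Set.preimage_univ, Set.univ_inter, measure_univ, one_mul,
    ← Measure.map_apply (measurable_cycleBlock h μ σ k) hC'] at this

lemma indepFun_cycleBlock_chain :
    IndepFun (fun ω j => cycleBlock μ σ B A j ω) (fun ω j => X j ω) P := by
  have mX : Measurable fun ω k => X k ω := measurable_pi_lambda _ fun k => h.measurable_X k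
  have mB : Measurable fun ω u => B u ω := measurable_pi_lambda _ fun u => h.measurable_B u
  have mA : Measurable fun ω u => A u ω := measurable_pi_lambda _ fun u => h.measurable_A u
  have hAX := h.indep_A_X
  have hBAX := h.indep_B_AX
  rw [IndepFun_iff] at hAX hBAX
  have leA : MeasurableSpace.comap (fun ω t => A t ω) inferInstance ≤
      MeasurableSpace.comap (fun ω => (fun t => A t ω, fun k => X k ω)) inferInstance :=
    (measurable_fst.comp (comap_measurable (fun ω => (fun t => A t ω, fun k => X k ω)))).comap_le
  have leX : MeasurableSpace.comap (fun ω k => X k ω) inferInstance ≤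
      MeasurableSpace.comap (fun ω => (fun t => A t ω, fun k => X k ω)) inferInstance :=
    (measurable_snd.comp (comap_measurable (fun ω => (fun t => A t ω, fun k => X k ω)))).comap_le
  -- Brownian motion and arrivals are jointly independent of the chain. The join of three and of two
  -- σ-algebras is used with repetitions, which `sup_idem` removes.
  have key := indep_sup_sup (P := P) mB.comap_le mA.comap_le mA.comap_le mX.comap_le mX.comap_le
    (fun s₁ s₂ s₃ s₄ s₅ h₁ h₂ h₃ h₄ h₅ => by
      have ha := MeasurableSet.inter h₂ h₃
      have hx := MeasurableSet.inter h₄ h₅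
      rw [Set.inter_assoc, hBAX _ _ h₁ (MeasurableSet.inter (leA _ ha) (leX _ hx)),
        hAX _ _ ha hx, hBAX _ _ h₁ (leA _ ha), mul_assoc])
  rw [sup_idem, sup_idem] at key
  have hBm : ∀ u, Measurable[MeasurableSpace.comap (fun ω t => B t ω) inferInstance ⊔
      MeasurableSpace.comap (fun ω t => A t ω) inferInstance] (B u) := fun u =>
    ((measurable_pi_apply u).comp (comap_measurable (fun ω t => B t ω))).mono le_sup_left le_rfl
  have hAm : ∀ u, Measurable[MeasurableSpace.comap (fun ω t => B t ω) inferInstance ⊔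
      MeasurableSpace.comap (fun ω t => A t ω) inferInstance] (A u) := fun u =>
    ((measurable_pi_apply u).comp (comap_measurable (fun ω t => A t ω))).mono le_sup_right le_rfl
  have he := measurable_epoch hAm (le_arrival_iff h)
  refine indep_of_indep_of_le_left key (Measurable.comap_le ?_)
  exact @measurable_pi_lambda _ _ _ (_ ⊔ _) _ _ fun j =>
    measurable_block_comp μ σ hBm h.continuous_B (he j) ((he (j + 1)).sub (he j))

/-- The blocks between arrivals and the chain form a cycle chain. -/
theorem isCycleChain_cycleBlock {p : S → ℝ} {K : Matrix S S ℝ} (hX : IsMarkovChain X p K P)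
    {om et : S → ℝ} (hom : ∀ i, 0 < om i) (het : ∀ i, 0 < et i) (hσ : ∀ i, 0 < σ i)
    (hsub : ∀ i, om i - et i = 2 * (μ i * (σ i ^ 2)⁻¹))
    (hmul : ∀ i, om i * et i = 2 * q * (σ i ^ 2)⁻¹) :
    IsCycleChain P X (cycleBlock μ σ B A) p K om et where
  chain := hX
  measurable_block := measurable_cycleBlock h μ σ
  nonneg k ω i := ⟨depth_nonneg (h.continuous_B ω) _ _, height_nonneg (h.continuous_B ω) _ _⟩
  law k i := by
    rw [← map_arrivalBlock_apply h μ σ i (hom i) (het i) (hσ i) (hsub i) (hmul i)]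
    have h1 := Measure.map_map (μ := P) (measurable_pi_apply i) (measurable_cycleBlock h μ σ k)
    have h2 := Measure.map_map (μ := P) (measurable_pi_apply i) (measurable_arrivalBlock h μ σ 0)
    rw [map_cycleBlock h] at h1
    exact h1.symm.trans h2
  indep_past k := by
    rw [IndepFun_iff]
    rintro - - ⟨C, hC, rfl⟩ ⟨C', hC', rfl⟩
    rw [measure_history_inter_cycleBlock h μ σ k hC hC', ← map_cycleBlock h μ σ k,
      Measure.map_apply (measurable_cycleBlock h μ σ k) hC']
  indep_chain := indepFun_cycleBlock_chain h μ σ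

end

end MMBM

/-! ### First crossings by a chain of cycles. -/

namespace MMBM

section Crossing

variable {S Ω : Type*} (X : ℕ → Ω → S) (ξ : ℕ → Ω → S → ℝ × ℝ)

/-- The level at the start of the `k`-th cycle. -/
def cycleLevel : ℕ → Ω → ℝ
  | 0, _ => 0
  | k + 1, ω => cycleLevel k ω - (ξ k ω (X k ω)).1 + (ξ k ω (X k ω)).2

/-- No descent before the `k`-th cycle goes below `-x`. -/
def NotCrossed (x : ℝ) (k : ℕ) (ω : Ω) : Prop :=
  ∀ j < k, (ξ j ω (X j ω)).1 ≤ cycleLevel X ξ j ω + x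

/-- The descent of the `k`-th cycle goes below `-x`. -/
def Crosses (x : ℝ) (k : ℕ) (ω : Ω) : Prop := cycleLevel X ξ k ω + x < (ξ k ω (X k ω)).1

/-- The first descent below `-x` happens before the `n`-th cycle and in phase `b`. -/
def hitSet (x : ℝ) (b : S) (n : ℕ) : Set Ω :=
  {ω | ∃ k < n, NotCrossed X ξ x k ω ∧ Crosses X ξ x k ω ∧ X k ω = b}

/-- The first descent below `-x` happens in phase `b`. -/
def phaseHit (x : ℝ) (b : S) : Set Ω :=
  {ω | ∃ k, NotCrossed X ξ x k ω ∧ Crosses X ξ x k ω ∧ X k ω = b}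

variable {X ξ}

lemma NotCrossed.mono {x : ℝ} {j k : ℕ} {ω : Ω} (h : NotCrossed X ξ x k ω) (hjk : j ≤ k) :
    NotCrossed X ξ x j ω := fun i hi => h i (hi.trans_le hjk)

lemma NotCrossed.mono_level {x y : ℝ} {k : ℕ} {ω : Ω} (h : NotCrossed X ξ x k ω) (hxy : x ≤ y) :
    NotCrossed X ξ y k ω := fun i hi => (h i hi).trans (by linarith)

lemma Crosses.not_notCrossed {x : ℝ} {j k : ℕ} {ω : Ω} (h : Crosses X ξ x j ω) (hjk : j < k) :
    ¬ NotCrossed X ξ x k ω := fun h' => absurd (h' j hjk) (not_le.2 h)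

lemma eq_of_crosses {x : ℝ} {j k : ℕ} {ω : Ω} (h1 : NotCrossed X ξ x j ω)
    (h2 : Crosses X ξ x j ω) (h1' : NotCrossed X ξ x k ω) (h2' : Crosses X ξ x k ω) : j = k := by
  rcases lt_trichotomy j k with h | h | h
  · exact absurd h1' (h2.not_notCrossed h)
  · exact h
  · exact absurd h1 (h2'.not_notCrossed h)

section Measurability

variable [Fintype S] [MeasurableSpace S] [MeasurableSingletonClass S] {m : MeasurableSpace Ω}

lemma measurable_selected {Z : Ω → S} {ζ : Ω → S → ℝ × ℝ} (hZ : Measurable Z)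
    (hζ : Measurable ζ) : Measurable fun ω => ζ ω (Z ω) := by
  have : Measurable fun p : (S → ℝ × ℝ) × S => p.1 p.2 :=
    measurable_from_prod_countable_left fun s => measurable_pi_apply s
  exact this.comp (hζ.prodMk hZ)

lemma measurable_cycleLevel {k : ℕ} (hX : ∀ j < k, Measurable (X j))
    (hξ : ∀ j < k, Measurable (ξ j)) : Measurable (cycleLevel X ξ k) := by
  induction k with
  | zero => exact measurable_const
  | succ k ih =>
    have h1 := measurable_selected (hX k (Nat.lt_succ_self k)) (hξ k (Nat.lt_succ_self k))
    exact ((ih (fun j hj => hX j (hj.trans (Nat.lt_succ_self k)))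
      (fun j hj => hξ j (hj.trans (Nat.lt_succ_self k)))).sub h1.fst).add h1.snd

lemma measurableSet_crosses {k : ℕ} (hX : ∀ j ≤ k, Measurable (X j))
    (hξ : ∀ j ≤ k, Measurable (ξ j)) (x : ℝ) : MeasurableSet {ω | Crosses X ξ x k ω} :=
  measurableSet_lt ((measurable_cycleLevel (fun j hj => hX j hj.le)
    (fun j hj => hξ j hj.le)).add measurable_const)
    (measurable_selected (hX k le_rfl) (hξ k le_rfl)).fst

lemma measurableSet_notCrossed {k : ℕ} (hX : ∀ j < k, Measurable (X j))
    (hξ : ∀ j < k, Measurable (ξ j)) (x : ℝ) : MeasurableSet {ω | NotCrossed X ξ x k ω} := by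
  have : {ω | NotCrossed X ξ x k ω} = ⋂ j ∈ Set.Iio k, {ω | Crosses X ξ x j ω}ᶜ := by
    ext ω
    simp [NotCrossed, Crosses]
  rw [this]
  exact MeasurableSet.biInter (Set.to_countable _) fun j hj =>
    (measurableSet_crosses (fun i hi => hX i (hi.trans_lt hj)) (fun i hi => hξ i (hi.trans_lt hj))
      x).compl

lemma measurableSet_hitSet {n : ℕ} (hX : ∀ j < n, Measurable (X j))
    (hξ : ∀ j < n, Measurable (ξ j)) (x : ℝ) (b : S) : MeasurableSet (hitSet X ξ x b n) := by
  have : hitSet X ξ x b n = ⋃ k ∈ Set.Iio n, {ω | NotCrossed X ξ x k ω} ∩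
      ({ω | Crosses X ξ x k ω} ∩ X k ⁻¹' {b}) := by
    ext ω
    simp only [hitSet, Set.mem_ofPred_eq, Set.mem_iUnion, Set.mem_inter_iff, Set.mem_preimage,
      Set.mem_singleton_iff, Set.mem_Iio, exists_prop]
  rw [this]
  refine MeasurableSet.biUnion (Set.to_countable _) fun k hk => ?_
  exact (measurableSet_notCrossed (fun j hj => hX j (lt_trans hj hk))
    (fun j hj => hξ j (lt_trans hj hk)) x).inter
    ((measurableSet_crosses (fun j hj => hX j (lt_of_le_of_lt hj hk))
      (fun j hj => hξ j (lt_of_le_of_lt hj hk)) x).inter (hX k hk (measurableSet_singleton b)))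

lemma phaseHit_eq_iUnion (x : ℝ) (b : S) : phaseHit X ξ x b = ⋃ n, hitSet X ξ x b n := by
  ext ω
  simp only [phaseHit, hitSet, Set.mem_iUnion, Set.mem_ofPred_eq]
  exact ⟨fun ⟨k, hk⟩ => ⟨k + 1, k, Nat.lt_succ_self k, hk⟩, fun ⟨_, k, _, hk⟩ => ⟨k, hk⟩⟩

lemma hitSet_mono (x : ℝ) (b : S) : Monotone (hitSet X ξ x b) :=
  fun _ _ hnm _ ⟨k, hk, hh⟩ => ⟨k, hk.trans_le hnm, hh⟩

variable (X ξ) in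
/-- The history of the chain up to `k` and of the first `l` blocks. -/
@[reducible]
def history (k l : ℕ) : MeasurableSpace Ω :=
  MeasurableSpace.comap (fun ω (j : Fin (k + 1)) => X j ω) inferInstance ⊔
    MeasurableSpace.comap (fun ω (j : Fin l) => ξ j ω) inferInstance

lemma measurable_history_chain {j k : ℕ} (hj : j ≤ k) (l : ℕ) :
    Measurable[history X ξ k l] (X j) := by
  have : Measurable[history X ξ k l] fun ω (j : Fin (k + 1)) => X j ω :=
    (comap_measurable _).mono le_sup_left le_rfl
  exact (measurable_pi_apply (⟨j, Nat.lt_succ_of_le hj⟩ : Fin (k + 1))).comp this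

lemma measurable_history_block {j l : ℕ} (hj : j < l) (k : ℕ) :
    Measurable[history X ξ k l] (ξ j) := by
  have : Measurable[history X ξ k l] fun ω (j : Fin l) => ξ j ω :=
    (comap_measurable _).mono le_sup_right le_rfl
  exact (measurable_pi_apply (⟨j, hj⟩ : Fin l)).comp this

lemma history_le_of {k l : ℕ} {m' : MeasurableSpace Ω} (hX : ∀ j ≤ k, Measurable[m'] (X j))
    (hξ : ∀ j < l, Measurable[m'] (ξ j)) : history X ξ k l ≤ m' :=
  sup_le (measurable_pi_lambda (fun ω (j : Fin (k + 1)) => X j ω)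
      fun j => hX j (Nat.le_of_lt_succ j.2)).comap_le
    (measurable_pi_lambda (fun ω (j : Fin l) => ξ j ω) fun j => hξ j j.2).comap_le

lemma history_mono {k k' l l' : ℕ} (hk : k ≤ k') (hl : l ≤ l') :
    history X ξ k l ≤ history X ξ k' l' :=
  history_le_of (fun _ hj => measurable_history_chain (hj.trans hk) l')
    (fun _ hj => measurable_history_block (hj.trans_le hl) k')

end Measurability

end Crossing

section CycleChain

variable {S Ω : Type*} [Fintype S] [MeasurableSpace S] [MeasurableSingletonClass S]
  {m0 : MeasurableSpace Ω} {P : Measure Ω} [IsProbabilityMeasure P] {X : ℕ → Ω → S}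
  {ξ : ℕ → Ω → S → ℝ × ℝ} {p : S → ℝ} {K : Matrix S S ℝ} {om et : S → ℝ}

variable (hc : IsCycleChain P X ξ p K om et)

include hc

lemma history_le (k l : ℕ) : history X ξ k l ≤ m0 :=
  history_le_of (fun j _ => hc.chain.measurable j) (fun j _ => hc.measurable_block j)

/-- The two indices of `history` follow the order of events within a cycle: at `(k, k)` the phase of
cycle `k` is known and its block is still fresh, at `(k, k + 1)` the block is known and the
transition is still to come. -/
lemma indep_history_block (k : ℕ) :
    Indep (history X ξ k k) (MeasurableSpace.comap (ξ k) inferInstance) P := by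
  refine indep_of_indep_of_le_left (hc.indep_past k) ?_
  set Z := fun ω => ((fun j => X j ω : ℕ → S),
    (fun j => if j < k then ξ j ω else 0 : ℕ → S → ℝ × ℝ))
  refine history_le_of (fun j _ => ?_) (fun j hj => ?_)
  · exact ((measurable_pi_apply j).comp measurable_fst).comp (comap_measurable Z)
  · have h1 : Measurable[MeasurableSpace.comap Z inferInstance]
        fun ω => if j < k then ξ j ω else 0 :=
      ((measurable_pi_apply j).comp measurable_snd).comp (comap_measurable Z)
    simpa only [if_pos hj] using h1

/-- Integration of a function of the history and of the next block. -/
lemma setLIntegral_history_block {E : Type*} [MeasurableSpace E] {k : ℕ} {F : Set Ω}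
    (hF : MeasurableSet[history X ξ k k] F) {s : Ω → E} (hs : Measurable[history X ξ k k] s) (a : S)
    {g : E × (ℝ × ℝ) → ℝ≥0∞} (hg : Measurable g) :
    ∫⁻ ω in F, g (s ω, ξ k ω a) ∂P =
      ∫⁻ ω in F, ∫⁻ z, g (s ω, z) ∂((expMeasure (om a)).prod (expMeasure (et a))) ∂P := by
  have hle := history_le hc k k
  have hFm := hle _ hF
  have hξa : Measurable fun ω => ξ k ω a := (measurable_pi_apply a).comp (hc.measurable_block k)
  have hu : Measurable[history X ξ k k] (F.indicator fun _ => (1 : ℝ≥0∞)) :=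
    measurable_const.indicator hF
  have hus : Measurable fun ω => ((F.indicator fun _ => (1 : ℝ≥0∞)) ω, s ω) :=
    (hu.prodMk hs).mono hle le_rfl
  have hind : IndepFun (fun ω => ((F.indicator fun _ => (1 : ℝ≥0∞)) ω, s ω)) (fun ω => ξ k ω a) P :=
    indep_of_indep_of_le_left (indep_of_indep_of_le_right (indep_history_block hc k)
      (((measurable_pi_apply a).comp (comap_measurable (ξ k))).comap_le))
      (hu.prodMk hs).comap_le
  have hprob : IsProbabilityMeasure (P.map fun ω => ξ k ω a) :=
    Measure.isProbabilityMeasure_map hξa.aemeasurable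
  rw [← hc.law k a]
  have hg' : Measurable fun y : (ℝ≥0∞ × E) × (ℝ × ℝ) => y.1.1 * g (y.1.2, y.2) := by fun_prop
  have hmap := (indepFun_iff_map_prod_eq_prod_map_map hus.aemeasurable hξa.aemeasurable).1 hind
  calc ∫⁻ ω in F, g (s ω, ξ k ω a) ∂P
      = ∫⁻ ω, (F.indicator fun _ => (1 : ℝ≥0∞)) ω * g (s ω, ξ k ω a) ∂P := by
        rw [← lintegral_indicator hFm]
        refine lintegral_congr fun ω => ?_
        by_cases hω : ω ∈ F <;> simp [hω]
    _ = ∫⁻ y, y.1.1 * g (y.1.2, y.2) ∂(P.map fun ω =>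
          (((F.indicator fun _ => (1 : ℝ≥0∞)) ω, s ω), ξ k ω a)) := by
        rw [lintegral_map hg' (hus.prodMk hξa)]
    _ = ∫⁻ ω, ∫⁻ z, (F.indicator fun _ => (1 : ℝ≥0∞)) ω * g (s ω, z)
        ∂(P.map fun ω => ξ k ω a) ∂P := by
        rw [hmap, lintegral_prod _ hg'.aemeasurable,
          lintegral_map (f := fun y : ℝ≥0∞ × E => ∫⁻ z, y.1 * g (y.2, z) ∂(P.map fun ω => ξ k ω a))
            hg'.lintegral_prod_right' hus]
    _ = _ := by
        rw [← lintegral_indicator hFm]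
        refine lintegral_congr fun ω => ?_
        by_cases hω : ω ∈ F <;> simp [hω]

/-- The Markov property of the chain, given the past of the blocks. -/
lemma measure_inter_chain_succ (k l : ℕ) (a c : S) {F : Set Ω}
    (hF : MeasurableSet[history X ξ k l] F) (hFa : F ⊆ {ω | X k ω = a}) :
    P (F ∩ {ω | X (k + 1) ω = c}) = ENNReal.ofReal (K a c) * P F := by
  have hX := hc.chain.measurable
  have mX : ∀ k c, MeasurableSet {ω | X k ω = c} := fun k c => hX k (measurableSet_singleton c)
  have mX' : ∀ k c, MeasurableSet[MeasurableSpace.comap (fun ω j => X j ω) inferInstance]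
      {ω | X k ω = c} := fun k c =>
    ((measurable_pi_apply k).comp (comap_measurable (fun ω j => X j ω))) (measurableSet_singleton c)
  have hZ : Measurable fun ω (j : Fin (k + 1)) => X j ω := measurable_pi_lambda _ fun j => hX j
  have hZX : Measurable[MeasurableSpace.comap (fun ω j => X j ω) inferInstance]
      fun ω (j : Fin (k + 1)) => X j ω :=
    @measurable_pi_lambda _ _ _ (MeasurableSpace.comap _ _) _ _ fun j =>
      (measurable_pi_apply j.1).comp (comap_measurable (fun ω j => X j ω))
  -- the chain alone
  have hchain : ∀ C : Set (Fin (k + 1) → S), MeasurableSet C →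
      P ((fun ω (j : Fin (k + 1)) => X j ω) ⁻¹' C ∩ ({ω | X k ω = a} ∩ {ω | X (k + 1) ω = c})) =
      ENNReal.ofReal (K a c) * P ((fun ω (j : Fin (k + 1)) => X j ω) ⁻¹' C ∩ {ω | X k ω = a}) := by
    intro C hC
    -- The trajectory up to `k` takes finitely many values, so it suffices to compare singletons.
    -- Those ending in `a` are covered by the product formula for the law of the chain, the others
    -- have mass zero on both sides.
    have hmeas : (P.restrict ({ω | X k ω = a} ∩ {ω | X (k + 1) ω = c})).map
        (fun ω (j : Fin (k + 1)) => X j ω) =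
        ENNReal.ofReal (K a c) • (P.restrict {ω | X k ω = a}).map
          (fun ω (j : Fin (k + 1)) => X j ω) := by
      refine Measure.ext_of_singleton fun z => ?_
      rw [Measure.smul_apply, smul_eq_mul, Measure.map_apply hZ (measurableSet_singleton z),
        Measure.map_apply hZ (measurableSet_singleton z),
        Measure.restrict_apply (hZ (measurableSet_singleton z)),
        Measure.restrict_apply (hZ (measurableSet_singleton z))]
      by_cases hz : z (Fin.last k) = a
      · let i : ℕ → S := fun j => if hj : j < k + 1 then z ⟨j, hj⟩ else c
        have hik : i k = a := by simp only [i]; rw [dif_pos (Nat.lt_succ_self k)]; exact hz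
        have hic : i (k + 1) = c := by simp [i]
        have e1 : (fun ω (j : Fin (k + 1)) => X j ω) ⁻¹' {z} ∩
            ({ω | X k ω = a} ∩ {ω | X (k + 1) ω = c}) = {ω | ∀ j ≤ k + 1, X j ω = i j} := by
          ext ω
          simp only [Set.mem_inter_iff, Set.mem_preimage, Set.mem_singleton_iff, Set.mem_ofPred_eq]
          constructor
          · rintro ⟨rfl, h2, h3⟩ j hj
            rcases Nat.lt_or_ge j (k + 1) with h4 | h4
            · simp only [i]
              rw [dif_pos h4]
            · obtain rfl : j = k + 1 := le_antisymm hj h4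
              rw [hic, h3]
          · intro hh
            refine ⟨?_, ?_, ?_⟩
            · funext j
              rw [hh j j.2.le]
              simp only [i]
              rw [dif_pos j.2]
            · rw [hh k (Nat.le_succ k), hik]
            · rw [hh (k + 1) le_rfl, hic]
        have e2 : (fun ω (j : Fin (k + 1)) => X j ω) ⁻¹' {z} ∩ {ω | X k ω = a} =
            {ω | ∀ j ≤ k, X j ω = i j} := by
          ext ω
          simp only [Set.mem_inter_iff, Set.mem_preimage, Set.mem_singleton_iff, Set.mem_ofPred_eq]
          constructor
          · rintro ⟨rfl, h2⟩ j hj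
            simp only [i]
            rw [dif_pos (Nat.lt_succ_of_le hj)]
          · intro hh
            refine ⟨?_, ?_⟩
            · funext j
              rw [hh j (Nat.le_of_lt_succ j.2)]
              simp only [i]
              rw [dif_pos j.2]
            · rw [hh k le_rfl, hik]
        have h1 := hc.chain.law (k + 1) i
        have h2 := hc.chain.law k i
        rw [Finset.prod_range_succ, ← mul_assoc, ← h2, hik, hic, mul_comm] at h1
        rw [e1, e2, ← ofReal_measureReal, ← ofReal_measureReal, h1,
          ENNReal.ofReal_mul' measureReal_nonneg]
      · have e1 : (fun ω (j : Fin (k + 1)) => X j ω) ⁻¹' {z} ∩ {ω | X k ω = a} = ∅ := by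
          ext ω
          simp only [Set.mem_inter_iff, Set.mem_preimage, Set.mem_singleton_iff, Set.mem_ofPred_eq,
            Set.mem_empty_iff_false, iff_false, not_and]
          rintro rfl
          exact hz
        rw [← Set.inter_assoc, e1]
        simp
    have := congrArg (fun ρ => ρ C) hmeas
    simp only [Measure.smul_apply, smul_eq_mul] at this
    rwa [Measure.map_apply hZ hC, Measure.map_apply hZ hC, Measure.restrict_apply (hZ hC),
      Measure.restrict_apply (hZ hC)] at this
  have hξX := hc.indep_chain
  rw [IndepFun_iff] at hξX
  have hpi : ∀ m : MeasurableSpace Ω, IsPiSystem {s | MeasurableSet[m] s} :=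
    fun m => @MeasurableSpace.isPiSystem_measurableSet Ω m
  have hgen : ∀ m : MeasurableSpace Ω, m = MeasurableSpace.generateFrom {s | MeasurableSet[m] s} :=
    fun m => (@MeasurableSpace.generateFrom_measurableSet Ω m).symm
  have huniv : ∀ m : MeasurableSpace Ω, Set.univ ∈ {s | MeasurableSet[m] s} :=
    fun m => @MeasurableSet.univ Ω m
  -- Block events are independent of the whole chain and factor out of both sides. Intersections of
  -- chain and block events form a π-system generating the history, so the identity extends to all
  -- of it.
  have hkey : ∀ U V, MeasurableSet[MeasurableSpace.comap (fun ω (j : Fin (k + 1)) => X j ω)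
      inferInstance] U → MeasurableSet[MeasurableSpace.comap (fun ω (j : Fin l) => ξ j ω)
      inferInstance] V → P (U ∩ V ∩ ({ω | X k ω = a} ∩ {ω | X (k + 1) ω = c})) =
      ENNReal.ofReal (K a c) * P (U ∩ V ∩ {ω | X k ω = a}) := by
    rintro - - ⟨C, hC, rfl⟩ ⟨C', hC', rfl⟩
    have hV : MeasurableSet[MeasurableSpace.comap (fun ω j => ξ j ω) inferInstance]
        ((fun ω (j : Fin l) => ξ j ω) ⁻¹' C') :=
      (@measurable_pi_lambda _ _ _ (MeasurableSpace.comap _ _) _ _ fun j : Fin l =>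
        (measurable_pi_apply j.1).comp (comap_measurable (fun ω j => ξ j ω)) :
        Measurable[MeasurableSpace.comap (fun ω j => ξ j ω) inferInstance]
        fun ω (j : Fin l) => ξ j ω) hC'
    rw [Set.inter_comm ((fun ω (j : Fin (k + 1)) => X j ω) ⁻¹' C), Set.inter_assoc, Set.inter_assoc,
      hξX _ _ hV (MeasurableSet.inter (hZX hC) (MeasurableSet.inter (mX' k a) (mX' (k + 1) c))),
      hξX _ _ hV (MeasurableSet.inter (hZX hC) (mX' k a)), hchain C hC]
    ring
  have hext : (P.restrict ({ω | X k ω = a} ∩ {ω | X (k + 1) ω = c})) F =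
      (ENNReal.ofReal (K a c) • P.restrict {ω | X k ω = a}) F := by
    refine ext_on_measurableSpace_of_generate_finite m0
      (Set.image2 (· ∩ ·) {s | MeasurableSet[MeasurableSpace.comap
          (fun ω (j : Fin (k + 1)) => X j ω) inferInstance] s}
        {s | MeasurableSet[MeasurableSpace.comap (fun ω (j : Fin l) => ξ j ω) inferInstance] s})
      ?_ (history_le hc k l) ?_ (isPiSystem_image2_inter (hpi _) (hpi _)) ?_ hF
    · rintro - ⟨U, hU, V, hV, rfl⟩
      have hUV : MeasurableSet (U ∩ V) := history_le hc k l _ (MeasurableSet.inter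
        ((le_sup_left : _ ≤ history X ξ k l) _ hU) ((le_sup_right : _ ≤ history X ξ k l) _ hV))
      rw [Measure.smul_apply, smul_eq_mul, Measure.restrict_apply hUV, Measure.restrict_apply hUV]
      exact hkey U V hU hV
    · rw [generateFrom_image2_inter (huniv _) (huniv _), ← hgen, ← hgen]
    · have := hkey Set.univ Set.univ (@MeasurableSet.univ _ (MeasurableSpace.comap _ _))
        (@MeasurableSet.univ _ (MeasurableSpace.comap _ _))
      simpa using this
  rw [Measure.smul_apply, smul_eq_mul, Measure.restrict_apply (history_le hc k l _ hF),
    Measure.restrict_apply (history_le hc k l _ hF), Set.inter_eq_left.2 hFa, ← Set.inter_assoc,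
    Set.inter_eq_left.2 hFa] at hext
  exact hext

/-- The identity for events says that two measures agree after restriction to the history, hence
they integrate its measurable functions alike. -/
lemma setLIntegral_inter_chain_succ (k l : ℕ) (a c : S) {F : Set Ω}
    (hF : MeasurableSet[history X ξ k l] F) (hFa : F ⊆ {ω | X k ω = a}) {g : Ω → ℝ≥0∞}
    (hg : Measurable[history X ξ k l] g) :
    ∫⁻ ω in F ∩ {ω | X (k + 1) ω = c}, g ω ∂P = ENNReal.ofReal (K a c) * ∫⁻ ω in F, g ω ∂P := by
  have hle := history_le hc k l
  have htrim : (P.restrict (F ∩ {ω | X (k + 1) ω = c})).trim hle =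
      (ENNReal.ofReal (K a c) • P.restrict F).trim hle := by
    refine @Measure.ext _ (history X ξ k l) _ _ fun s hs => ?_
    rw [trim_measurableSet_eq hle hs, trim_measurableSet_eq hle hs, Measure.smul_apply, smul_eq_mul,
      Measure.restrict_apply (hle _ hs), Measure.restrict_apply (hle _ hs), ← Set.inter_assoc]
    exact measure_inter_chain_succ hc k l a c (MeasurableSet.inter hs hF)
      (Set.inter_subset_right.trans hFa)
  rw [← lintegral_trim hle hg, htrim, lintegral_trim hle hg, lintegral_smul_measure, smul_eq_mul]

end CycleChain

end MMBM

/-! ### The crossing recursion for a cycle chain. -/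

namespace MMBM

section CycleChain

variable {S Ω : Type*} [Fintype S] [DecidableEq S] [MeasurableSpace S] [MeasurableSingletonClass S]
  {m0 : MeasurableSpace Ω} {P : Measure Ω} [IsProbabilityMeasure P] {X : ℕ → Ω → S}
  {ξ : ℕ → Ω → S → ℝ × ℝ} {p : S → ℝ} {K : Matrix S S ℝ} {om et : S → ℝ}

variable (hc : IsCycleChain P X ξ p K om et) (hom : ∀ i, 0 < om i) (het : ∀ i, 0 < et i)

include hc hom het

/-- One cycle of the crossing recursion. -/
lemma measure_crossing_restart (r : ℕ) (x : ℝ) (b : S)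
    (ih : ∀ (k : ℕ) (a : S) (F : Set Ω), MeasurableSet[history X ξ k k] F →
      F ⊆ {ω | X k ω = a} → (∀ ω ∈ F, NotCrossed X ξ x k ω) →
      P (F ∩ hitSet X ξ x b (k + r)) =
        ∫⁻ ω in F, crossProb om et K r (cycleLevel X ξ k ω + x) a b ∂P)
    (k : ℕ) (a : S) {F : Set Ω} (hF : MeasurableSet[history X ξ k k] F)
    (hFa : F ⊆ {ω | X k ω = a}) (hFx : ∀ ω ∈ F, NotCrossed X ξ x k ω) {v : Ω → ℝ}
    (hv : Measurable[history X ξ k k] v) :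
    P (F ∩ {ω | v ω < (ξ k ω a).1} ∩ hitSet X ξ x b (k + 1 + r)) =
      ∫⁻ ω in F, ∫⁻ l in Set.Ioi (v ω), (if cycleLevel X ξ k ω + x < l
        then (1 : Matrix S S ℝ≥0∞) a b
        else ascend et K (crossProb om et K r) (cycleLevel X ξ k ω + x - l) a b)
        ∂expMeasure (om a) ∂P := by
  have hprobo := isProbabilityMeasure_expMeasure (hom a)
  have hprobe := isProbabilityMeasure_expMeasure (het a)
  have hle := history_le hc k k
  have hcm := fun c => measurable_crossProb (K := K) hom het r c b
  have hlev : Measurable[history X ξ k k] (cycleLevel X ξ k) :=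
    measurable_cycleLevel (fun j hj => measurable_history_chain hj.le k)
      (fun j hj => measurable_history_block hj k)
  have hlev' : Measurable[history X ξ k (k + 1)] (cycleLevel X ξ k) :=
    hlev.mono (history_mono le_rfl (Nat.le_succ k)) le_rfl
  have hξa : Measurable fun ω => ξ k ω a := (measurable_pi_apply a).comp (hc.measurable_block k)
  have hξa' : Measurable[history X ξ k (k + 1)] fun ω => ξ k ω a :=
    (measurable_pi_apply a).comp (measurable_history_block (Nat.lt_succ_self k) k)
  -- `Φ` is the value of the cycle given the pair (threshold `v`, height above `-x`) and the block
  -- (descent, ascent). The threshold serves two purposes: a negative one imposes nothing, while the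
  -- height above an upper level restricts to cycles that cross that level.
  set Φ : (ℝ × ℝ) × (ℝ × ℝ) → ℝ≥0∞ := fun y => if y.1.1 < y.2.1 then
    (if y.1.2 < y.2.1 then (1 : Matrix S S ℝ≥0∞) a b else
      ∑ c, ENNReal.ofReal (K a c) * crossProb om et K r (y.1.2 - y.2.1 + y.2.2) c b) else 0 with hΦ
  have hsum : Measurable fun y : (ℝ × ℝ) × (ℝ × ℝ) =>
      ∑ c, ENNReal.ofReal (K a c) * crossProb om et K r (y.1.2 - y.2.1 + y.2.2) c b :=
    Finset.measurable_sum _ fun c _ => measurable_const.mul ((hcm c).comp (by fun_prop))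
  have hΦm : Measurable Φ :=
    Measurable.ite (measurableSet_lt (by fun_prop) (by fun_prop))
      (Measurable.ite (measurableSet_lt (by fun_prop) (by fun_prop)) measurable_const hsum)
      measurable_const
  have hs : Measurable[history X ξ k k] fun ω => (v ω, cycleLevel X ξ k ω + x) :=
    hv.prodMk (hlev.add_const x)
  -- the right-hand side
  have hright : ∫⁻ ω in F, ∫⁻ l in Set.Ioi (v ω), (if cycleLevel X ξ k ω + x < l
        then (1 : Matrix S S ℝ≥0∞) a b
        else ascend et K (crossProb om et K r) (cycleLevel X ξ k ω + x - l) a b)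
        ∂expMeasure (om a) ∂P = ∫⁻ ω in F, Φ ((v ω, cycleLevel X ξ k ω + x), ξ k ω a) ∂P := by
    rw [setLIntegral_history_block hc hF hs a hΦm]
    refine lintegral_congr fun ω => ?_
    have hp : Measurable fun z => Φ ((v ω, cycleLevel X ξ k ω + x), z) :=
      hΦm.comp measurable_prodMk_left
    rw [lintegral_prod _ hp.aemeasurable, ← lintegral_indicator measurableSet_Ioi]
    refine lintegral_congr fun l => ?_
    by_cases h1 : v ω < l
    · rw [Set.indicator_of_mem (Set.mem_Ioi.2 h1)]
      simp only [hΦ, h1, if_true]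
      by_cases h2 : cycleLevel X ξ k ω + x < l
      · simp [h2]
      · simp only [h2, if_false]
        rfl
    · rw [Set.indicator_of_notMem (by simpa using h1)]
      simp [hΦ, h1]
  rw [hright]
  -- the two parts of the event
  have hFm' : MeasurableSet[history X ξ k (k + 1)] F :=
    history_mono le_rfl (Nat.le_succ k) _ hF
  have hD1 : MeasurableSet[history X ξ k (k + 1)] {ω | v ω < (ξ k ω a).1} :=
    ((hv.mono (history_mono le_rfl (Nat.le_succ k)) le_rfl).prodMk hξa'.fst)
      (measurableSet_lt measurable_fst measurable_snd)
  have hD2 : MeasurableSet[history X ξ k (k + 1)]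
      {ω | cycleLevel X ξ k ω + x < (ξ k ω a).1} :=
    ((hlev'.add_const x).prodMk hξa'.fst) (measurableSet_lt measurable_fst measurable_snd)
  set G := F ∩ {ω | v ω < (ξ k ω a).1} with hG
  set D := {ω | cycleLevel X ξ k ω + x < (ξ k ω a).1} with hD
  have hGm : MeasurableSet[history X ξ k (k + 1)] G := MeasurableSet.inter hFm' hD1
  have hG2 : MeasurableSet[history X ξ k (k + 1)] (G \ D) := MeasurableSet.diff hGm hD2
  have hle' := history_le hc k (k + 1)
  have hsplit : ∫⁻ ω in F, Φ ((v ω, cycleLevel X ξ k ω + x), ξ k ω a) ∂P =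
      (∫⁻ _ω in G ∩ D, (1 : Matrix S S ℝ≥0∞) a b ∂P) + ∫⁻ ω in G \ D, ∑ c, ENNReal.ofReal (K a c) *
        crossProb om et K r (cycleLevel X ξ k ω + x - (ξ k ω a).1 + (ξ k ω a).2) c b ∂P := by
    rw [← lintegral_indicator (hle' _ hFm'),
      ← lintegral_indicator ((hle' _ hGm).inter (hle' _ hD2)),
      ← lintegral_indicator (hle' _ hG2), ← lintegral_add_left
        (measurable_const.indicator ((hle' _ hGm).inter (hle' _ hD2)))]
    refine lintegral_congr fun ω => ?_
    by_cases h0 : ω ∈ F <;> by_cases h1 : v ω < (ξ k ω a).1 <;>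
      by_cases h2 : cycleLevel X ξ k ω + x < (ξ k ω a).1 <;>
      simp [hΦ, hG, hD, h0, h1, h2]
  -- Two cases. If the current descent crosses, it is the first crossing and its phase is `a`;
  -- otherwise the crossing is left to later cycles.
  rw [hsplit, ← measure_inter_add_sdiff (G ∩ hitSet X ξ x b (k + 1 + r)) (hle' _ hD2)]
  congr 1
  · rw [setLIntegral_const]
    by_cases hab : a = b
    · have : G ∩ hitSet X ξ x b (k + 1 + r) ∩ D = G ∩ D := by
        ext ω
        constructor
        · rintro ⟨⟨h1, -⟩, h2⟩; exact ⟨h1, h2⟩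
        · rintro ⟨h1, h2⟩
          have hXk : X k ω = a := hFa h1.1
          refine ⟨⟨h1, k, by omega, hFx ω h1.1, ?_, hXk.trans hab⟩, h2⟩
          rw [Crosses, hXk]
          exact h2
      rw [this, hab, Matrix.one_apply_eq, one_mul]
    · have : G ∩ hitSet X ξ x b (k + 1 + r) ∩ D = ∅ := by
        ext ω
        simp only [Set.mem_empty_iff_false, iff_false]
        rintro ⟨⟨h1, j, -, hj1, hj2, hjb⟩, h2⟩
        have hXk : X k ω = a := hFa h1.1
        have hkc : Crosses X ξ x k ω := by
          rw [Crosses, hXk]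
          exact h2
        have := eq_of_crosses (hFx ω h1.1) hkc hj1 hj2
        subst this
        exact hab (hXk.symm.trans hjb)
      rw [this, Matrix.one_apply_ne hab]
      simp
  · have hset : (G ∩ hitSet X ξ x b (k + 1 + r)) \ D = (G \ D) ∩ hitSet X ξ x b (k + 1 + r) := by
      ext ω; simp only [Set.mem_sdiff, Set.mem_inter_iff]; tauto
    rw [hset]
    -- The remaining part is split by the next phase `c`. The induction hypothesis applies from
    -- cycle `k + 1`, and the transition probability `K a c` is then extracted by the Markov
    -- property of the chain.
    have hpart : P ((G \ D) ∩ hitSet X ξ x b (k + 1 + r)) =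
        ∑ c, P ((G \ D) ∩ {ω | X (k + 1) ω = c} ∩ hitSet X ξ x b (k + 1 + r)) := by
      have h1 := sum_measure_preimage_singleton
        (μ := P.restrict ((G \ D) ∩ hitSet X ξ x b (k + 1 + r)))
        (f := X (k + 1)) Finset.univ (fun c _ => hc.chain.measurable _ (measurableSet_singleton c))
      rw [Finset.coe_univ, Set.preimage_univ, Measure.restrict_apply_univ] at h1
      rw [← h1]
      refine Finset.sum_congr rfl fun c _ => ?_
      rw [Measure.restrict_apply (hc.chain.measurable _ (measurableSet_singleton c))]
      congr 1
      ext ω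
      simp only [Set.mem_inter_iff, Set.mem_preimage, Set.mem_singleton_iff, Set.mem_ofPred_eq]
      tauto
    have hgm : ∀ c, Measurable[history X ξ k (k + 1)] fun ω =>
        crossProb om et K r (cycleLevel X ξ k ω + x - (ξ k ω a).1 + (ξ k ω a).2) c b := fun c =>
      (hcm c).comp (((hlev'.add_const x).sub hξa'.fst).add hξa'.snd)
    rw [hpart, lintegral_finsetSum _ fun c _ =>
      ((hgm c).mono hle' le_rfl).const_mul (ENNReal.ofReal (K a c))]
    refine Finset.sum_congr rfl fun c _ => ?_
    rw [lintegral_const_mul _ ((hgm c).mono hle' le_rfl),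
      ← setLIntegral_inter_chain_succ hc k (k + 1) a c hG2
        (fun ω hω => hFa hω.1.1) (hgm c)]
    have hF' : MeasurableSet[history X ξ (k + 1) (k + 1)] ((G \ D) ∩ {ω | X (k + 1) ω = c}) :=
      MeasurableSet.inter (history_mono (Nat.le_succ k) le_rfl _ hG2)
        (measurable_history_chain le_rfl (k + 1) (measurableSet_singleton c))
    rw [ih (k + 1) c _ hF' Set.inter_subset_right ?_]
    · refine setLIntegral_congr_fun (history_le hc _ _ _ hF') fun ω hω => ?_
      have hXk : X k ω = a := hFa hω.1.1.1
      simp only [cycleLevel, hXk]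
      congr 1
      ring
    · rintro ω ⟨⟨h1, h2⟩, -⟩ j hj
      rcases Nat.lt_succ_iff_lt_or_eq.1 hj with h3 | rfl
      · exact hFx ω h1.1 j h3
      · have hXk : X j ω = a := hFa h1.1
        rw [hXk]
        exact not_lt.1 h2

/-- The probability of crossing the level `-x` within `r` cycles. -/
lemma measure_crossing (r : ℕ) (x : ℝ) (b : S) (k : ℕ) (a : S) {F : Set Ω}
    (hF : MeasurableSet[history X ξ k k] F) (hFa : F ⊆ {ω | X k ω = a})
    (hFx : ∀ ω ∈ F, NotCrossed X ξ x k ω) :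
    P (F ∩ hitSet X ξ x b (k + r)) =
      ∫⁻ ω in F, crossProb om et K r (cycleLevel X ξ k ω + x) a b ∂P := by
  induction r generalizing k a F with
  | zero =>
    have : F ∩ hitSet X ξ x b (k + 0) = ∅ := by
      ext ω
      simp only [Set.mem_empty_iff_false, iff_false]
      rintro ⟨h1, j, hj, -, h2, -⟩
      exact h2.not_notCrossed hj (hFx ω h1)
    rw [this]
    simp [crossProb]
  | succ r ih =>
    -- Depths are nonnegative, so the threshold `-1` leaves the event unrestricted.
    have hstep := measure_crossing_restart hc hom het r x b (fun k a F => ih k a) k a hF hFa hFx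
      (v := fun _ => -1) measurable_const
    have h1 : F ∩ {ω | -1 < (ξ k ω a).1} = F := by
      refine Set.inter_eq_left.2 fun ω _ => ?_
      have := (hc.nonneg k ω a).1
      simp only [Set.mem_ofPred_eq]
      linarith
    rw [h1, add_assoc, add_comm 1 r] at hstep
    rw [hstep]
    refine lintegral_congr fun ω => ?_
    have h2 : (Set.Ioi (-1 : ℝ)) =ᵐ[expMeasure (om a)] Set.univ := by
      filter_upwards [ae_pos_expMeasure (om a)] with l hl
      have : l ∈ Set.Ioi (-1 : ℝ) := by
        simp only [Set.mem_Ioi]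
        linarith
      exact propext (iff_of_true this trivial)
    rw [setLIntegral_congr h2, setLIntegral_univ]
    rfl

lemma cycleLevel_add_nonneg {x : ℝ} (hx : 0 ≤ x) {k : ℕ} {ω : Ω} (h : NotCrossed X ξ x k ω) :
    0 ≤ cycleLevel X ξ k ω + x := by
  cases k with
  | zero => simpa [cycleLevel] using hx
  | succ k =>
    have h1 := h k (Nat.lt_succ_self k)
    have h2 := (hc.nonneg k ω (X k ω)).2
    rw [cycleLevel]
    linarith

/-- The Markov property at the first crossing of `-x`, for finitely many cycles. -/
lemma measure_crossing_add_of_le (r : ℕ) {x z : ℝ} (hx : 0 ≤ x) (hz : 0 ≤ z) (b : S) (k : ℕ) (a : S)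
    {F : Set Ω} (hF : MeasurableSet[history X ξ k k] F) (hFa : F ⊆ {ω | X k ω = a})
    (hFx : ∀ ω ∈ F, NotCrossed X ξ x k ω) :
    P (F ∩ {ω | Crosses X ξ x k ω} ∩ hitSet X ξ (x + z) b (k + 1 + r)) =
      P (F ∩ {ω | Crosses X ξ x k ω}) * crossProb om et K (r + 1) z a b := by
  have hlev : Measurable[history X ξ k k] (cycleLevel X ξ k) :=
    measurable_cycleLevel (fun j hj => measurable_history_chain hj.le k)
      (fun j hj => measurable_history_block hj k)
  have hv : Measurable[history X ξ k k] fun ω => cycleLevel X ξ k ω + x := hlev.add_const x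
  have hset : F ∩ {ω | Crosses X ξ x k ω} = F ∩ {ω | cycleLevel X ξ k ω + x < (ξ k ω a).1} := by
    ext ω
    simp only [Set.mem_inter_iff, Set.mem_ofPred_eq]
    refine and_congr_right fun hω => ?_
    have hXk : X k ω = a := hFa hω
    rw [Crosses, hXk]
  -- Given the history, the descent crosses when an exponential variable exceeds the nonnegative
  -- height `cycleLevel + x`.
  have hmeas : P (F ∩ {ω | Crosses X ξ x k ω}) =
      ∫⁻ ω in F, ENNReal.ofReal (Real.exp (-(om a * (cycleLevel X ξ k ω + x)))) ∂P := by
    have hprobe := isProbabilityMeasure_expMeasure (het a)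
    have hΦ : Measurable fun y : ℝ × (ℝ × ℝ) => if y.1 < y.2.1 then (1 : ℝ≥0∞) else 0 :=
      Measurable.ite (measurableSet_lt (by fun_prop) (by fun_prop)) measurable_const
        measurable_const
    have h1 := setLIntegral_history_block hc hF hv a hΦ
    have hξa : Measurable fun ω => ξ k ω a := (measurable_pi_apply a).comp (hc.measurable_block k)
    have hm : MeasurableSet {ω | cycleLevel X ξ k ω + x < (ξ k ω a).1} :=
      measurableSet_lt (hv.mono (history_le hc k k) le_rfl) hξa.fst
    have h2 : ∫⁻ ω in F, (if cycleLevel X ξ k ω + x < (ξ k ω a).1 then (1 : ℝ≥0∞) else 0) ∂P =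
        P (F ∩ {ω | cycleLevel X ξ k ω + x < (ξ k ω a).1}) := by
      rw [Set.inter_comm, ← Measure.restrict_apply hm, ← lintegral_indicator_one hm]
      refine lintegral_congr fun ω => ?_
      simp [Set.indicator_apply]
    rw [hset, ← h2, h1]
    refine setLIntegral_congr_fun (history_le hc _ _ _ hF) fun ω hω => ?_
    have h0 := cycleLevel_add_nonneg hc hom het hx (hFx ω hω)
    simp only
    have hp : Measurable fun z : ℝ × ℝ =>
        if cycleLevel X ξ k ω + x < z.1 then (1 : ℝ≥0∞) else 0 := hΦ.comp measurable_prodMk_left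
    rw [← expMeasure_Ioi (hom a) h0, lintegral_prod _ hp.aemeasurable,
      ← lintegral_indicator_one measurableSet_Ioi]
    refine lintegral_congr fun l => ?_
    simp only [Set.indicator_apply, Set.mem_Ioi, Pi.one_apply]
    by_cases hl : cycleLevel X ξ k ω + x < l
    · simp only [hl, if_true, lintegral_one, measure_univ]
    · simp only [hl, if_false, lintegral_zero]
  rw [hset] at hmeas
  rw [hset, measure_crossing_restart hc hom het r (x + z) b
    (fun k a F hF hFa hFx => measure_crossing hc hom het r (x + z) b k a hF hFa hFx)
    k a hF hFa (fun ω hω => (hFx ω hω).mono_level (by linarith)) hv, hmeas,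
    ← lintegral_mul_const _ (by
      have := (hv.mono (history_le hc k k) le_rfl : Measurable fun ω => cycleLevel X ξ k ω + x)
      fun_prop)]
  refine setLIntegral_congr_fun (history_le hc _ _ _ hF) fun ω hω => ?_
  have h0 := cycleLevel_add_nonneg hc hom het hx (hFx ω hω)
  have hm := (measurable_ascend (K := K) (measurable_crossProb (K := K) hom het r) het a b)
  have hg : Measurable fun l => if cycleLevel X ξ k ω + (x + z) < l
        then (1 : Matrix S S ℝ≥0∞) a b
        else ascend et K (crossProb om et K r) (cycleLevel X ξ k ω + (x + z) - l) a b :=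
    Measurable.ite (measurableSet_lt measurable_const measurable_id) measurable_const
      (hm.comp (measurable_const.sub measurable_id))
  -- By memorylessness the part of the descent below `-x` is a fresh exponential descent in the same
  -- phase `a`, with distance `z` still to go. The factor extracted is the probability of having
  -- crossed `-x`.
  rw [setLIntegral_Ioi_expMeasure h0 hg, crossProb]
  congr 1
  refine lintegral_congr fun l => ?_
  have e1 : cycleLevel X ξ k ω + (x + z) < cycleLevel X ξ k ω + x + l ↔ z < l := by
    constructor <;> intro hh <;> linarith
  have e2 : cycleLevel X ξ k ω + (x + z) - (cycleLevel X ξ k ω + x + l) = z - l := by ring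
  simp only [e1, e2]

/-- The Markov property at the first crossing of `-x`. -/
lemma measure_crossing_add {x z : ℝ} (hx : 0 ≤ x) (hz : 0 ≤ z) (b : S) (k : ℕ) (a : S)
    {F : Set Ω} (hF : MeasurableSet[history X ξ k k] F) (hFa : F ⊆ {ω | X k ω = a})
    (hFx : ∀ ω ∈ F, NotCrossed X ξ x k ω) :
    P (F ∩ {ω | Crosses X ξ x k ω} ∩ phaseHit X ξ (x + z) b) =
      P (F ∩ {ω | Crosses X ξ x k ω}) * crossLim om et K z a b := by
  have h1 : Tendsto (fun r => P (F ∩ {ω | Crosses X ξ x k ω} ∩ hitSet X ξ (x + z) b (k + 1 + r)))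
      atTop (𝓝 (P (F ∩ {ω | Crosses X ξ x k ω} ∩ phaseHit X ξ (x + z) b))) := by
    have hmono : Monotone fun r =>
        F ∩ {ω | Crosses X ξ x k ω} ∩ hitSet X ξ (x + z) b (k + 1 + r) := fun r r' hrr =>
      Set.inter_subset_inter_right _ (hitSet_mono _ _ (by omega))
    have h2 := tendsto_measure_iUnion_atTop (μ := P) hmono
    have h3 : ⋃ r, F ∩ {ω | Crosses X ξ x k ω} ∩ hitSet X ξ (x + z) b (k + 1 + r) =
        F ∩ {ω | Crosses X ξ x k ω} ∩ phaseHit X ξ (x + z) b := by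
      rw [← Set.inter_iUnion, phaseHit_eq_iUnion]
      congr 1
      refine subset_antisymm (Set.iUnion_subset fun r => Set.subset_iUnion _ _)
        (Set.iUnion_subset fun n => ?_)
      exact (hitSet_mono _ _ (by omega : n ≤ k + 1 + n)).trans
        (Set.subset_iUnion (fun r => hitSet X ξ (x + z) b (k + 1 + r)) n)
    rwa [h3] at h2
  refine tendsto_nhds_unique h1 ?_
  simp_rw [measure_crossing_add_of_le hc hom het _ hx hz b k a hF hFa hFx]
  refine ENNReal.Tendsto.const_mul ?_ (Or.inr (measure_ne_top _ _))
  exact (tendsto_crossProb z a b).comp (tendsto_add_atTop_nat 1)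

end CycleChain

end MMBM

/-! ### Finite-dimensional laws of the phase at first crossings. -/

namespace MMBM

section CycleChain

variable {S Ω : Type*} [Fintype S] [DecidableEq S] [MeasurableSpace S] [MeasurableSingletonClass S]
  {m0 : MeasurableSpace Ω} {P : Measure Ω} [IsProbabilityMeasure P] {X : ℕ → Ω → S}
  {ξ : ℕ → Ω → S → ℝ × ℝ} {p : S → ℝ} {K : Matrix S S ℝ} {om et : S → ℝ}

variable (hc : IsCycleChain P X ξ p K om et) (hom : ∀ i, 0 < om i) (het : ∀ i, 0 < et i)

include hc hom het

/-- The Markov property of the phase at the first crossings of a sequence of levels. -/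
lemma measure_phaseHit_succ (m : ℕ) {x : ℕ → ℝ} (hx : ∀ k, 0 ≤ x k) (hmono : Monotone x)
    (i : ℕ → S) :
    P {ω | ∀ j ≤ m + 1, ω ∈ phaseHit X ξ (x j) (i j)} =
      P {ω | ∀ j ≤ m, ω ∈ phaseHit X ξ (x j) (i j)} *
        crossLim om et K (x (m + 1) - x m) (i m) (i (m + 1)) := by
  -- `F k` holds what is known before the `k`-th descent if this descent is to be the first below
  -- `-x_m`: every earlier level has either been crossed already in its prescribed phase, or is
  -- still uncrossed and will be crossed by the same descent, in which case its prescribed phase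
  -- must be that of cycle `k`.
  set F : ℕ → Set Ω := fun k => {ω | X k ω = i m ∧ NotCrossed X ξ (x m) k ω ∧
    ∀ j ≤ m, ω ∈ hitSet X ξ (x j) (i j) k ∨ (NotCrossed X ξ (x j) k ω ∧ X k ω = i j)} with hF
  have hFm : ∀ k, MeasurableSet[history X ξ k k] (F k) := by
    intro k
    have hX : ∀ j ≤ k, Measurable[history X ξ k k] (X j) := fun j hj =>
      measurable_history_chain hj k
    have hξ : ∀ j < k, Measurable[history X ξ k k] (ξ j) := fun j hj =>
      measurable_history_block hj k
    have hset : F k = X k ⁻¹' {i m} ∩ ({ω | NotCrossed X ξ (x m) k ω} ∩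
        ⋂ j ∈ Set.Iic m, (hitSet X ξ (x j) (i j) k ∪
          ({ω | NotCrossed X ξ (x j) k ω} ∩ X k ⁻¹' {i j}))) := by
      ext ω
      simp only [hF, Set.mem_ofPred_eq, Set.mem_inter_iff, Set.mem_preimage, Set.mem_singleton_iff,
        Set.mem_iInter, Set.mem_Iic, Set.mem_union]
    have hnc : ∀ y, MeasurableSet[history X ξ k k] {ω | NotCrossed X ξ y k ω} := fun y =>
      measurableSet_notCrossed (fun j hj => hX j hj.le) hξ y
    rw [hset]
    refine MeasurableSet.inter (hX k le_rfl (measurableSet_singleton _))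
      (MeasurableSet.inter (hnc _) (MeasurableSet.biInter (Set.to_countable _) fun j _ => ?_))
    exact MeasurableSet.union (measurableSet_hitSet (fun j hj => hX j hj.le) hξ _ _)
      (MeasurableSet.inter (hnc _) (hX k le_rfl (measurableSet_singleton _)))
  have hG : {ω | ∀ j ≤ m, ω ∈ phaseHit X ξ (x j) (i j)} =
      ⋃ k, F k ∩ {ω | Crosses X ξ (x m) k ω} := by
    ext ω
    simp only [Set.mem_ofPred_eq, Set.mem_iUnion, Set.mem_inter_iff, hF]
    constructor
    · intro hh
      obtain ⟨k, hk1, hk2, hk3⟩ := hh m le_rfl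
      refine ⟨k, ⟨hk3, hk1, fun j hj => ?_⟩, hk2⟩
      obtain ⟨k', h1, h2, h3⟩ := hh j hj
      rcases lt_trichotomy k' k with h4 | h4 | h4
      · exact Or.inl ⟨k', h4, h1, h2, h3⟩
      · exact Or.inr ⟨h4 ▸ h1, h4 ▸ h3⟩
      · exact absurd ((h1.mono_level (hmono hj)).mono h4) (hk2.not_notCrossed (Nat.lt_succ_self k))
    · rintro ⟨k, ⟨h1, h2, h3⟩, h4⟩ j hj
      rcases h3 j hj with ⟨k', -, h5⟩ | ⟨h5, h6⟩
      · exact ⟨k', h5⟩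
      · refine ⟨k, h5, ?_, h6⟩
        have := hmono hj
        rw [Crosses] at h4 ⊢
        linarith
  have hGm : ∀ k, MeasurableSet (F k ∩ {ω | Crosses X ξ (x m) k ω}) := fun k =>
    (history_le hc k k _ (hFm k)).inter (measurableSet_crosses (fun j _ => hc.chain.measurable j)
      (fun j _ => hc.measurable_block j) _)
  have hdisj : Pairwise (Function.onFun Disjoint fun k => F k ∩ {ω | Crosses X ξ (x m) k ω}) := by
    intro k k' hkk
    refine Set.disjoint_left.2 fun ω h1 h2 => hkk ?_
    exact eq_of_crosses h1.1.2.1 h1.2 h2.1.2.1 h2.2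
  have hH : MeasurableSet (phaseHit X ξ (x (m + 1)) (i (m + 1))) := by
    rw [phaseHit_eq_iUnion]
    exact MeasurableSet.iUnion fun n => measurableSet_hitSet (fun j _ => hc.chain.measurable j)
      (fun j _ => hc.measurable_block j) _ _
  have hsucc : {ω | ∀ j ≤ m + 1, ω ∈ phaseHit X ξ (x j) (i j)} =
      ⋃ k, F k ∩ {ω | Crosses X ξ (x m) k ω} ∩ phaseHit X ξ (x (m + 1)) (i (m + 1)) := by
    rw [← Set.iUnion_inter, ← hG]
    ext ω
    simp only [Set.mem_ofPred_eq, Set.mem_inter_iff]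
    constructor
    · exact fun hh => ⟨fun j hj => hh j (hj.trans (Nat.le_succ m)), hh (m + 1) le_rfl⟩
    · rintro ⟨h1, h2⟩ j hj
      rcases Nat.le_succ_iff.1 hj with h3 | rfl
      · exact h1 j h3
      · exact h2
  rw [hsucc, hG, measure_iUnion hdisj hGm, measure_iUnion
    (fun k k' hkk => (hdisj hkk).mono Set.inter_subset_left Set.inter_subset_left)
    (fun k => (hGm k).inter hH), ← ENNReal.tsum_mul_right]
  congr 1
  funext k
  have := measure_crossing_add hc hom het (hx m)
    (sub_nonneg.2 (hmono (Nat.le_succ m))) (i (m + 1)) k (i m) (hFm k) (fun ω hω => hω.1)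
    (fun ω hω => hω.2.1)
  rwa [add_sub_cancel] at this

/-- The finite-dimensional laws of the phase at the first crossings. -/
theorem measure_phaseHit (hK : ∀ i j, 0 ≤ K i j) (hK1 : ∀ i, ∑ j, K i j = 1) (m : ℕ) {x : ℕ → ℝ}
    (hx : ∀ k, 0 ≤ x k) (hmono : Monotone x) (i : ℕ → S) :
    P.real {ω | ∀ j ≤ m, ω ∈ phaseHit X ξ (x j) (i j)} =
      P.real (phaseHit X ξ (x 0) (i 0)) * ∏ k ∈ Finset.range m,
        NormedSpace.exp ((x (k + 1) - x k) • crossGenerator om et K) (i k) (i (k + 1)) := by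
  induction m with
  | zero =>
    simp only [Finset.range_zero, Finset.prod_empty, mul_one]
    congr 1
    ext ω
    simp
  | succ m ih =>
    have hz : 0 ≤ x (m + 1) - x m := sub_nonneg.2 (hmono (Nat.le_succ m))
    rw [Finset.prod_range_succ, ← mul_assoc, ← ih, measureReal_def,
      measure_phaseHit_succ hc hom het m hx hmono i, ENNReal.toReal_mul, ← measureReal_def,
      crossLim_eq_exp hom het hK hK1 hz, ENNReal.toReal_ofReal]
    rw [← crossMatrix_eq_exp hom het hK hK1 hz]
    exact crossMatrix_nonneg _ _ _

/-- The descents do not tend to zero. -/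
lemma ae_not_tendsto_descent :
    ∀ᵐ ω ∂P, ¬ Tendsto (fun k => (ξ k ω (X k ω)).1) atTop (𝓝 0) := by
  -- If the descents tend to zero, they are at most `ε` from some `N` on, so at time `N` some
  -- coordinate of the block is at most `ε`. The bound on this probability does not depend on `N`
  -- and vanishes with `ε`; independence between cycles is not needed.
  have hsmall : ∀ ε : ℝ, 0 < ε → P {ω | Tendsto (fun k => (ξ k ω (X k ω)).1) atTop (𝓝 0)} ≤
      ∑ i, (1 - ENNReal.ofReal (Real.exp (-(om i * ε)))) := by
    intro ε hε
    set E : ℕ → Set Ω := fun N => {ω | ∀ k ≥ N, (ξ k ω (X k ω)).1 ≤ ε} with hE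
    have hsub : {ω | Tendsto (fun k => (ξ k ω (X k ω)).1) atTop (𝓝 0)} ⊆ ⋃ N, E N := by
      intro ω hω
      obtain ⟨N, hN⟩ := eventually_atTop.1 ((tendsto_order.1 hω).2 ε hε)
      exact Set.mem_iUnion.2 ⟨N, fun k hk => (hN k hk).le⟩
    have hmono : Monotone E := fun N N' hNN ω hω k hk => hω k (hNN.trans hk)
    refine (measure_mono hsub).trans ?_
    rw [hmono.measure_iUnion]
    refine iSup_le fun N => ?_
    have h1 : E N ⊆ ⋃ i, {ω | (ξ N ω i).1 ≤ ε} := fun ω hω =>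
      Set.mem_iUnion.2 ⟨X N ω, hω N le_rfl⟩
    refine (measure_mono h1).trans ((measure_iUnion_fintype_le P _).trans
      (Finset.sum_le_sum fun i _ => ?_))
    have hprobo := isProbabilityMeasure_expMeasure (hom i)
    have hprobe := isProbabilityMeasure_expMeasure (het i)
    have h2 : P {ω | (ξ N ω i).1 ≤ ε} =
        ((expMeasure (om i)).prod (expMeasure (et i))) (Set.Iic ε ×ˢ Set.univ) := by
      have hm : Measurable fun ω => ξ N ω i :=
        (measurable_pi_apply i).comp (hc.measurable_block N)
      rw [← hc.law N i, Measure.map_apply hm (measurableSet_Iic.prod .univ)]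
      congr 1
      ext ω
      simp
    rw [h2, Measure.prod_prod, measure_univ, mul_one, ← Set.compl_Ioi,
      prob_compl_eq_one_sub measurableSet_Ioi, expMeasure_Ioi (hom i) hε.le]
  have hlim : Tendsto (fun ε : ℝ => ∑ i, (1 - ENNReal.ofReal (Real.exp (-(om i * ε)))))
      (𝓝[>] 0) (𝓝 (∑ i, (1 - ENNReal.ofReal (Real.exp (-(om i * 0)))))) := by
    refine tendsto_finsetSum _ fun i _ => ?_
    refine ENNReal.Tendsto.sub tendsto_const_nhds ?_ (Or.inl ENNReal.one_ne_top)
    refine ENNReal.tendsto_ofReal (Tendsto.mono_left ?_ nhdsWithin_le_nhds)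
    exact (by fun_prop : Continuous fun ε : ℝ => Real.exp (-(om i * ε))).tendsto 0
  have h0 : P {ω | Tendsto (fun k => (ξ k ω (X k ω)).1) atTop (𝓝 0)} ≤ 0 := by
    simp only [mul_zero, neg_zero, Real.exp_zero, ENNReal.ofReal_one, tsub_self,
      Finset.sum_const_zero] at hlim
    exact ge_of_tendsto hlim (eventually_nhdsWithin_of_forall fun ε hε => hsmall ε hε)
  rw [ae_iff]
  simpa using h0

/-- The initial law of the phase at the first crossings. -/
lemma measure_phaseHit_zero (i : S) : P.real (phaseHit X ξ 0 i) = p i := by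
  have hpos : ∀ᵐ ω ∂P, ∀ j, 0 < (ξ 0 ω j).1 := by
    rw [ae_all_iff]
    intro j
    have hprobo := isProbabilityMeasure_expMeasure (hom j)
    have hprobe := isProbabilityMeasure_expMeasure (het j)
    have h1 : ∀ᵐ z ∂(P.map fun ω => ξ 0 ω j), 0 < z.1 := by
      rw [hc.law 0 j]
      exact Measure.quasiMeasurePreserving_fst.ae (ae_pos_expMeasure (om j))
    exact ae_of_ae_map ((measurable_pi_apply j).comp (hc.measurable_block 0)).aemeasurable h1
  have h1 := hc.chain.law 0 (fun _ => i)
  simp only [Finset.range_zero, Finset.prod_empty, mul_one] at h1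
  rw [← h1]
  refine measureReal_congr ?_
  filter_upwards [hpos] with ω hω
  refine propext ⟨?_, ?_⟩
  · rintro ⟨k, hk1, hk2, hk3⟩
    have h0 : Crosses X ξ 0 0 ω := by
      simpa [Crosses, cycleLevel] using hω (X 0 ω)
    have : NotCrossed X ξ 0 0 ω := fun j hj => absurd hj (Nat.not_lt_zero j)
    have := eq_of_crosses this h0 hk1 hk2
    subst this
    intro j hj
    rw [Nat.le_zero.1 hj]
    exact hk3
  · intro hh
    exact ⟨0, fun j hj => absurd hj (Nat.not_lt_zero j), by
      simpa [Crosses, cycleLevel] using hω (X 0 ω), hh 0 le_rfl⟩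

end CycleChain

end MMBM

namespace MMBM

/-! ### Down-crossings of processes built from cycles -/

section DownPhase

variable {S Ω : Type*}

/-- If a level process is continuous on successive cycles `[T k, T (k + 1)]`, on which the phase is
`Y k` and the minimum of the level is `m k`, then the phase at the first passage below `-x` is
that of the first cycle whose minimum is below `-x`. -/
lemma downPhase_eq_iff {Z : ℝ≥0 → Ω → ℝ} {K : ℝ≥0 → Ω → S} {ω : Ω} {T : ℕ → ℝ≥0} {Y : ℕ → S}
    {m : ℕ → ℝ} (hT0 : T 0 = 0) (hT : Monotone T) (hcov : ∀ t, ∃ k, T k ≤ t ∧ t < T (k + 1))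
    (hY : ∀ k t, T k ≤ t → t < T (k + 1) → K t ω = Y k) (hZ0 : Z 0 ω = 0)
    (hc : ∀ k, ContinuousOn (fun t => Z t ω) (Set.Icc (T k) (T (k + 1))))
    (hm : ∀ k x, (∃ t ∈ Set.Icc (T k) (T (k + 1)), Z t ω < -x) ↔ m k < -x) (x : ℝ≥0) (i : S) :
    downPhase Z K x ω = i ↔ ∃ k, (∀ j < k, -(x : ℝ) ≤ m j) ∧ m k < -(x : ℝ) ∧ Y k = i := by
  classical
  by_cases hex : ∃ k, m k < -(x : ℝ)
  · set k := Nat.find hex with hk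
    have hkx : m k < -(x : ℝ) := Nat.find_spec hex
    have hlt : ∀ j < k, -(x : ℝ) ≤ m j := fun j hj => not_lt.1 (Nat.find_min hex hj)
    have hprev : ∀ t, t < T k → -(x : ℝ) ≤ Z t ω := by
      intro t ht
      obtain ⟨j, hj1, hj2⟩ := hcov t
      have hjk : j < k := by
        by_contra! hkj
        exact absurd (ht.trans_le (hT hkj)) (not_lt.2 hj1)
      by_contra! hneg
      exact absurd ((hm j x).1 ⟨t, ⟨hj1, hj2.le⟩, hneg⟩) (not_lt.2 (hlt j hjk))
    have hstart : -(x : ℝ) ≤ Z (T k) ω := by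
      rcases Nat.eq_zero_or_pos k with h0 | h0
      · rw [h0, hT0, hZ0]
        exact neg_nonpos.2 x.2
      · by_contra! hneg
        have hk1 : k - 1 + 1 = k := Nat.sub_add_cancel h0
        have hj := hlt (k - 1) (by omega)
        refine absurd ((hm (k - 1) x).1 ⟨T k, ⟨hT (Nat.sub_le k 1), ?_⟩, hneg⟩) (not_lt.2 hj)
        rw [hk1]
    -- The cycle is closed but the phase is `Y k` only before its right end. If the level is below
    -- `-x` at that end, continuity puts it below `-x` slightly earlier, so the passage time falls
    -- in the half-open cycle.
    obtain ⟨t, ⟨ht1, ht2⟩, hZt⟩ : ∃ t ∈ Set.Ico (T k) (T (k + 1)), Z t ω < -(x : ℝ) := by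
      obtain ⟨t, ⟨ht1, ht2⟩, hZt⟩ := (hm k x).2 hkx
      rcases ht2.lt_or_eq with h | h
      · exact ⟨t, ⟨ht1, h⟩, hZt⟩
      · subst h
        have hne : T k < T (k + 1) := by
          refine lt_of_le_of_ne ht1 fun heq => ?_
          rw [← heq] at hZt
          exact absurd hZt (not_lt.2 hstart)
        have hcw := ((hc k) (T (k + 1)) (Set.right_mem_Icc.2 ht1)).mono
          (Set.Ico_subset_Icc_self : Set.Ico (T k) (T (k + 1)) ⊆ _)
        have := right_nhdsWithin_Ico_neBot hne
        have hev := (hcw.eventually (gt_mem_nhds hZt)).and self_mem_nhdsWithin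
        obtain ⟨u, hu1, hu2⟩ := hev.exists
        exact ⟨u, hu2, hu1⟩
    set A : Set ℝ≥0 := {u | 0 ≤ u ∧ Z u ω ∈ Set.Iio (-(x : ℝ))} with hA
    have htA : t ∈ A := ⟨zero_le, hZt⟩
    have hτ : tau Z x ω = ((sInf A : ℝ≥0) : WithTop ℝ≥0) := by
      rw [tau, hittingAfter, if_pos ⟨t, zero_le, hZt⟩]
    have h1 : T k ≤ sInf A := le_csInf ⟨t, htA⟩ fun u hu => by
      by_contra! hlt'
      exact absurd hu.2 (not_lt.2 (hprev u hlt'))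
    have h2 : sInf A < T (k + 1) := (csInf_le (OrderBot.bddBelow _) htA).trans_lt ht2
    have hval : downPhase Z K x ω = (Y k : WithTop S) := by
      rw [downPhase, hτ, WithTop.map_coe, hY k _ h1 h2]
    rw [hval, WithTop.coe_inj]
    constructor
    · exact fun h => ⟨k, hlt, hkx, h⟩
    · rintro ⟨k', h3, h4, h5⟩
      have : k' = k := by
        rcases lt_trichotomy k' k with h | h | h
        · exact absurd h4 (not_lt.2 (hlt _ h))
        · exact h
        · exact absurd hkx (not_lt.2 (h3 _ h))
      rw [← h5, this]
  · have hτ : tau Z x ω = ⊤ := by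
      rw [tau, hittingAfter_eq_top_iff]
      intro t _ hZt
      obtain ⟨k, hk1, hk2⟩ := hcov t
      exact hex ⟨k, (hm k x).1 ⟨t, ⟨hk1, hk2.le⟩, hZt⟩⟩
    rw [downPhase, hτ, WithTop.map_top]
    constructor
    · exact fun h => absurd h WithTop.top_ne_coe
    · rintro ⟨k, -, hk, -⟩
      exact absurd ⟨k, hk⟩ hex

/-- Once killed, the down-crossing phase process remains so. -/
lemma downPhase_eq_top_mono {Z : ℝ≥0 → Ω → ℝ} {K : ℝ≥0 → Ω → S} {x y : ℝ≥0} (hxy : x ≤ y) {ω : Ω}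
    (h : downPhase Z K x ω = ⊤) : downPhase Z K y ω = ⊤ := by
  rw [downPhase, WithTop.map_eq_top_iff, tau, hittingAfter_eq_top_iff] at h ⊢
  intro t ht hlt
  refine h t ht ?_
  have hxy' : (x : ℝ) ≤ y := hxy
  simp only [Set.mem_Iio] at hlt ⊢
  linarith

end DownPhase

/-! ### Paths of the modulated Brownian motion -/

/-- The path of `B` is continuous and those of the counting processes are regular. -/
structure IsRegularPath {S Ω : Type*} (W : Drivers S Ω) (ω : Ω) : Prop where
  continuous_B : Continuous fun t => W.B t ω
  mono : ∀ ℓ, Monotone fun t => W.N ℓ t ω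
  zero : ∀ ℓ, W.N ℓ 0 ω = 0
  right : ∀ ℓ t, ∃ s, t < s ∧ W.N ℓ s ω = W.N ℓ t ω

section Path

variable {S Ω : Type*} [Fintype S] {D : Params S} {W : Drivers S Ω} {ω : Ω}
variable (h : IsRegularPath W ω)

include h

lemma M_mono (n : ℕ) : Monotone fun t => M W n t ω := fun _ _ hst =>
  Finset.sum_le_sum fun ℓ _ => h.mono ℓ hst

lemma M_zero (n : ℕ) : M W n 0 ω = 0 := Finset.sum_eq_zero fun ℓ _ => h.zero ℓ

omit h in
lemma M_stage_mono {m n : ℕ} (hmn : m ≤ n) (t : ℝ≥0) : M W m t ω ≤ M W n t ω :=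
  Finset.sum_le_sum_of_subset (Finset.range_mono (Nat.succ_le_succ hmn))

lemma M_right (n : ℕ) (t : ℝ≥0) : ∃ s, t < s ∧ M W n s ω = M W n t ω := by
  induction n with
  | zero => simpa [M] using h.right 0 t
  | succ n ih =>
    obtain ⟨s, hs, hMs⟩ := ih
    obtain ⟨u, hu, hNu⟩ := h.right (n + 1) t
    have hM : ∀ v, M W (n + 1) v ω = M W n v ω + W.N (n + 1) v ω := fun v =>
      Finset.sum_range_succ _ _
    refine ⟨min s u, lt_min hs hu, ?_⟩
    have h1 := M_mono h n (min_le_left s u)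
    have h2 := M_mono h n (lt_min hs hu).le
    have h3 := h.mono (n + 1) (min_le_right s u)
    have h4 := h.mono (n + 1) (lt_min hs hu).le
    simp only at h1 h2 h3 h4
    rw [hM, hM]
    omega

/-- Right regularity makes the infimum an arrival. The existence hypothesis matters: if the count
never reached `k`, the epoch would be the infimum of the empty set, which is `0`. -/
lemma le_M_iff {n k : ℕ} (hk : ∃ t, k ≤ M W n t ω) (t : ℝ≥0) :
    k ≤ M W n t ω ↔ theta W n k ω ≤ t := by
  constructor
  · exact fun hk => csInf_le (OrderBot.bddBelow _) hk
  · intro hle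
    obtain ⟨s, hs, hMs⟩ := M_right h n t
    obtain ⟨u, hu, hus⟩ := exists_lt_of_csInf_lt (s := {t | k ≤ M W n t ω}) hk (hle.trans_lt hs)
    exact (hu.trans (M_mono h n hus.le)).trans hMs.le

lemma theta_zero (n : ℕ) : theta W n 0 ω = 0 :=
  le_antisymm ((le_M_iff h ⟨0, Nat.zero_le _⟩ 0).1 (Nat.zero_le _)) zero_le

lemma M_eq_iff {n : ℕ} (hn : ∀ k, ∃ t, k ≤ M W n t ω) (k : ℕ) (t : ℝ≥0) :
    M W n t ω = k ↔ theta W n k ω ≤ t ∧ t < theta W n (k + 1) ω := by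
  rw [← le_M_iff h (hn k), ← not_le, ← le_M_iff h (hn (k + 1))]
  omega

lemma theta_mono {n : ℕ} (hn : ∀ k, ∃ t, k ≤ M W n t ω) : Monotone fun k => theta W n k ω := by
  intro j k hjk
  refine (le_M_iff h (hn j) _).1 (hjk.trans ((le_M_iff h (hn k) _).2 le_rfl))

/-- The original counting process is constant between the arrivals of a superposition. -/
lemma M_stage_const {m n : ℕ} (hmn : m ≤ n) {s t : ℝ≥0} (hst : s ≤ t)
    (hM : M W n t ω = M W n s ω) : M W m t ω = M W m s ω := by
  have hsplit : ∀ v, M W n v ω = M W m v ω + ∑ ℓ ∈ Finset.Ico (m + 1) (n + 1), W.N ℓ v ω :=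
    fun v => (Finset.sum_range_add_sum_Ico _ (Nat.succ_le_succ hmn)).symm
  have h1 := M_mono h m hst
  have h2 : ∑ ℓ ∈ Finset.Ico (m + 1) (n + 1), W.N ℓ s ω ≤
    ∑ ℓ ∈ Finset.Ico (m + 1) (n + 1), W.N ℓ t ω := Finset.sum_le_sum fun ℓ _ => h.mono ℓ hst
  rw [hsplit, hsplit] at hM
  simp only at h1
  omega

lemma intervalIntegrable_drift (a b : ℝ) :
    IntervalIntegrable (fun s : ℝ => D.μ (J W s.toNNReal ω)) volume a b := by
  have hm : Measurable fun s : ℝ => M W 0 s.toNNReal ω :=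
    Monotone.measurable fun a b hab => M_mono h 0 (Real.toNNReal_mono hab)
  have hg : Measurable fun s : ℝ => D.μ (J W s.toNNReal ω) :=
    (measurable_from_top (f := fun k => D.μ (W.X k ω))).comp hm
  rw [intervalIntegrable_iff]
  refine Measure.integrableOn_of_bounded (M := ∑ i, |D.μ i|) (by simp)
    hg.aestronglyMeasurable (ae_of_all _ fun s => ?_)
  exact Finset.single_le_sum (f := fun i => |D.μ i|) (fun i _ => abs_nonneg _)
    (Finset.mem_univ _)

/-- The level process follows a Brownian motion with drift as long as the phase does not change. -/
lemma R_sub_R {s t : ℝ≥0} (hst : s ≤ t)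
    (hc : ∀ u, s ≤ u → u < t → M W 0 u ω = M W 0 s ω) :
    R D W t ω - R D W s ω =
      D.μ (J W s ω) * (t - s) + D.σ (J W s ω) * (W.B t ω - W.B s ω) := by
  have hst' : (s : ℝ) ≤ t := hst
  have hint : (∫ u in (0 : ℝ)..t, D.μ (J W u.toNNReal ω)) -
      (∫ u in (0 : ℝ)..s, D.μ (J W u.toNNReal ω)) = D.μ (J W s ω) * (t - s) := by
    rw [intervalIntegral.integral_interval_sub_left (intervalIntegrable_drift h _ _)
      (intervalIntegrable_drift h _ _)]
    have : ∫ u in (s : ℝ)..t, D.μ (J W u.toNNReal ω) = ∫ _u in (s : ℝ)..t, D.μ (J W s ω) := by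
      rw [intervalIntegral.integral_of_le hst', intervalIntegral.integral_of_le hst',
        integral_Ioc_eq_integral_Ioo, integral_Ioc_eq_integral_Ioo]
      refine setIntegral_congr_fun measurableSet_Ioo fun u hu => ?_
      have h1 : s ≤ u.toNNReal := NNReal.le_toNNReal_of_coe_le hu.1.le
      have h2 : u.toNNReal < t := by
        rw [← NNReal.coe_lt_coe, Real.coe_toNNReal _ (s.2.trans hu.1.le)]
        exact hu.2
      simp only [J, hc _ h1 h2]
    rw [this, intervalIntegral.integral_const, smul_eq_mul, mul_comm]
  have hsto : stochInt D W t ω - stochInt D W s ω =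
      D.σ (J W s ω) * (W.B t ω - W.B s ω) := by
    have hM := M_mono h 0 hst
    simp only at hM
    rcases hM.eq_or_lt with heq | hlt
    · rw [stochInt, stochInt, J, ← heq]
      ring
    · have hθ : ∀ k, M W 0 s ω < k → k ≤ M W 0 t ω → theta W 0 k ω = t := by
        intro k hk1 hk2
        refine le_antisymm (csInf_le (OrderBot.bddBelow _) hk2) (le_csInf ⟨t, hk2⟩ fun u hu => ?_)
        by_contra! hut
        have hu' : k ≤ M W 0 u ω := hu
        rcases le_total s u with h1 | h1
        · have := hc u h1 hut
          omega
        · have := M_mono h 0 h1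
          simp only at this
          omega
      have hsum : ∑ k ∈ Finset.Ico (M W 0 s ω + 1) (M W 0 t ω),
          D.σ (W.X k ω) * (W.B (theta W 0 (k + 1) ω) ω - W.B (theta W 0 k ω) ω) = 0 := by
        refine Finset.sum_eq_zero fun k hk => ?_
        rw [Finset.mem_Ico] at hk
        rw [hθ k (by omega) (by omega), hθ (k + 1) (by omega) (by omega), sub_self, mul_zero]
      rw [stochInt, stochInt, J, ← Finset.sum_range_add_sum_Ico _ (Nat.succ_le_of_lt hlt), hsum,
        Finset.sum_range_succ, hθ (M W 0 s ω + 1) (by omega) (by omega),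
        hθ (M W 0 t ω) hlt le_rfl]
      ring
  rw [R, R]
  linear_combination hint + hsto

lemma R_zero : R D W 0 ω = 0 := by
  simp [R, stochInt, M_zero h, theta_zero h]

section Cycles

variable {n : ℕ} (hn : ∀ k, ∃ t, k ≤ M W n t ω)

include hn

lemma R_sub_R_theta {k : ℕ} {t : ℝ≥0} (h1 : theta W n k ω ≤ t) (h2 : t ≤ theta W n (k + 1) ω) :
    R D W t ω - R D W (theta W n k ω) ω =
      D.μ (Xn W n k ω) * (t - theta W n k ω) +
        D.σ (Xn W n k ω) * (W.B t ω - W.B (theta W n k ω) ω) := by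
  refine R_sub_R h h1 fun u hu1 hu2 => M_stage_const h (Nat.zero_le n) hu1 ?_
  rw [(M_eq_iff h hn k _).2 ⟨le_rfl, hu1.trans_lt (hu2.trans_le h2)⟩,
    (M_eq_iff h hn k _).2 ⟨hu1, hu2.trans_le h2⟩]

lemma continuousOn_R_cycle (k : ℕ) : ContinuousOn (fun t => R D W t ω)
    (Set.Icc (theta W n k ω) (theta W n (k + 1) ω)) := by
  have hB := h.continuous_B
  have : Continuous fun t : ℝ≥0 => R D W (theta W n k ω) ω +
      (D.μ (Xn W n k ω) * (t - theta W n k ω) +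
        D.σ (Xn W n k ω) * (W.B t ω - W.B (theta W n k ω) ω)) := by
    fun_prop
  refine this.continuousOn.congr fun t ht => ?_
  have := R_sub_R_theta (D := D) h hn ht.1 ht.2
  simp only
  linarith

lemma bddBelow_R_cycle (k : ℕ) : BddBelow ((fun t => R D W t ω) ''
    Set.Icc (theta W n k ω) (theta W n (k + 1) ω)) :=
  isCompact_Icc.bddBelow_image (continuousOn_R_cycle h hn k)

lemma nonempty_R_cycle (k : ℕ) : ((fun t => R D W t ω) ''
    Set.Icc (theta W n k ω) (theta W n (k + 1) ω)).Nonempty :=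
  (Set.nonempty_Icc.2 (theta_mono h hn (Nat.le_succ k))).image _

lemma minR_lt_iff (k : ℕ) (y : ℝ) : minR D W n k ω < y ↔
    ∃ t ∈ Set.Icc (theta W n k ω) (theta W n (k + 1) ω), R D W t ω < y := by
  rw [minR, csInf_lt_iff (bddBelow_R_cycle h hn k) (nonempty_R_cycle h hn k)]
  simp

lemma minR_le {k : ℕ} {t : ℝ≥0} (h1 : theta W n k ω ≤ t) (h2 : t ≤ theta W n (k + 1) ω) :
    minR D W n k ω ≤ R D W t ω :=
  csInf_le (bddBelow_R_cycle h hn k) ⟨t, ⟨h1, h2⟩, rfl⟩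

lemma L_nonneg (k : ℕ) : 0 ≤ L D W n k ω :=
  sub_nonneg.2 (minR_le h hn le_rfl (theta_mono h hn (Nat.le_succ k)))

lemma H_nonneg (k : ℕ) : 0 ≤ H D W n k ω :=
  sub_nonneg.2 (minR_le h hn (theta_mono h hn (Nat.le_succ k)) le_rfl)

lemma exists_cycle (t : ℝ≥0) : ∃ k, theta W n k ω ≤ t ∧ t < theta W n (k + 1) ω :=
  ⟨M W n t ω, (M_eq_iff h hn _ t).1 rfl⟩

/-- The phase of the modulated Brownian motion at its first passage below `-x`. -/
lemma downPhase_R_eq_iff (x : ℝ≥0) (i : S) :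
    downPhase (R D W) (J W) x ω = i ↔
      ∃ k, (∀ j < k, -(x : ℝ) ≤ minR D W n j ω) ∧ minR D W n k ω < -(x : ℝ) ∧
        Xn W n k ω = i := by
  refine downPhase_eq_iff (T := fun k => theta W n k ω) (theta_zero h n) (theta_mono h hn)
    (exists_cycle h hn) (fun k t h1 h2 => ?_) (R_zero h) (continuousOn_R_cycle h hn)
    (fun k y => (minR_lt_iff h hn k _).symm) x i
  have hlt : theta W n k ω < theta W n (k + 1) ω := h1.trans_lt h2
  rw [Xn, J, J, M_stage_const h (Nat.zero_le n) h1 ?_]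
  rw [(M_eq_iff h hn k _).2 ⟨le_rfl, hlt⟩, (M_eq_iff h hn k _).2 ⟨h1, h2⟩]

end Cycles

end Path

end MMBM

namespace MMBM

/-! ### Paths of the fluid process -/

lemma integral_of_eq_const {f : ℝ → ℝ} {a b c : ℝ} (hab : a ≤ b) (hf : ∀ s ∈ Set.Ioo a b, f s = c) :
    IntervalIntegrable f volume a b ∧ ∫ s in a..b, f s = c * (b - a) := by
  have hae : f =ᵐ[volume.restrict (Set.Ioc a b)] fun _ => c := by
    rw [← restrict_Ioo_eq_restrict_Ioc]
    exact (ae_restrict_iff' measurableSet_Ioo).2 (ae_of_all _ hf)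
  constructor
  · rw [intervalIntegrable_iff_integrableOn_Ioc_of_le hab, IntegrableOn]
    exact (integrable_const c).congr hae.symm
  · rw [intervalIntegral.integral_of_le hab, integral_congr_ae hae,
      ← intervalIntegral.integral_of_le hab, intervalIntegral.integral_const, smul_eq_mul, mul_comm]

section Fluid

variable {S Ω : Type*} [Fintype S] {D : Params S} {W : Drivers S Ω} {ω : Ω}
variable (h : IsRegularPath W ω) {n : ℕ} (hn : ∀ k, ∃ t, k ≤ M W n t ω) (hlam : 0 < D.lam n)

include h hn hlam

lemma Lhat_nonneg (k : ℕ) : 0 ≤ Lhat D W n k ω :=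
  mul_nonneg (mul_nonneg (inv_nonneg.2 hlam.le) (omegaRate_pos hlam _).le) (L_nonneg h hn k)

lemma Hhat_nonneg (k : ℕ) : 0 ≤ Hhat D W n k ω :=
  mul_nonneg (mul_nonneg (inv_nonneg.2 hlam.le) (etaRate_pos hlam _).le) (H_nonneg h hn k)

omit h hn hlam in
lemma chi_succ (k : ℕ) :
    chi D W n (k + 1) ω = chi D W n k ω + (Lhat D W n k ω + Hhat D W n k ω) :=
  Finset.sum_range_succ _ _

lemma chi_mono : Monotone fun k => chi D W n k ω := by
  refine monotone_nat_of_le_succ fun k => ?_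
  rw [chi_succ]
  linarith [Lhat_nonneg h hn hlam k, Hhat_nonneg h hn hlam k]

omit h hn hlam in
lemma chi_zero : chi D W n 0 ω = 0 := Finset.sum_range_zero _

lemma chi_nonneg (k : ℕ) : 0 ≤ chi D W n k ω := by
  rw [← chi_zero (D := D) (W := W) (n := n) (ω := ω)]
  exact chi_mono h hn hlam (Nat.zero_le k)

lemma cycle_eq {k : ℕ} {t : ℝ≥0} (h1 : chi D W n k ω ≤ t) (h2 : t < chi D W n (k + 1) ω) :
    cycle D W n t ω = k := by
  refine IsGreatest.csSup_eq ⟨h1, fun j hj => ?_⟩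
  by_contra! hlt
  exact absurd (h2.trans_le (chi_mono h hn hlam (Nat.succ_le_of_lt hlt))) (not_lt.2 hj)

lemma rate_Jn_of_lt {k : ℕ} {s : ℝ} (h1 : chi D W n k ω ≤ s)
    (h2 : s < chi D W n k ω + Lhat D W n k ω) :
    rate D n (Jn D W n s.toNNReal ω) = -(D.lam n / omegaRate D n (Xn W n k ω)) := by
  have hs : ((s.toNNReal : ℝ≥0) : ℝ) = s :=
    Real.coe_toNNReal s ((chi_nonneg h hn hlam k).trans h1)
  have hc : cycle D W n s.toNNReal ω = k := by
    refine cycle_eq h hn hlam (by rwa [hs]) ?_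
    rw [hs, chi_succ]
    linarith [Hhat_nonneg h hn hlam k]
  rw [Jn, hc, hs, if_pos h2, rate]

lemma rate_Jn_of_ge {k : ℕ} {s : ℝ} (h1 : chi D W n k ω + Lhat D W n k ω ≤ s)
    (h2 : s < chi D W n (k + 1) ω) :
    rate D n (Jn D W n s.toNNReal ω) = D.lam n / etaRate D n (Xn W n k ω) := by
  have h1' : chi D W n k ω ≤ s := by linarith [Lhat_nonneg h hn hlam k]
  have hs : ((s.toNNReal : ℝ≥0) : ℝ) = s :=
    Real.coe_toNNReal s ((chi_nonneg h hn hlam k).trans h1')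
  have hc : cycle D W n s.toNNReal ω = k := cycle_eq h hn hlam (by rwa [hs]) (by rwa [hs])
  rw [Jn, hc, hs, if_neg (not_lt.2 h1), rate]

lemma lam_div_omegaRate_mul_Lhat (k : ℕ) :
    D.lam n / omegaRate D n (Xn W n k ω) * Lhat D W n k ω = L D W n k ω := by
  have := omegaRate_pos hlam (Xn W n k ω)
  rw [Lhat]
  field_simp

lemma lam_div_etaRate_mul_Hhat (k : ℕ) :
    D.lam n / etaRate D n (Xn W n k ω) * Hhat D W n k ω = H D W n k ω := by
  have := etaRate_pos hlam (Xn W n k ω)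
  rw [Hhat]
  field_simp

/-- The fluid level is a descent followed by an ascent on each cycle. -/
lemma integral_rate_cycle (k : ℕ) {t : ℝ} (h1 : chi D W n k ω ≤ t)
    (h2 : t ≤ chi D W n (k + 1) ω) :
    IntervalIntegrable (fun s => rate D n (Jn D W n s.toNNReal ω)) volume (chi D W n k ω) t ∧
      ∫ s in (chi D W n k ω)..t, rate D n (Jn D W n s.toNNReal ω) =
        max (-(D.lam n / omegaRate D n (Xn W n k ω)) * (t - chi D W n k ω))
          (-L D W n k ω + D.lam n / etaRate D n (Xn W n k ω) *
            (t - chi D W n k ω - Lhat D W n k ω)) := by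
  set c := chi D W n k ω with hc
  set l := Lhat D W n k ω with hl
  set u := D.lam n / omegaRate D n (Xn W n k ω) with hu
  set v := D.lam n / etaRate D n (Xn W n k ω) with hv
  have hu0 : 0 < u := div_pos hlam (omegaRate_pos hlam _)
  have hv0 : 0 < v := div_pos hlam (etaRate_pos hlam _)
  have hul : u * l = L D W n k ω := lam_div_omegaRate_mul_Lhat h hn hlam k
  have hl0 : 0 ≤ l := Lhat_nonneg h hn hlam k
  -- A descent followed by an ascent is convex, so it is the maximum of its two affine branches.
  -- This gives one formula for both, and continuity with it.
  rcases le_total t (c + l) with htl | htl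
  · obtain ⟨hi, hI⟩ := integral_of_eq_const (f := fun s => rate D n (Jn D W n s.toNNReal ω)) h1
      fun s hs => rate_Jn_of_lt h hn hlam hs.1.le (hs.2.trans_le htl)
    refine ⟨hi, ?_⟩
    rw [hI, max_eq_left]
    rw [← hul]
    nlinarith
  · obtain ⟨hi, hI⟩ := integral_of_eq_const (f := fun s => rate D n (Jn D W n s.toNNReal ω))
      (show c ≤ c + l by linarith) fun s hs => rate_Jn_of_lt h hn hlam hs.1.le hs.2
    obtain ⟨hi', hI'⟩ := integral_of_eq_const (f := fun s => rate D n (Jn D W n s.toNNReal ω)) htl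
      fun s hs => rate_Jn_of_ge h hn hlam hs.1.le (hs.2.trans_le h2)
    refine ⟨hi.trans hi', ?_⟩
    rw [← intervalIntegral.integral_add_adjacent_intervals hi hi', hI, hI', max_eq_right]
    · rw [← hul]
      ring
    · rw [← hul]
      nlinarith

lemma intervalIntegrable_rate_chi (k : ℕ) :
    IntervalIntegrable (fun s => rate D n (Jn D W n s.toNNReal ω)) volume 0 (chi D W n k ω) := by
  induction k with
  | zero => rw [chi_zero]
  | succ k ih =>
    exact ih.trans (integral_rate_cycle h hn hlam k (chi_mono h hn hlam (Nat.le_succ k)) le_rfl).1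

lemma integral_rate_of_cycle (k : ℕ) {t : ℝ} (h1 : chi D W n k ω ≤ t)
    (h2 : t ≤ chi D W n (k + 1) ω) :
    ∫ s in (0 : ℝ)..t, rate D n (Jn D W n s.toNNReal ω) =
      (∫ s in (0 : ℝ)..(chi D W n k ω), rate D n (Jn D W n s.toNNReal ω)) +
        max (-(D.lam n / omegaRate D n (Xn W n k ω)) * (t - chi D W n k ω))
          (-L D W n k ω + D.lam n / etaRate D n (Xn W n k ω) *
            (t - chi D W n k ω - Lhat D W n k ω)) := by
  obtain ⟨hi, hI⟩ := integral_rate_cycle h hn hlam k h1 h2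
  rw [← intervalIntegral.integral_add_adjacent_intervals
    (intervalIntegrable_rate_chi h hn hlam k) hi, hI]

/-- The fluid level and the modulated Brownian motion agree at the starts of the cycles. -/
lemma integral_rate_chi (k : ℕ) :
    ∫ s in (0 : ℝ)..(chi D W n k ω), rate D n (Jn D W n s.toNNReal ω) =
      R D W (theta W n k ω) ω := by
  induction k with
  | zero => rw [chi_zero, intervalIntegral.integral_same, theta_zero h, R_zero h]
  | succ k ih =>
    have hL := L_nonneg (D := D) h hn k
    have hH := H_nonneg (D := D) h hn k
    have hLh := lam_div_omegaRate_mul_Lhat h hn hlam k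
    have hHh := lam_div_etaRate_mul_Hhat h hn hlam k
    have hu := div_pos hlam (omegaRate_pos hlam (Xn W n k ω))
    have hH0 := Hhat_nonneg h hn hlam k
    have h1 : -(D.lam n / omegaRate D n (Xn W n k ω)) *
        (chi D W n (k + 1) ω - chi D W n k ω) ≤ -L D W n k ω := by
      rw [chi_succ]
      nlinarith [mul_nonneg hu.le hH0]
    have h2 : D.lam n / etaRate D n (Xn W n k ω) *
        (chi D W n (k + 1) ω - chi D W n k ω - Lhat D W n k ω) = H D W n k ω := by
      rw [chi_succ, ← hHh]
      ring
    rw [integral_rate_of_cycle h hn hlam k (chi_mono h hn hlam (Nat.le_succ k)) le_rfl, ih, h2,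
      max_eq_right (by linarith), L, H]
    ring

lemma Rn_eq {k : ℕ} {t : ℝ≥0} (h1 : chi D W n k ω ≤ t) (h2 : t ≤ chi D W n (k + 1) ω) :
    Rn D W n t ω = R D W (theta W n k ω) ω +
        max (-(D.lam n / omegaRate D n (Xn W n k ω)) * (t - chi D W n k ω))
          (-L D W n k ω + D.lam n / etaRate D n (Xn W n k ω) *
            (t - chi D W n k ω - Lhat D W n k ω)) := by
  rw [Rn, integral_rate_of_cycle h hn hlam k h1 h2, integral_rate_chi h hn hlam k]

/-- The fluid attains the minimum of a cycle at the end of the descent, at the level `R(θ_k) - L`,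
which is the minimum of the MMBM over the corresponding cycle. -/
lemma exists_Rn_lt_iff (k : ℕ) (y : ℝ) :
    (∃ t ∈ Set.Icc (chi D W n k ω).toNNReal (chi D W n (k + 1) ω).toNNReal, Rn D W n t ω < y) ↔
      minR D W n k ω < y := by
  have hk := chi_nonneg h hn hlam k
  have hk1 := chi_nonneg h hn hlam (k + 1)
  have hLh := lam_div_omegaRate_mul_Lhat h hn hlam k
  have hu := div_pos hlam (omegaRate_pos hlam (Xn W n k ω))
  have hv := div_pos hlam (etaRate_pos hlam (Xn W n k ω))
  have hmin : minR D W n k ω = R D W (theta W n k ω) ω - L D W n k ω := by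
    rw [L]
    ring
  constructor
  · rintro ⟨t, ⟨ht1, ht2⟩, ht⟩
    rw [Real.toNNReal_le_iff_le_coe] at ht1
    rw [Real.le_toNNReal_iff_coe_le hk1] at ht2
    refine lt_of_le_of_lt ?_ ht
    rw [Rn_eq h hn hlam ht1 ht2, hmin, sub_eq_add_neg]
    refine add_le_add_right (le_max_iff.2 ?_) _
    rcases le_total (t : ℝ) (chi D W n k ω + Lhat D W n k ω) with h3 | h3
    · left
      nlinarith
    · right
      nlinarith
  · intro hlt
    have hl0 := Lhat_nonneg h hn hlam k
    have hh0 := Hhat_nonneg h hn hlam k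
    have hsum : 0 ≤ chi D W n k ω + Lhat D W n k ω := by linarith
    have hco : (((chi D W n k ω + Lhat D W n k ω).toNNReal : ℝ≥0) : ℝ) =
        chi D W n k ω + Lhat D W n k ω := Real.coe_toNNReal _ hsum
    have h3 : chi D W n k ω + Lhat D W n k ω ≤ chi D W n (k + 1) ω := by
      rw [chi_succ]
      linarith
    refine ⟨(chi D W n k ω + Lhat D W n k ω).toNNReal,
      ⟨Real.toNNReal_mono (by linarith), Real.toNNReal_mono h3⟩, ?_⟩
    rw [Rn_eq h hn hlam (k := k) (by rw [hco]; linarith) (by rwa [hco]), hco]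
    rw [hmin] at hlt
    have h4 : -(D.lam n / omegaRate D n (Xn W n k ω)) *
        (chi D W n k ω + Lhat D W n k ω - chi D W n k ω) = -L D W n k ω := by
      rw [← hLh]
      ring
    have h5 : D.lam n / etaRate D n (Xn W n k ω) *
        (chi D W n k ω + Lhat D W n k ω - chi D W n k ω - Lhat D W n k ω) = 0 := by
      ring
    rw [h4, h5, add_zero, max_self]
    linarith

lemma continuousOn_Rn_cycle (k : ℕ) : ContinuousOn (fun t => Rn D W n t ω)
    (Set.Icc (chi D W n k ω).toNNReal (chi D W n (k + 1) ω).toNNReal) := by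
  have hc : Continuous fun t : ℝ≥0 => R D W (theta W n k ω) ω +
        max (-(D.lam n / omegaRate D n (Xn W n k ω)) * (t - chi D W n k ω))
          (-L D W n k ω + D.lam n / etaRate D n (Xn W n k ω) *
            (t - chi D W n k ω - Lhat D W n k ω)) := by
    fun_prop
  refine hc.continuousOn.congr fun t ht => ?_
  exact Rn_eq h hn hlam (Real.toNNReal_le_iff_le_coe.1 ht.1)
    ((Real.le_toNNReal_iff_coe_le (chi_nonneg h hn hlam (k + 1))).1 ht.2)

/-- The phase of the fluid process at its first passage below `-x`. -/
lemma downPhase_Rn_eq_iff (hchi : ∀ t, ∃ k, t < chi D W n k ω) (x : ℝ≥0) (i : S) :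
    downPhase (Rn D W n) (fun t ω => (Jn D W n t ω).2) x ω = i ↔
      ∃ k, (∀ j < k, -(x : ℝ) ≤ minR D W n j ω) ∧ minR D W n k ω < -(x : ℝ) ∧
        Xn W n k ω = i := by
  have hle : ∀ (k : ℕ) (t : ℝ≥0), (chi D W n k ω).toNNReal ≤ t ↔ chi D W n k ω ≤ t := fun k t =>
    Real.toNNReal_le_iff_le_coe
  have hlt : ∀ (k : ℕ) (t : ℝ≥0), t < (chi D W n k ω).toNNReal ↔ t < chi D W n k ω := fun k t => by
    rw [← not_le, hle, not_le]
  refine downPhase_eq_iff (T := fun k => (chi D W n k ω).toNNReal) ?_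
    (fun a b hab => Real.toNNReal_mono (chi_mono h hn hlam hab)) (fun t => ?_)
    (fun k t h1 h2 => ?_) (by simp [Rn]) (continuousOn_Rn_cycle h hn hlam)
    (fun k y => exists_Rn_lt_iff h hn hlam k _) x i
  · rw [chi_zero, Real.toNNReal_zero]
  · classical
    have hex := hchi t
    have h0 : Nat.find hex ≠ 0 := by
      intro h0
      have := Nat.find_spec hex
      rw [h0, chi_zero] at this
      exact absurd t.2 (not_le.2 this)
    obtain ⟨k, hk⟩ := Nat.exists_eq_succ_of_ne_zero h0
    refine ⟨k, (hle _ _).2 (not_lt.1 (Nat.find_min hex (by omega))), (hlt _ _).2 ?_⟩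
    have := Nat.find_spec hex
    rwa [hk] at this
  · simp only [Jn]
    rw [cycle_eq h hn hlam ((hle _ _).1 h1) ((hlt _ _).1 h2)]

/-- The arrivals of a thinned process are arrivals of the superposition. -/
lemma theta_eq_theta {m : ℕ} (hmn : m ≤ n) (hm : ∀ k, ∃ t, k ≤ M W m t ω) (k : ℕ) :
    theta W n (M W n (theta W m k ω) ω) ω = theta W m k ω := by
  obtain ⟨h1, -⟩ := (M_eq_iff h hn _ (theta W m k ω)).1 rfl
  refine le_antisymm h1 ((le_M_iff h (hm k) _).1 ?_)
  rw [← M_stage_const h hmn h1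
    ((le_antisymm (M_mono h n h1) ((le_M_iff h (hn _) _).2 le_rfl)).symm)]
  exact (le_M_iff h (hm k) _).2 le_rfl

/-- If the durations of the cycles of the fluid process are summable, then the descents of the
modulated Brownian motion tend to zero. -/
lemma exists_lt_chi {m : ℕ} (hmn : m ≤ n) (hm : ∀ k, ∃ t, k ≤ M W m t ω)
    (hL : ¬ Tendsto (fun k => L D W m k ω) atTop (𝓝 0)) (t : ℝ) : ∃ k, t < chi D W n k ω := by
  by_contra! hbdd
  refine hL ?_
  set C : ℝ := ∑ i, (D.lam n / omegaRate D n i + D.lam n / etaRate D n i) with hC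
  have hu : ∀ i, 0 < D.lam n / omegaRate D n i := fun i => div_pos hlam (omegaRate_pos hlam i)
  have hv : ∀ i, 0 < D.lam n / etaRate D n i := fun i => div_pos hlam (etaRate_pos hlam i)
  have hCi : ∀ i, D.lam n / omegaRate D n i + D.lam n / etaRate D n i ≤ C := fun i =>
    Finset.single_le_sum (f := fun i => D.lam n / omegaRate D n i + D.lam n / etaRate D n i)
      (fun i _ => (add_pos (hu i) (hv i)).le) (Finset.mem_univ i)
  have hsum0 : Summable fun k => Lhat D W n k ω + Hhat D W n k ω :=
    summable_of_sum_range_le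
      (fun k => add_nonneg (Lhat_nonneg h hn hlam k) (Hhat_nonneg h hn hlam k)) hbdd
  have hLH : ∀ k, L D W n k ω + H D W n k ω ≤ C * (Lhat D W n k ω + Hhat D W n k ω) := by
    intro k
    have h1 := lam_div_omegaRate_mul_Lhat h hn hlam k
    have h2 := lam_div_etaRate_mul_Hhat h hn hlam k
    have h3 := hCi (Xn W n k ω)
    have h4 := hu (Xn W n k ω)
    have h5 := hv (Xn W n k ω)
    rw [← h1, ← h2, mul_add]
    exact add_le_add
      (mul_le_mul_of_nonneg_right (by linarith) (Lhat_nonneg h hn hlam k))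
      (mul_le_mul_of_nonneg_right (by linarith) (Hhat_nonneg h hn hlam k))
  have hsum : Summable fun k => L D W n k ω + H D W n k ω :=
    Summable.of_nonneg_of_le (fun k => add_nonneg (L_nonneg h hn k) (H_nonneg h hn k)) hLH
      (hsum0.mul_left C)
  -- The level changes by at most `L + H` over a cycle, so summable cycles make the levels at the
  -- epochs converge. The minima then have the same limit `z`.
  have hcauchy : CauchySeq fun k => R D W (theta W n k ω) ω := by
    refine cauchySeq_of_dist_le_of_summable _ (fun k => ?_) hsum
    have h1 := L_nonneg (D := D) h hn k
    have h2 := H_nonneg (D := D) h hn k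
    rw [Real.dist_eq, abs_le]
    simp only [L, H] at h1 h2 ⊢
    constructor <;> linarith
  obtain ⟨z, hz⟩ := cauchySeq_tendsto_of_complete hcauchy
  have hL0 : Tendsto (fun k => L D W n k ω) atTop (𝓝 0) :=
    squeeze_zero (fun k => L_nonneg h hn k) (fun k => le_add_of_nonneg_right (H_nonneg h hn k))
      hsum.tendsto_atTop_zero
  have hmin : Tendsto (fun k => minR D W n k ω) atTop (𝓝 z) := by
    have := hz.sub hL0
    simpa [L] using this
  have hidx : ∀ k (s : ℝ≥0), theta W m k ω ≤ s → k ≤ M W n s ω := fun k s hs =>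
    ((le_M_iff h (hm k) s).2 hs).trans (M_stage_mono hmn s)
  rw [Metric.tendsto_atTop]
  intro ε hε
  have h1 := (tendsto_order.1 hz).2 (z + ε / 3) (by linarith)
  have h2 := (tendsto_order.1 hmin).1 (z - ε / 3) (by linarith)
  obtain ⟨N, hN⟩ := eventually_atTop.1 (h1.and h2)
  refine ⟨N, fun k hk => ?_⟩
  have hR : R D W (theta W m k ω) ω < z + ε / 3 := by
    rw [← theta_eq_theta h hn hlam hmn hm k]
    exact (hN _ (hk.trans (hidx k _ le_rfl))).1
  -- Every time of a coarse cycle lies in some fine cycle of index at least `k`, whose minimum is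
  -- already close to `z`. With the starting level also close to `z`, the coarse descent is small.
  have hm' : z - ε / 3 ≤ minR D W m k ω := by
    refine le_csInf (nonempty_R_cycle h hm k) ?_
    rintro - ⟨s, hs, rfl⟩
    obtain ⟨h3, h4⟩ := (M_eq_iff h hn _ s).1 rfl
    exact (hN _ (hk.trans (hidx k s hs.1))).2.le.trans (minR_le h hn h3 h4.le)
  rw [Real.dist_eq, sub_zero, abs_of_nonneg (L_nonneg h hm k), L]
  linarith

end Fluid

end MMBM

namespace MMBM

/-! ### The cycles of the modulated Brownian motion as blocks of the drivers -/

section Identification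

variable {S Ω : Type*} [Fintype S] {D : Params S} {W : Drivers S Ω} {ω : Ω}
variable (h : IsRegularPath W ω) {n : ℕ} (hn : ∀ k, ∃ t, k ≤ M W n t ω)

include h hn

lemma depth_eq_L (k : ℕ) : depth (D.μ (Xn W n k ω)) (D.σ (Xn W n k ω)) (fun u => W.B u ω)
    (theta W n k ω) (theta W n (k + 1) ω - theta W n k ω) = L D W n k ω := by
  have hle : theta W n k ω ≤ theta W n (k + 1) ω := theta_mono h hn (Nat.le_succ k)
  refine eq_of_forall_lt_iff fun x => ?_
  rw [lt_depth_iff h.continuous_B, L, lt_sub_comm, minR_lt_iff h hn]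
  constructor
  · rintro ⟨t, ht, hlt⟩
    have h2 : theta W n k ω + t ≤ theta W n (k + 1) ω := by
      rw [← add_tsub_cancel_of_le hle]
      exact add_le_add_right ht _
    refine ⟨theta W n k ω + t, ⟨le_self_add, h2⟩, ?_⟩
    have := R_sub_R_theta (D := D) h hn le_self_add h2
    push_cast at this
    rw [add_sub_cancel_left] at this
    linarith
  · rintro ⟨t, ⟨ht1, ht2⟩, hlt⟩
    refine ⟨t - theta W n k ω, tsub_le_tsub_right ht2 _, ?_⟩
    have := R_sub_R_theta (D := D) h hn ht1 ht2
    rw [add_tsub_cancel_of_le ht1, NNReal.coe_sub ht1]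
    linarith

lemma height_eq_H (k : ℕ) : height (D.μ (Xn W n k ω)) (D.σ (Xn W n k ω)) (fun u => W.B u ω)
    (theta W n k ω) (theta W n (k + 1) ω - theta W n k ω) = H D W n k ω := by
  have hle : theta W n k ω ≤ theta W n (k + 1) ω := theta_mono h hn (Nat.le_succ k)
  rw [height, depth_eq_L h hn, segment, one_mul, add_tsub_cancel_of_le hle, NNReal.coe_sub hle,
    NNReal.coe_one, one_mul, ← R_sub_R_theta h hn hle le_rfl, L, H]
  ring

variable {B : ℝ≥0 → Ω → ℝ} {A : ℝ≥0 → Ω → ℕ} (hB : ∀ t, B t ω = W.B t ω)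
  (hA : ∀ t, A t ω = M W n t ω) (hX : ∀ k, Xn W n k ω = W.X k ω)

include hB hA hX

lemma cycleBlock_eq_L_H (k : ℕ) :
    cycleBlock D.μ D.σ B A k ω (W.X k ω) = (L D W n k ω, H D W n k ω) := by
  have hθ : ∀ j, epoch A j ω = theta W n j ω := fun j => by simp only [epoch, theta, hA]
  simp only [cycleBlock, block, hθ, hB]
  rw [← hX, depth_eq_L h hn, height_eq_H h hn]

lemma cycleLevel_eq_R (k : ℕ) :
    cycleLevel W.X (cycleBlock D.μ D.σ B A) k ω = R D W (theta W n k ω) ω := by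
  induction k with
  | zero => rw [theta_zero h, R_zero h, cycleLevel]
  | succ k ih =>
    rw [cycleLevel, ih, cycleBlock_eq_L_H h hn hB hA hX, L, H]
    ring

lemma mem_phaseHit_iff (x : ℝ) (i : S) : ω ∈ phaseHit W.X (cycleBlock D.μ D.σ B A) x i ↔
    ∃ k, (∀ j < k, -x ≤ minR D W n j ω) ∧ minR D W n k ω < -x ∧ Xn W n k ω = i := by
  have hiff : ∀ k, cycleLevel W.X (cycleBlock D.μ D.σ B A) k ω + x <
      (cycleBlock D.μ D.σ B A k ω (W.X k ω)).1 ↔ minR D W n k ω < -x := fun k => by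
    rw [cycleLevel_eq_R h hn hB hA hX, cycleBlock_eq_L_H h hn hB hA hX]
    simp only [L]
    constructor <;> intro h' <;> linarith
  simp only [phaseHit, Set.mem_ofPred_eq, NotCrossed, Crosses, hX, ← not_lt, hiff]

end Identification

/-! ### Almost sure properties of Poisson processes -/

section Poisson

variable {Ω : Type*} {m0 : MeasurableSpace Ω} {P : Measure Ω} [IsProbabilityMeasure P]
  {A : ℝ≥0 → Ω → ℕ} {r : ℝ≥0}

/-- The left side is `1 - e^{-u}(1 + u)`, and `e^{-u} ≥ 1 - u` bounds it by `1 - (1 - u)(1 + u)`. -/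
lemma poissonMeasure_two_le (u : ℝ≥0) :
    poissonMeasure u {k | 2 ≤ k} ≤ ENNReal.ofReal ((u : ℝ) ^ 2) := by
  have hset : {k : ℕ | 2 ≤ k} = ({0, 1} : Set ℕ)ᶜ := by
    ext k
    simp only [Set.mem_ofPred_eq, Set.mem_compl_iff, Set.mem_insert_iff, Set.mem_singleton_iff]
    omega
  have h01 : (poissonMeasure u).real {0, 1} = Real.exp (-u) * (1 + u) := by
    rw [Set.insert_eq, measureReal_union (by simp) (measurableSet_singleton _),
      poissonMeasure_real_singleton, poissonMeasure_real_singleton]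
    simp
    ring
  rw [← ofReal_measureReal, hset, probReal_compl_eq_one_sub (Set.toFinite _).measurableSet, h01]
  refine ENNReal.ofReal_le_ofReal ?_
  have h1 := Real.add_one_le_exp (-(u : ℝ))
  have h2 : (0 : ℝ) ≤ u := u.2
  nlinarith

variable (h : IsPoissonProcess A r P)

include h

lemma IsPoissonProcess.measure_sub_mem {s t : ℝ≥0} (hst : s ≤ t) (C : Set ℕ) :
    P {ω | A t ω - A s ω ∈ C} = poissonMeasure (r * (t - s)) C := by
  have hm : Measurable fun ω => A t ω - A s ω := (h.measurable t).sub (h.measurable s)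
  rw [← (h.law s t hst).map_eq, Measure.map_apply hm (MeasurableSet.of_discrete)]
  rfl

lemma IsPoissonProcess.measure_eq (t s : ℝ≥0) :
    P {ω | A (t + s) ω = A t ω} = ENNReal.ofReal (Real.exp (-(r * s))) := by
  have h1 := h.measure_sub_mem (le_self_add : t ≤ t + s) {0}
  rw [add_tsub_cancel_left, poissonMeasure_singleton] at h1
  simp only [pow_zero, mul_one, Nat.factorial_zero, Nat.cast_one, div_one, NNReal.coe_mul] at h1
  rw [← h1]
  refine measure_congr ?_
  filter_upwards [h.mono] with ω hω
  have := hω (le_self_add : t ≤ t + s)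
  simp only at this
  refine propext ?_
  change A (t + s) ω = A t ω ↔ A (t + s) ω - A t ω = 0
  omega

lemma IsPoissonProcess.ae_right : ∀ᵐ ω ∂P, ∀ t, ∃ s, t < s ∧ A s ω = A t ω := by
  filter_upwards [h.rightCont] with ω hω t
  have h1 : ∀ᶠ s in 𝓝[>] t, A s ω = A t ω :=
    ((hω t).mono_left (nhdsWithin_mono t Set.Ioi_subset_Ici_self)).eventually
      (show ∀ᶠ k in 𝓝 (A t ω), k = A t ω by simp)
  obtain ⟨s, hs1, hs2⟩ := (h1.and self_mem_nhdsWithin).exists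
  exact ⟨s, hs2, hs1⟩

lemma IsPoissonProcess.ae_eq_zero (hr : r = 0) : ∀ᵐ ω ∂P, ∀ t, A t ω = 0 := by
  have h1 : ∀ k : ℕ, ∀ᵐ ω ∂P, A k ω = A 0 ω := fun k => by
    have h2 := h.measure_eq 0 k
    rw [hr, zero_add] at h2
    rw [NNReal.coe_zero, zero_mul, neg_zero, Real.exp_zero, ENNReal.ofReal_one] at h2
    exact (mem_ae_iff_prob_eq_one (measurableSet_eq_fun (h.measurable k) (h.measurable 0))).2 h2
  filter_upwards [h.mono, h.zero, ae_all_iff.2 h1] with ω hm h0 hk t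
  obtain ⟨k, hk'⟩ := exists_nat_ge t
  have := hm hk'
  simp only [hk k, h0] at this
  omega

lemma IsPoissonProcess.ae_unbounded (hr : 0 < r) : ∀ᵐ ω ∂P, ∀ k, ∃ t, k ≤ A t ω := by
  rw [ae_all_iff]
  intro k
  have hle : ∀ n : ℕ, P {ω | ∀ t, A t ω < k} ≤ poissonMeasure (r * n) (Finset.range k) := by
    intro n
    have h1 := h.measure_sub_mem (zero_le : (0 : ℝ≥0) ≤ n) (Finset.range k)
    rw [tsub_zero] at h1
    rw [← h1]
    refine measure_mono fun ω hω => ?_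
    simp only [Finset.coe_range, Set.mem_Iio, Set.mem_ofPred_eq]
    exact (Nat.sub_le _ _).trans_lt (hω n)
  have hlim : Tendsto (fun n : ℕ => poissonMeasure (r * n) (Finset.range k)) atTop (𝓝 0) := by
    have hsum : ∀ n : ℕ, poissonMeasure (r * n) (Finset.range k) = ∑ j ∈ Finset.range k,
        ENNReal.ofReal (Real.exp (-((r * n : ℝ≥0) : ℝ)) *
          ((r * n : ℝ≥0) : ℝ) ^ j / j.factorial) := by
      intro n
      rw [← sum_measure_singleton]
      simp only [poissonMeasure_singleton]
    simp only [hsum]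
    rw [show (0 : ℝ≥0∞) = ∑ _j ∈ Finset.range k, 0 by simp]
    refine tendsto_finsetSum _ fun j _ => ?_
    rw [← ENNReal.ofReal_zero]
    refine ENNReal.tendsto_ofReal ?_
    have h1 : Tendsto (fun n : ℕ => ((r * n : ℝ≥0) : ℝ)) atTop atTop := by
      push_cast
      exact tendsto_natCast_atTop_atTop.const_mul_atTop (NNReal.coe_pos.2 hr)
    have h2 := ((Real.tendsto_pow_mul_exp_neg_atTop_nhds_zero j).comp h1).div_const
      (j.factorial : ℝ)
    rw [zero_div] at h2
    refine h2.congr fun n => ?_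
    simp only [Function.comp]
    rw [mul_comm]
  have h0 : P {ω | ∀ t, A t ω < k} = 0 := le_antisymm (ge_of_tendsto' hlim hle) zero_le
  rw [ae_iff]
  convert h0 using 3
  ext ω
  simp

/-- Almost surely, the jumps of a Poisson process have size one. -/
lemma IsPoissonProcess.ae_surjective (hr : 0 < r) : ∀ᵐ ω ∂P, ∀ k, ∃ t, A t ω = k := by
  -- `E N m`: some interval of the mesh `1/(m+1)` in `[0, N]` contains at least two arrivals. There
  -- are `N(m+1)` intervals, each with probability at most `(r/(m+1))²`, so the total tends to `0`
  -- as the mesh is refined.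
  set E : ℕ → ℕ → Set Ω := fun N m => ⋃ j ∈ Finset.range (N * (m + 1)),
    {ω | A (((j + 1 : ℕ) : ℝ≥0) / (m + 1 : ℕ)) ω - A ((j : ℝ≥0) / (m + 1 : ℕ)) ω ∈ {k | 2 ≤ k}}
    with hE
  have hEm : ∀ N m, P (E N m) ≤ ENNReal.ofReal (N * (r : ℝ) ^ 2 / (m + 1 : ℕ)) := by
    intro N m
    refine (measure_biUnion_finset_le _ _).trans ?_
    have hm0 : ((m + 1 : ℕ) : ℝ≥0) ≠ 0 := by positivity
    have hm0' : ((m + 1 : ℕ) : ℝ) ≠ 0 := by positivity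
    have hterm : ∀ j ∈ Finset.range (N * (m + 1)),
        P {ω | A (((j + 1 : ℕ) : ℝ≥0) / (m + 1 : ℕ)) ω - A ((j : ℝ≥0) / (m + 1 : ℕ)) ω ∈
          {k | 2 ≤ k}} ≤ ENNReal.ofReal ((r / (m + 1 : ℕ) : ℝ) ^ 2) := by
      intro j _
      have hle : (j : ℝ≥0) / (m + 1 : ℕ) ≤ ((j + 1 : ℕ) : ℝ≥0) / (m + 1 : ℕ) := by
        gcongr
        exact Nat.le_succ j
      have hdiff : ((j + 1 : ℕ) : ℝ≥0) / (m + 1 : ℕ) - (j : ℝ≥0) / (m + 1 : ℕ) =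
          1 / (m + 1 : ℕ) := by
        rw [tsub_eq_iff_eq_add_of_le hle, ← add_div]
        push_cast
        ring
      rw [h.measure_sub_mem hle, hdiff]
      refine (poissonMeasure_two_le _).trans_eq ?_
      congr 2
      push_cast
      ring
    refine (Finset.sum_le_sum hterm).trans_eq ?_
    rw [Finset.sum_const, Finset.card_range, ← ENNReal.ofReal_nsmul, nsmul_eq_mul]
    congr 1
    push_cast
    push_cast at hm0'
    field_simp
  have hnull : ∀ N, P (⋂ m, E N m) = 0 := by
    intro N
    have hlim : Tendsto (fun m : ℕ => ENNReal.ofReal (N * (r : ℝ) ^ 2 / (m + 1 : ℕ))) atTop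
        (𝓝 0) := by
      rw [← ENNReal.ofReal_zero]
      refine ENNReal.tendsto_ofReal ?_
      exact (tendsto_const_nhds.div_atTop
        (tendsto_natCast_atTop_atTop.comp (tendsto_add_atTop_nat 1)))
    exact le_antisymm (ge_of_tendsto' hlim fun m =>
      (measure_mono (Set.iInter_subset _ m)).trans (hEm N m)) zero_le
  have hae : ∀ᵐ ω ∂P, ∀ N, ω ∉ ⋂ m, E N m :=
    ae_all_iff.2 fun N => measure_eq_zero_iff_ae_notMem.1 (hnull N)
  filter_upwards [h.mono, h.zero, h.ae_right, h.ae_unbounded hr, hae]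
    with ω hmono h0 hright hub hN k
  -- If the value `k` is skipped, the count jumps at a time `t` from below `k` to above `k`. For
  -- every mesh the interval containing this jump has at least two arrivals.
  by_contra! hk
  set t : ℝ≥0 := sInf {t | k ≤ A t ω} with ht
  have hkt : k < A t ω := by
    obtain ⟨s, hs, hAs⟩ := hright t
    obtain ⟨u, hu, hus⟩ := exists_lt_of_csInf_lt (s := {t | k ≤ A t ω}) (hub k) hs
    have h1 := hmono hus.le
    have h2 : k ≤ A u ω := hu
    simp only at h1
    exact lt_of_le_of_ne (by omega) (hk t).symm
  have hbefore : ∀ s < t, A s ω < k := fun s hs => not_le.1 fun hks =>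
    absurd (csInf_le (OrderBot.bddBelow {t | k ≤ A t ω}) hks) (not_le.2 hs)
  have htpos : 0 < t := by
    refine pos_of_ne_zero fun h' => ?_
    rw [h', h0] at hkt
    omega
  obtain ⟨N, hNt⟩ := exists_nat_ge t
  refine hN N (Set.mem_iInter.2 fun m => ?_)
  have hm0 : (0 : ℝ≥0) < (m + 1 : ℕ) := by positivity
  have htm : 0 < t * (m + 1 : ℕ) := mul_pos htpos hm0
  obtain ⟨j, hj⟩ := Nat.exists_eq_succ_of_ne_zero (Nat.ceil_pos.2 htm).ne'
  have hj1 : t ≤ ((j + 1 : ℕ) : ℝ≥0) / (m + 1 : ℕ) := by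
    rw [le_div_iff₀ hm0]
    exact (Nat.le_ceil _).trans_eq (by rw [hj])
  have hj2 : (j : ℝ≥0) / (m + 1 : ℕ) < t := by
    rw [div_lt_iff₀ hm0]
    exact Nat.lt_ceil.1 (by omega)
  have hjN : j < N * (m + 1) := by
    have : (j : ℝ≥0) < ((N * (m + 1) : ℕ) : ℝ≥0) := by
      rw [Nat.cast_mul]
      refine ((div_lt_iff₀ hm0).1 hj2).trans_le ?_
      gcongr
    exact_mod_cast this
  simp only [hE, Set.mem_iUnion, Finset.mem_range, Set.mem_ofPred_eq]
  refine ⟨j, hjN, ?_⟩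
  have h1 := hmono hj1
  have h2 := hbefore _ hj2
  simp only at h1
  omega

end Poisson

end MMBM

namespace MMBM

/-! ### Almost sure properties of the drivers -/

section Drivers

variable {S Ω : Type*} [Fintype S] [DecidableEq S] [MeasurableSpace S]
  [MeasurableSingletonClass S] {m0 : MeasurableSpace Ω} {P : Measure Ω} [IsProbabilityMeasure P]
  {D : Params S} {W : Drivers S Ω}

/-- A chain whose transition matrix is the identity is almost surely constant. -/
lemma IsMarkovChain.ae_const {X : ℕ → Ω → S} (hX : IsMarkovChain X D.p 1 P) :
    ∀ᵐ ω ∂P, ∀ k, X k ω = X 0 ω := by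
  rw [ae_all_iff]
  intro m
  set E : S → Set Ω := fun a => {ω | ∀ k ≤ m, X k ω = a} with hE
  have hEm : ∀ a, MeasurableSet (E a) := fun a => by
    have : E a = ⋂ k ∈ Set.Iic m, X k ⁻¹' {a} := by
      ext ω
      simp [hE]
    rw [this]
    exact MeasurableSet.biInter (Set.to_countable _) fun k _ =>
      hX.measurable k (measurableSet_singleton a)
  have hdisj : Pairwise (Function.onFun Disjoint E) := fun a b hab =>
    Set.disjoint_left.2 fun ω h1 h2 =>
      hab ((h1 0 (Nat.zero_le m)).symm.trans (h2 0 (Nat.zero_le m)))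
  -- With identity transitions, staying at `a` up to time `m` has probability `p a`, and these
  -- disjoint events exhaust the total mass.
  have hreal : P.real (⋃ a, E a) = 1 := by
    rw [measureReal_iUnion_fintype hdisj hEm, ← D.p_sum]
    refine Finset.sum_congr rfl fun a _ => ?_
    rw [hX.law m fun _ => a]
    simp
  have hone : P (⋃ a, E a) = 1 := by
    rw [← ofReal_measureReal, hreal, ENNReal.ofReal_one]
  have hae : ∀ᵐ ω ∂P, ω ∈ ⋃ a, E a :=
    (mem_ae_iff_prob_eq_one (MeasurableSet.iUnion hEm)).2 hone
  filter_upwards [hae] with ω hω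
  obtain ⟨a, ha⟩ := Set.mem_iUnion.1 hω
  rw [ha m le_rfl, ha 0 (Nat.zero_le m)]

lemma Q_eq_zero (h0 : D.lam 0 = 0) : D.Q = 0 := by
  have hd : ∀ i, D.Q i i = 0 := fun i => by
    have h1 := abs_Q_diag_le D 0 i
    rw [h0] at h1
    exact abs_eq_zero.1 (le_antisymm (by linarith) (abs_nonneg _))
  ext i j
  by_cases hij : i = j
  · rw [← hij, hd, Matrix.zero_apply]
  · have hnn : ∀ k, 0 ≤ D.Q i k := fun k => by
      by_cases hik : i = k
      · rw [← hik, hd]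
      · exact D.Q_offDiag i k hik
    exact (Finset.sum_eq_zero_iff_of_nonneg fun k _ => hnn k).1 (D.Q_rowSum i) j
      (Finset.mem_univ j)

lemma lam_nonneg (n : ℕ) : 0 ≤ D.lam n := by
  refine le_trans ?_ (D.lam_mono (Nat.zero_le n))
  rw [D.lam_zero]
  exact mul_nonneg zero_le_two (Real.iSup_nonneg fun i => abs_nonneg _)

/-- The first stage with a positive intensity. -/
lemma exists_first_stage : ∃ n, 0 < D.lam n ∧ ∀ m < n, D.lam m = 0 := by
  classical
  have hex : ∃ n, 0 < D.lam n := (D.lam_tendsto.eventually_gt_atTop 0).exists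
  exact ⟨Nat.find hex, Nat.find_spec hex, fun m hm =>
    le_antisymm (not_lt.1 (Nat.find_min hex hm)) (lam_nonneg m)⟩

/-- Either `n = 0`, or `λ_0 = 0`; the latter forces `Q = 0` and both sides are the identity. -/
lemma embeddedMatrix_eq {n : ℕ} (hfirst : ∀ m < n, D.lam m = 0) :
    1 + (D.lam 0 / 2)⁻¹ • D.Q = embeddedMatrix D n := by
  rcases Nat.eq_zero_or_pos n with rfl | hn
  · rfl
  · rw [embeddedMatrix, Q_eq_zero (hfirst 0 hn), smul_zero, smul_zero]

variable (hW : W.HasLaws D P)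

include hW

lemma isPoissonProcess_N : ∀ ℓ, ∃ r, IsPoissonProcess (W.N ℓ) r P
  | 0 => ⟨_, hW.poisson_zero⟩
  | ℓ + 1 => ⟨_, hW.poisson_succ ℓ⟩

lemma ae_isRegularPath : ∀ᵐ ω ∂P, IsRegularPath W ω := by
  choose r hr using isPoissonProcess_N hW
  filter_upwards [hW.brownian.cont, ae_all_iff.2 fun ℓ => (hr ℓ).mono,
    ae_all_iff.2 fun ℓ => (hr ℓ).zero, ae_all_iff.2 fun ℓ => (hr ℓ).ae_right] with ω h1 h2 h3 h4
  exact ⟨h1, h2, h3, h4⟩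

/-- The earlier sources have rate zero, so almost surely this one process is the whole superposition
at the first stage of positive intensity. -/
lemma isPoissonProcess_first {n : ℕ} (hfirst : ∀ m < n, D.lam m = 0) :
    IsPoissonProcess (W.N n) (D.lam n / 2).toNNReal P := by
  cases n with
  | zero => exact hW.poisson_zero
  | succ n =>
    have := hW.poisson_succ n
    rwa [hfirst n (Nat.lt_succ_self n), sub_zero] at this

lemma ae_N_eq_zero {n : ℕ} (hfirst : ∀ m < n, D.lam m = 0) :
    ∀ᵐ ω ∂P, ∀ m < n, ∀ t, W.N m t ω = 0 := by
  rw [ae_all_iff]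
  intro m
  by_cases hm : m < n
  · have hp := isPoissonProcess_first hW (n := m) fun j hj => hfirst j (hj.trans hm)
    filter_upwards [hp.ae_eq_zero (by rw [hfirst m hm, zero_div, Real.toNNReal_zero])] with ω hω _
    exact hω
  · exact ae_of_all _ fun ω h => absurd h hm

lemma ae_chain_const {n : ℕ} (hfirst : ∀ m < n, D.lam m = 0) (hn : n ≠ 0) :
    ∀ᵐ ω ∂P, ∀ k, W.X k ω = W.X 0 ω := by
  have hc := hW.chain
  rw [Q_eq_zero (hfirst 0 (Nat.pos_of_ne_zero hn)), smul_zero, add_zero] at hc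
  exact hc.ae_const

lemma sigma_le (s : Source) : W.sigma s ≤ m0 := by
  cases s with
  | brownian => exact (measurable_pi_lambda _ hW.brownian_measurable).comap_le
  | poisson ℓ =>
    obtain ⟨r, hr⟩ := isPoissonProcess_N hW ℓ
    exact (measurable_pi_lambda _ hr.measurable).comap_le
  | chain => exact (measurable_pi_lambda _ hW.chain.measurable).comap_le

lemma indepFun_N_X (ℓ : ℕ) :
    IndepFun (fun ω t => W.N ℓ t ω) (fun ω k => W.X k ω) P :=
  hW.indep.indep (i := .poisson ℓ) (j := .chain) (by simp)

lemma indepFun_B_N_X (ℓ : ℕ) :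
    IndepFun (fun ω t => W.B t ω) (fun ω => (fun t => W.N ℓ t ω, fun k => W.X k ω)) P := by
  have h := indep_iSup_of_disjoint (sigma_le hW) hW.indep
    (S := {Source.brownian}) (T := {Source.poisson ℓ, Source.chain}) (by simp)
  rw [iSup_singleton, iSup_pair] at h
  rw [IndepFun_iff_Indep]
  refine indep_of_indep_of_le_right h ?_
  exact (MeasurableSpace.comap_prodMk _ _).le

/-- Off a null set, the Brownian motion and a Poisson process of positive rate have regular
paths. -/
lemma exists_isRegularDrivers {ℓ : ℕ} {r : ℝ≥0} (hr : 0 < r) (hN : IsPoissonProcess (W.N ℓ) r P) :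
    ∃ (B : ℝ≥0 → Ω → ℝ) (A : ℝ≥0 → Ω → ℕ), IsRegularDrivers P B A W.X r ∧
      ∀ᵐ ω ∂P, (∀ t, B t ω = W.B t ω) ∧ ∀ t, A t ω = W.N ℓ t ω := by
  classical
  have hgood : ∀ᵐ ω ∂P, (Continuous fun t => W.B t ω) ∧ W.B 0 ω = 0 ∧
      (Monotone fun t => W.N ℓ t ω) ∧ W.N ℓ 0 ω = 0 ∧
      (∀ t, ∃ s, t < s ∧ W.N ℓ s ω = W.N ℓ t ω) ∧ ∀ k, ∃ t, W.N ℓ t ω = k := by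
    filter_upwards [hW.brownian.cont, hW.brownian.eval_zero_ae_eq_zero, hN.mono, hN.zero,
      hN.ae_right, hN.ae_surjective hr] with ω h1 h2 h3 h4 h5 h6
    exact ⟨h1, h2, h3, h4, h5, h6⟩
  -- The bad paths are enclosed in a measurable null set, on which they are replaced by regular
  -- ones: the zero path for `B`, and `⌊t⌋` for the arrivals. Measurability of `Γ` keeps the
  -- modified processes measurable.
  obtain ⟨Γ, hΓsub, hΓm, hΓ⟩ := exists_measurable_superset_of_null hgood
  set B : ℝ≥0 → Ω → ℝ := fun t ω => if ω ∈ Γ then 0 else W.B t ω with hB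
  set A : ℝ≥0 → Ω → ℕ := fun t ω => if ω ∈ Γ then ⌊t⌋₊ else W.N ℓ t ω with hA
  have hout : ∀ ω ∉ Γ, (Continuous fun t => W.B t ω) ∧ W.B 0 ω = 0 ∧
      (Monotone fun t => W.N ℓ t ω) ∧ W.N ℓ 0 ω = 0 ∧
      (∀ t, ∃ s, t < s ∧ W.N ℓ s ω = W.N ℓ t ω) ∧ ∀ k, ∃ t, W.N ℓ t ω = k := fun ω hω => by
    by_contra hneg
    exact hω (hΓsub hneg)
  have hBω : ∀ ω ∉ Γ, ∀ t, B t ω = W.B t ω := fun ω hω t => if_neg hω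
  have hAω : ∀ ω ∉ Γ, ∀ t, A t ω = W.N ℓ t ω := fun ω hω t => if_neg hω
  have hBin : ∀ ω ∈ Γ, ∀ t, B t ω = 0 := fun ω hω t => if_pos hω
  have hAin : ∀ ω ∈ Γ, ∀ t, A t ω = ⌊t⌋₊ := fun ω hω t => if_pos hω
  have hae : ∀ᵐ ω ∂P, ω ∉ Γ := measure_eq_zero_iff_ae_notMem.1 hΓ
  have hBae : (fun ω t => W.B t ω) =ᵐ[P] fun ω t => B t ω := by
    filter_upwards [hae] with ω hω
    exact funext fun t => (hBω ω hω t).symm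
  have hAae : (fun ω t => W.N ℓ t ω) =ᵐ[P] fun ω t => A t ω := by
    filter_upwards [hae] with ω hω
    exact funext fun t => (hAω ω hω t).symm
  refine ⟨B, A, ?_, ?_⟩
  · constructor
    · exact NNReal.coe_pos.2 hr
    · exact fun t => Measurable.ite hΓm measurable_const (hW.brownian_measurable t)
    · exact fun t => Measurable.ite hΓm measurable_const (hN.measurable t)
    · exact hW.chain.measurable
    · intro ω
      by_cases hω : ω ∈ Γ
      · simp only [hBin ω hω]
        exact continuous_const
      · simp only [hBω ω hω]
        exact (hout ω hω).1
    · intro ω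
      by_cases hω : ω ∈ Γ
      · exact hBin ω hω 0
      · rw [hBω ω hω]
        exact (hout ω hω).2.1
    · intro ω
      by_cases hω : ω ∈ Γ
      · simp only [hAin ω hω]
        exact Nat.floor_mono
      · simp only [hAω ω hω]
        exact (hout ω hω).2.2.1
    · intro ω
      by_cases hω : ω ∈ Γ
      · rw [hAin ω hω, Nat.floor_zero]
      · rw [hAω ω hω]
        exact (hout ω hω).2.2.2.1
    · intro ω t
      by_cases hω : ω ∈ Γ
      · simp only [hAin ω hω]
        obtain ⟨s, hs1, hs2⟩ := exists_between (Nat.lt_floor_add_one t)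
        refine ⟨s, hs1, (Nat.floor_eq_iff zero_le).2 ⟨(Nat.floor_le zero_le).trans hs1.le, hs2⟩⟩
      · simp only [hAω ω hω]
        exact (hout ω hω).2.2.2.2.1 t
    · intro ω k
      by_cases hω : ω ∈ Γ
      · exact ⟨k, by rw [hAin ω hω, Nat.floor_natCast]⟩
      · simp only [hAω ω hω]
        exact (hout ω hω).2.2.2.2.2 k
    · refine hW.brownian.toIsPreBrownianReal.congr fun t => ?_
      filter_upwards [hae] with ω hω
      exact (hBω ω hω t).symm
    · intro n t ht
      refine (hN.indep n t ht).congr fun i => ?_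
      filter_upwards [hae] with ω hω
      simp only [hAω ω hω]
    · intro t s
      rw [← hN.measure_eq t s]
      refine measure_congr ?_
      filter_upwards [hae] with ω hω
      refine propext ?_
      change A (t + s) ω = A t ω ↔ W.N ℓ (t + s) ω = W.N ℓ t ω
      rw [hAω ω hω, hAω ω hω]
    · refine (indepFun_B_N_X hW ℓ).congr hBae ?_
      filter_upwards [hAae] with ω hω
      simp only [hω]
    · exact (indepFun_N_X hW ℓ).congr hAae EventuallyEq.rfl
  · filter_upwards [hae] with ω hω
    exact ⟨hBω ω hω, hAω ω hω⟩

end Drivers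

end MMBM

namespace MMBM

/-! ### The generator of the down-crossing phase processes -/

section Generator

variable {S Ω : Type*} [Fintype S] [DecidableEq S] [MeasurableSpace S] [MeasurableSingletonClass S]
  {m0 : MeasurableSpace Ω} {P : Measure Ω} [IsProbabilityMeasure P] {X : ℕ → Ω → S}
  {ξ : ℕ → Ω → S → ℝ × ℝ} {p : S → ℝ} {K : Matrix S S ℝ} {om et : S → ℝ}
  {Z : ℝ≥0 → Ω → ℝ} {C : ℝ≥0 → Ω → S}

lemma isGenerator_downPhase (hc : IsCycleChain P X ξ p K om et) (hom : ∀ i, 0 < om i)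
    (het : ∀ i, 0 < et i) (hK : ∀ i j, 0 ≤ K i j) (hK1 : ∀ i, ∑ j, K i j = 1)
    (hY : ∀ᵐ ω ∂P, ∀ (x : ℝ≥0) (i : S), downPhase Z C x ω = i ↔ ω ∈ phaseHit X ξ x i) :
    IsGenerator P (downPhase Z C) (crossGenerator om et K) where
  offDiag := crossGenerator_offDiag hom
  rowSum := crossGenerator_rowSum hom het hK hK1
  absorbing x y hxy := ae_of_all _ fun ω => downPhase_eq_top_mono hxy
  markov m x hx i := by
    have h := measure_phaseHit hc hom het hK hK1 m (x := fun k => (x k : ℝ)) (fun k => (x k).2)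
      (fun a b hab => hx hab) i
    have h1 : P.real {ω | ∀ k ≤ m, downPhase Z C (x k) ω = i k} =
        P.real {ω | ∀ j ≤ m, ω ∈ phaseHit X ξ (x j) (i j)} := by
      refine measureReal_congr ?_
      filter_upwards [hY] with ω hω
      exact propext (forall₂_congr fun k _ => hω (x k) (i k))
    have h2 : P.real {ω | downPhase Z C (x 0) ω = i 0} = P.real (phaseHit X ξ (x 0) (i 0)) := by
      refine measureReal_congr ?_
      filter_upwards [hY] with ω hω
      exact propext (hω (x 0) (i 0))
    rw [h1, h2, h]

/-- A process that starts from each state with positive probability has at most one generator. -/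
lemma IsGenerator.unique {Y : ℝ≥0 → Ω → WithTop S} {U V : Matrix S S ℝ}
    (hU : IsGenerator P Y U) (hV : IsGenerator P Y V)
    (hpos : ∀ i : S, 0 < P.real {ω | Y 0 ω = i}) : V = U := by
  have hexp : ∀ i j : S, ∀ x : ℝ, 0 ≤ x →
      NormedSpace.exp (x • V) i j = NormedSpace.exp (x • U) i j := by
    intro i j x hx
    -- The Markov formula for the times `0, x` and the states `i, j` isolates the entry `(i, j)` of
    -- the exponential, up to the positive probability of starting at `i`.
    set y : ℕ → ℝ≥0 := fun k => if k = 0 then 0 else ⟨x, hx⟩ with hy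
    have hmono : Monotone y := by
      refine monotone_nat_of_le_succ fun k => ?_
      rcases Nat.eq_zero_or_pos k with rfl | hk
      · exact zero_le
      · simp only [hy, hk.ne', Nat.succ_ne_zero]
        exact le_rfl
    have h1 := hU.markov 1 y hmono fun k => if k = 0 then i else j
    have h2 := hV.markov 1 y hmono fun k => if k = 0 then i else j
    rw [h1] at h2
    have hy0 : y 0 = 0 := rfl
    have hy1 : (y (0 + 1) : ℝ) = x := rfl
    simp only [Finset.prod_range_one, hy0, hy1, NNReal.coe_zero, sub_zero, if_true, zero_add,
      one_ne_zero, if_false] at h2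
    exact (mul_left_cancel₀ (hpos i).ne' h2).symm
  ext i j
  exact le_antisymm (le_of_exp_smul_le i j fun x hx => (hexp i j x hx).le)
    (le_of_exp_smul_le i j fun x hx => (hexp i j x hx).ge)

lemma measure_downPhase_zero_pos (hc : IsCycleChain P X ξ p K om et) (hom : ∀ i, 0 < om i)
    (het : ∀ i, 0 < et i)
    (hY : ∀ᵐ ω ∂P, ∀ (x : ℝ≥0) (i : S), downPhase Z C x ω = i ↔ ω ∈ phaseHit X ξ x i)
    {i : S} (hi : 0 < p i) : 0 < P.real {ω | downPhase Z C 0 ω = i} := by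
  have h : P.real {ω | downPhase Z C 0 ω = i} = P.real (phaseHit X ξ 0 i) := by
    refine measureReal_congr ?_
    filter_upwards [hY] with ω hω
    exact propext (hω 0 i)
  rwa [h, measure_phaseHit_zero hc hom het]

end Generator

/-- On a set of full measure, all the down-crossing phase processes are the process of phases at
the first crossings of a single cycle chain. -/
lemma exists_isCycleChain {S Ω : Type*} [Fintype S] [DecidableEq S] [MeasurableSpace S]
    [MeasurableSingletonClass S] {m0 : MeasurableSpace Ω} {P : Measure Ω} [IsProbabilityMeasure P]
    {D : Params S} {W : Drivers S Ω} (hW : W.HasLaws D P) {n₀ : ℕ} (hn₀ : 0 < D.lam n₀)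
    (hfirst : ∀ m < n₀, D.lam m = 0) :
    ∃ ξ : ℕ → Ω → S → ℝ × ℝ,
      IsCycleChain P W.X ξ D.p (embeddedMatrix D n₀) (omegaRate D n₀) (etaRate D n₀) ∧
      (∀ᵐ ω ∂P, ∀ (x : ℝ≥0) (i : S),
        downPhase (R D W) (J W) x ω = i ↔ ω ∈ phaseHit W.X ξ x i) ∧
      ∀ n, 0 < D.lam n → ∀ᵐ ω ∂P, ∀ (x : ℝ≥0) (i : S),
        downPhase (Rn D W n) (fun t ω => (Jn D W n t ω).2) x ω = i ↔ ω ∈ phaseHit W.X ξ x i := by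
  have hr : 0 < (D.lam n₀ / 2).toNNReal := Real.toNNReal_pos.2 (half_pos hn₀)
  have hN := isPoissonProcess_first hW hfirst
  obtain ⟨B, A, hreg, hBA⟩ := exists_isRegularDrivers hW hr hN
  have hq : (((D.lam n₀ / 2).toNNReal : ℝ≥0) : ℝ) = D.lam n₀ / 2 :=
    Real.coe_toNNReal _ (half_pos hn₀).le
  have hchain : IsMarkovChain W.X D.p (embeddedMatrix D n₀) P := by
    rw [← embeddedMatrix_eq hfirst]
    exact hW.chain
  have hom := fun i => omegaRate_pos hn₀ i
  have het := fun i => etaRate_pos hn₀ i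
  have hc := isCycleChain_cycleBlock hreg D.μ D.σ hchain hom het D.σ_pos omegaRate_sub_etaRate
    (fun i => by rw [omegaRate_mul_etaRate hn₀, hq]; ring)
  have hconst : ∀ᵐ ω ∂P, n₀ ≠ 0 → ∀ k, W.X k ω = W.X 0 ω := by
    by_cases h0 : n₀ = 0
    · exact ae_of_all _ fun ω h => absurd h0 h
    · filter_upwards [ae_chain_const hW hfirst h0] with ω hω _
      exact hω
  have hgood : ∀ᵐ ω ∂P, IsRegularPath W ω ∧ (∀ t, B t ω = W.B t ω) ∧
      (∀ t, A t ω = M W n₀ t ω) ∧ (∀ k, ∃ t, k ≤ M W n₀ t ω) ∧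
      ∀ k, Xn W n₀ k ω = W.X k ω := by
    filter_upwards [ae_isRegularPath hW, hBA, ae_N_eq_zero hW hfirst, hconst]
      with ω hp ⟨hB, hA⟩ hzero hX
    have hM : ∀ t, A t ω = M W n₀ t ω := fun t => by
      rw [hA, M, Finset.sum_range_succ, Finset.sum_eq_zero fun ℓ hℓ =>
        hzero ℓ (Finset.mem_range.1 hℓ) t, zero_add]
    have hub : ∀ k, ∃ t, k ≤ M W n₀ t ω := fun k => by
      obtain ⟨t, ht⟩ := hreg.surj_A ω k
      exact ⟨t, by rw [← hM, ht]⟩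
    -- If `n₀ = 0`, exactly `k` arrivals have occurred at the `k`-th epoch, so the observed phase is
    -- `X k`. If `n₀ > 0`, the chain is constant and the index does not matter.
    refine ⟨hp, hB, hM, hub, fun k => ?_⟩
    by_cases h0 : n₀ = 0
    · subst h0
      have hθ : theta W 0 k ω = epoch A k ω := by simp only [epoch, theta, hM]
      rw [Xn, J, ← hM, hθ, arrival_epoch hreg]
    · rw [Xn, J, hX h0, hX h0 k]
  refine ⟨_, hc, ?_, fun n hn => ?_⟩
  · filter_upwards [hgood] with ω ⟨hp, hB, hA, hub, hX⟩ x i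
    rw [downPhase_R_eq_iff hp hub, mem_phaseHit_iff hp hub hB hA hX]
  · have hle : n₀ ≤ n := by
      by_contra! hlt
      rw [hfirst n hlt] at hn
      exact lt_irrefl _ hn
    filter_upwards [hgood, ae_not_tendsto_descent hc hom het] with ω ⟨hp, hB, hA, hub, hX⟩ hdesc x i
    simp only [cycleBlock_eq_L_H hp hub hB hA hX] at hdesc
    have hubn : ∀ k, ∃ t, k ≤ M W n t ω := fun k => by
      obtain ⟨t, ht⟩ := hub k
      exact ⟨t, ht.trans (M_stage_mono hle t)⟩
    -- The MMBM mediates between the stages: the criterion for the fluid is that for `R` cut at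
    -- stage `n`, and `R` may equally be cut at stage `n₀`, where the cycle chain lives.
    rw [downPhase_Rn_eq_iff hp hubn hn (exists_lt_chi hp hubn hn hle hub hdesc),
      ← downPhase_R_eq_iff hp hubn, downPhase_R_eq_iff hp hub,
      mem_phaseHit_iff hp hub hB hA hX]

end MMBM

end

theorem theorem3 {S Ω : Type*} [Fintype S] [DecidableEq S] [MeasurableSpace S]
    [MeasurableSingletonClass S] [MeasurableSpace Ω] (P : Measure Ω) [IsProbabilityMeasure P]
    (D : MMBM.Params S) (W : MMBM.Drivers S Ω) (hW : W.HasLaws D P) :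
    ∃ U : Matrix S S ℝ,
      -- `U` is the generator of the down-crossing phase process of the modulated Brownian motion
      MMBM.IsGenerator P (MMBM.downPhase (MMBM.R D W) (MMBM.J W)) U ∧
      ((∀ i, 0 < D.p i) → ∀ V : Matrix S S ℝ,
        MMBM.IsGenerator P (MMBM.downPhase (MMBM.R D W) (MMBM.J W)) V → V = U) ∧
      -- it solves the quadratic equation
      MMBM.IsQuadraticSolution D U ∧
      ∀ n : ℕ, 0 < D.lam n →
        -- for each `n` it is the generator of the down-crossing phase process of the fluid process
        MMBM.IsGenerator P
          (MMBM.downPhase (MMBM.Rn D W n) (fun t ω => (MMBM.Jn D W n t ω).2)) U ∧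
        ((∀ i, 0 < D.p i) → ∀ V : Matrix S S ℝ,
          MMBM.IsGenerator P
            (MMBM.downPhase (MMBM.Rn D W n) (fun t ω => (MMBM.Jn D W n t ω).2)) V → V = U) ∧
        -- and it is given by the minimal nonnegative solution of the Riccati equation
        ∃ Ψ : Matrix S S ℝ, MMBM.IsMinimalRiccatiSolution D n Ψ ∧
          U = D.lam n • (MMBM.rMinusInv D n * (Ψ - 1)) := by
  -- `U` is built once, at this stage. Nothing about the laws of the cycles at the other stages is
  -- used.
  obtain ⟨n₀, hn₀, hfirst⟩ := MMBM.exists_first_stage (D := D)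
  obtain ⟨ξ, hc, hR, hRn⟩ := MMBM.exists_isCycleChain hW hn₀ hfirst
  have hom := fun i => MMBM.omegaRate_pos hn₀ i
  have het := fun i => MMBM.etaRate_pos hn₀ i
  have hK := MMBM.embeddedMatrix_nonneg hn₀
  have hK1 := fun i => MMBM.embeddedMatrix_rowSum (D := D) (n := n₀) i
  have hsol := MMBM.isFluidSolution_returnMatrix hom het hK hK1
  have hgen := MMBM.isGenerator_downPhase hc hom het hK hK1 hR
  refine ⟨_, hgen, fun hp V hV => hgen.unique hV fun i =>
      MMBM.measure_downPhase_zero_pos hc hom het hR (hp i),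
    (MMBM.isFluidSolution_iff_isQuadraticSolution hn₀ _ _ fun i j => rfl).1 hsol, fun n hn => ?_⟩
  have hgen' := MMBM.isGenerator_downPhase hc hom het hK hK1 (hRn n hn)
  exact ⟨hgen', fun hp V hV => hgen'.unique hV fun i =>
      MMBM.measure_downPhase_zero_pos hc hom het (hRn n hn) (hp i),
    MMBM.isMinimalRiccatiSolution_of_isFluidSolution hn₀
      (fun i j => MMBM.returnMatrix_nonneg i j) hsol
      (fun Φ hΦ hΦs => MMBM.returnMatrix_le hom het hK hK1 hΦ hΦs) (fun i j => rfl) hn⟩
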